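/- Let $M$ be a closed smooth $n$-manifold (compact, Hausdorff, without boundary). For a smooth Riemannian metric $g$ on $M$ and $f\in C^\infty(M)$ put $$\mathcal F(g,f)=\int_M (R+|\nabla f|^2)\,e^{-f}\,dV,$$ where $R$ is the scalar curvature of $g$ and $dV$ its Riemannian volume measure. Let $v_{ij}$ be a smooth symmetric covariant 2-tensor field and $h$ a smooth function on $M$, and write $v=g^{ij}v_{ij}$ for the trace. Let $(g_t,f_t)$ be any one-parameter family of smooth Riemannian metrics and functions on $M$ which for $t$ in a neighbourhood of $0$ is smooth jointly in $(t,x)$, with $(g_0,f_0)=(g,f)$ and $$\frac{\partial}{\partial t}\Big|_{t=0}g_t=v_{ij},\qquad \frac{\partial}{\partial t}\Big|_{t=0}f_t=h .$$ Then $\delta R:=\frac{\partial}{\partial t}\big|_{t=0}R(g_t)$ exists at every point of $M$ and $$\delta R=-\Delta v+\nabla_i\nabla_j v_{ij}-R_{ij}v_{ij},$$ and $t\mapsto\mathcal F(g_t,f_t)$ is differentiable at $t=0$ with derivative $$\delta\mathcal F(v_{ij},h)=\int_M e^{-f}\Big[-v_{ij}\big(R_{ij}+\nabla_i\nabla_j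 f\big)+\Big(\frac v2-h\Big)\big(2\Delta f-|\nabla f|^2+R\big)\Big]\,dV .$$ The integrand on the right is integrable with respect to $dV$, and for all $t$ near $0$ the integrand of $\mathcal F(g_t,f_t)$ is integrable with respect to the volume measure of $g_t$. On the right-hand sides all curvatures, covariant derivatives, the Laplacian $\Delta=g^{ij}\nabla_i\nabla_j$, norms and $dV$ are those of $g$; repeated lower indices are contracted with $g^{-1}$ (e.g. $\nabla_i\nabla_jv_{ij}=g^{ik}g^{jl}\nabla_k\nabla_lv_{ij}$), $R_{ij}$ is the Ricci tensor, and the sign of curvature is such that round spheres have positive $R$. -/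

import Mathlib

open Set Filter Topology MeasureTheory Bundle Manifold
open scoped Manifold ContDiff

noncomputable section

namespace Perelman

/-! ### Tensor calculus in a coordinate domain of `ℝⁿ`

`G` denotes the component matrix `y ↦ (g_ij(y))` of a metric, `V` the component matrix of a
covariant 2-tensor and `u` a function, all expressed in the same coordinates. -/

section Coordinates

variable {n : ℕ}

/-- The partial derivative `∂u/∂xⁱ`. -/
def pd (i : Fin n) (u : EuclideanSpace ℝ (Fin n) → ℝ) (y : EuclideanSpace ℝ (Fin n)) : ℝ :=
  fderiv ℝ u y (EuclideanSpace.single i 1)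

/-- `Γᵏ_ij = ½ gᵏˡ (∂_i g_jl + ∂_j g_il - ∂_l g_ij)`. -/
def christoffel (G : EuclideanSpace ℝ (Fin n) → Matrix (Fin n) (Fin n) ℝ) (k i j : Fin n)
    (y : EuclideanSpace ℝ (Fin n)) : ℝ :=
  (1 / 2) * ∑ l, (G y)⁻¹ k l *
    (pd i (fun z => G z j l) y + pd j (fun z => G z i l) y - pd l (fun z => G z i j) y)

/-- `R_ijlʰ`, the components of the curvature tensor:
`R(∂_i, ∂_j) ∂_l = ∇_i ∇_j ∂_l - ∇_j ∇_i ∂_l = R_ijlʰ ∂_h`. -/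
def riemannCoord (G : EuclideanSpace ℝ (Fin n) → Matrix (Fin n) (Fin n) ℝ) (i j l h : Fin n)
    (y : EuclideanSpace ℝ (Fin n)) : ℝ :=
  pd i (christoffel G h j l) y - pd j (christoffel G h i l) y
    + ∑ m, (christoffel G h i m y * christoffel G m j l y
      - christoffel G h j m y * christoffel G m i l y)

/-- `R_jl = R_ijlⁱ`; with this sign round spheres have positive Ricci curvature. -/
def ricciCoord (G : EuclideanSpace ℝ (Fin n) → Matrix (Fin n) (Fin n) ℝ) (j l : Fin n)
    (y : EuclideanSpace ℝ (Fin n)) : ℝ :=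
  ∑ i, riemannCoord G i j l i y

/-- `R = gʲˡ R_jl`. -/
def scalarCoord (G : EuclideanSpace ℝ (Fin n) → Matrix (Fin n) (Fin n) ℝ)
    (y : EuclideanSpace ℝ (Fin n)) : ℝ :=
  ∑ j, ∑ l, (G y)⁻¹ j l * ricciCoord G j l y

/-- `∇_i ∇_j u = ∂_i ∂_j u - Γᵏ_ij ∂_k u`. -/
def hessCoord (G : EuclideanSpace ℝ (Fin n) → Matrix (Fin n) (Fin n) ℝ)
    (u : EuclideanSpace ℝ (Fin n) → ℝ) (i j : Fin n) (y : EuclideanSpace ℝ (Fin n)) : ℝ :=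
  pd i (pd j u) y - ∑ k, christoffel G k i j y * pd k u y

/-- `Δu = gⁱʲ ∇_i ∇_j u`. -/
def laplacianCoord (G : EuclideanSpace ℝ (Fin n) → Matrix (Fin n) (Fin n) ℝ)
    (u : EuclideanSpace ℝ (Fin n) → ℝ) (y : EuclideanSpace ℝ (Fin n)) : ℝ :=
  ∑ i, ∑ j, (G y)⁻¹ i j * hessCoord G u i j y

/-- `|∇u|² = gⁱʲ ∂_i u ∂_j u`. -/
def gradSqCoord (G : EuclideanSpace ℝ (Fin n) → Matrix (Fin n) (Fin n) ℝ)
    (u : EuclideanSpace ℝ (Fin n) → ℝ) (y : EuclideanSpace ℝ (Fin n)) : ℝ :=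
  ∑ i, ∑ j, (G y)⁻¹ i j * (pd i u y * pd j u y)

/-- The trace `gⁱʲ A_ij` at a point. -/
def traceCoord (G₀ A : Matrix (Fin n) (Fin n) ℝ) : ℝ :=
  ∑ i, ∑ j, G₀⁻¹ i j * A i j

/-- The full contraction `gⁱᵏ gʲˡ A_ij B_kl` at a point, written `A_ij B_ij` when both indices are
lowered in the formulas. -/
def pairingCoord (G₀ A B : Matrix (Fin n) (Fin n) ℝ) : ℝ :=
  ∑ i, ∑ j, ∑ k, ∑ l, G₀⁻¹ i k * G₀⁻¹ j l * (A i j * B k l)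

/-- `∇_k V_ij = ∂_k V_ij - Γᵐ_ki V_mj - Γᵐ_kj V_im`. -/
def covDerivCoord (G V : EuclideanSpace ℝ (Fin n) → Matrix (Fin n) (Fin n) ℝ) (k i j : Fin n)
    (y : EuclideanSpace ℝ (Fin n)) : ℝ :=
  pd k (fun z => V z i j) y
    - ∑ m, (christoffel G m k i y * V y m j + christoffel G m k j y * V y i m)

/-- `∇_k ∇_l V_ij`, the covariant derivative of the covariant 3-tensor `∇_l V_ij`. -/
def covDeriv₂Coord (G V : EuclideanSpace ℝ (Fin n) → Matrix (Fin n) (Fin n) ℝ) (k l i j : Fin n)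
    (y : EuclideanSpace ℝ (Fin n)) : ℝ :=
  pd k (covDerivCoord G V l i j) y
    - ∑ m, (christoffel G m k l y * covDerivCoord G V m i j y
      + christoffel G m k i y * covDerivCoord G V l m j y
      + christoffel G m k j y * covDerivCoord G V l i m y)

/-- The double divergence `gⁱᵏ gʲˡ ∇_k ∇_l V_ij`, written `∇_i ∇_j V_ij` in the formulas. -/
def divDivCoord (G V : EuclideanSpace ℝ (Fin n) → Matrix (Fin n) (Fin n) ℝ)
    (y : EuclideanSpace ℝ (Fin n)) : ℝ :=
  ∑ i, ∑ j, ∑ k, ∑ l, (G y)⁻¹ i k * (G y)⁻¹ j l * covDeriv₂Coord G V k l i j y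

end Coordinates

/-! ### Riemannian quantities on a manifold -/

section Geometry

/-- The type of (not necessarily continuous) covariant 2-tensor fields on `M`. -/
abbrev TwoTensor (n : ℕ) (M : Type*) [TopologicalSpace M]
    [ChartedSpace (EuclideanSpace ℝ (Fin n)) M] : Type _ :=
  (x : M) → TangentSpace (𝓡 n) x →L[ℝ] TangentSpace (𝓡 n) x →L[ℝ] ℝ

/-- The space of smooth Riemannian metrics on `M`. -/
abbrev Metric (n : ℕ) (M : Type*) [TopologicalSpace M]
    [ChartedSpace (EuclideanSpace ℝ (Fin n)) M] [IsManifold (𝓡 n) ∞ M] : Type _ :=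
  ContMDiffRiemannianMetric (𝓡 n) ∞ (EuclideanSpace ℝ (Fin n))
    (TangentSpace (𝓡 n) : M → Type _)

variable {n : ℕ} {M : Type*} [TopologicalSpace M] [ChartedSpace (EuclideanSpace ℝ (Fin n)) M]

/-- The components `T(∂_i, ∂_j)` of a covariant 2-tensor field in the chart around `p`, as functions
on the coordinate domain; `∂_i` is the image of `e_i` under the differential of the inverse
chart. -/
def components (T : TwoTensor n M) (p : M) (y : EuclideanSpace ℝ (Fin n)) :
    Matrix (Fin n) (Fin n) ℝ :=
  Matrix.of fun i j => T ((extChartAt (𝓡 n) p).symm y)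
    (mfderiv 𝓘(ℝ, EuclideanSpace ℝ (Fin n)) (𝓡 n) (extChartAt (𝓡 n) p).symm y
      (EuclideanSpace.single i (1 : ℝ)))
    (mfderiv 𝓘(ℝ, EuclideanSpace ℝ (Fin n)) (𝓡 n) (extChartAt (𝓡 n) p).symm y
      (EuclideanSpace.single j (1 : ℝ)))

/-- A function on `M` read in the chart around `p`. -/
def inChart (u : M → ℝ) (p : M) (y : EuclideanSpace ℝ (Fin n)) : ℝ :=
  u ((extChartAt (𝓡 n) p).symm y)

/-- A covariant 2-tensor field is smooth. -/
def IsSmoothTensor [IsManifold (𝓡 n) ∞ M] (T : TwoTensor n M) : Prop :=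
  ContMDiff (𝓡 n)
    ((𝓡 n).prod 𝓘(ℝ, EuclideanSpace ℝ (Fin n) →L[ℝ] EuclideanSpace ℝ (Fin n) →L[ℝ] ℝ)) ∞
    (fun x => TotalSpace.mk' (EuclideanSpace ℝ (Fin n) →L[ℝ] EuclideanSpace ℝ (Fin n) →L[ℝ] ℝ)
      (E := fun x : M => TangentSpace (𝓡 n) x →L[ℝ] TangentSpace (𝓡 n) x →L[ℝ] ℝ) x (T x))

variable [IsManifold (𝓡 n) ∞ M]

/-- The component matrix `(g_ij)` of the metric in the chart around `p`. -/
def metricComponents (g : Metric n M) (p : M) :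
    EuclideanSpace ℝ (Fin n) → Matrix (Fin n) (Fin n) ℝ :=
  components g.inner p

/-- The components `R_ij` of the Ricci tensor at `p`, in the chart around `p`. -/
def ricci (g : Metric n M) (p : M) : Matrix (Fin n) (Fin n) ℝ :=
  Matrix.of fun i j => ricciCoord (metricComponents g p) i j (extChartAt (𝓡 n) p p)

/-- The scalar curvature `R`. -/
def scalarCurvature (g : Metric n M) (p : M) : ℝ :=
  scalarCoord (metricComponents g p) (extChartAt (𝓡 n) p p)

/-- The components `∇_i ∇_j u` of the Hessian at `p`, in the chart around `p`. -/
def hess (g : Metric n M) (u : M → ℝ) (p : M) : Matrix (Fin n) (Fin n) ℝ :=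
  Matrix.of fun i j => hessCoord (metricComponents g p) (inChart u p) i j (extChartAt (𝓡 n) p p)

/-- The Laplace-Beltrami operator `Δu`. -/
def laplacian (g : Metric n M) (u : M → ℝ) (p : M) : ℝ :=
  laplacianCoord (metricComponents g p) (inChart u p) (extChartAt (𝓡 n) p p)

/-- `|∇u|²`. -/
def gradSq (g : Metric n M) (u : M → ℝ) (p : M) : ℝ :=
  gradSqCoord (metricComponents g p) (inChart u p) (extChartAt (𝓡 n) p p)

/-- The trace `gⁱʲ T_ij` of a covariant 2-tensor field. -/
def trace (g : Metric n M) (T : TwoTensor n M) (p : M) : ℝ :=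
  traceCoord (metricComponents g p (extChartAt (𝓡 n) p p)) (components T p (extChartAt (𝓡 n) p p))

/-- The contraction `T_ij A_ij` at `p` of a covariant 2-tensor field with a covariant 2-tensor
at `p` that is given by its components in the chart around `p`. -/
def pairing (g : Metric n M) (T : TwoTensor n M) (p : M) (A : Matrix (Fin n) (Fin n) ℝ) : ℝ :=
  pairingCoord (metricComponents g p (extChartAt (𝓡 n) p p))
    (components T p (extChartAt (𝓡 n) p p)) A

/-- The double divergence `∇_i ∇_j T_ij`. -/
def divDiv (g : Metric n M) (T : TwoTensor n M) (p : M) : ℝ :=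
  divDivCoord (metricComponents g p) (components T p) (extChartAt (𝓡 n) p p)

/-- `(γ t, φ t)` is a variation of `(g, f)` with `δg = v` and `δf = h`: a one-parameter family of
metrics and functions which for small `t` is smooth in `(t, x)` jointly, which is `(g, f)` at
`t = 0`, and whose `t`-derivative at `t = 0` is `(v, h)`. -/
structure IsVariation (g : Metric n M) (f : M → ℝ) (v : TwoTensor n M) (h : M → ℝ)
    (γ : ℝ → Metric n M) (φ : ℝ → M → ℝ) : Prop where
  metric_zero : γ 0 = g
  function_zero : φ 0 = f
  smooth : ∃ ε : ℝ, 0 < ε ∧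
    ContMDiffOn (𝓘(ℝ, ℝ).prod (𝓡 n))
      ((𝓡 n).prod 𝓘(ℝ, EuclideanSpace ℝ (Fin n) →L[ℝ] EuclideanSpace ℝ (Fin n) →L[ℝ] ℝ)) ∞
      (fun q : ℝ × M =>
        TotalSpace.mk' (EuclideanSpace ℝ (Fin n) →L[ℝ] EuclideanSpace ℝ (Fin n) →L[ℝ] ℝ)
          (E := fun x : M => TangentSpace (𝓡 n) x →L[ℝ] TangentSpace (𝓡 n) x →L[ℝ] ℝ)
          q.2 ((γ q.1).inner q.2))
      (Ioo (-ε) ε ×ˢ univ) ∧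
    ContMDiffOn (𝓘(ℝ, ℝ).prod (𝓡 n)) 𝓘(ℝ, ℝ) ∞ (fun q : ℝ × M => φ q.1 q.2)
      (Ioo (-ε) ε ×ˢ univ)
  metric_deriv : ∀ (x : M) (X Y : TangentSpace (𝓡 n) x),
    HasDerivAt (fun t => (γ t).inner x X Y) (v x X Y) 0
  function_deriv : ∀ x : M, HasDerivAt (fun t => φ t x) (h x) 0

variable [MeasurableSpace M]

/-- The measure `√det(g_ij) dx¹ ⋯ dxⁿ` of the chart around `p`, as a measure on `M` that is carried
by the domain of that chart. -/
def chartVolume (g : Metric n M) (p : M) : Measure M :=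
  (((volume : Measure (EuclideanSpace ℝ (Fin n))).restrict (extChartAt (𝓡 n) p).target).withDensity
    fun y => ENNReal.ofReal (Real.sqrt (metricComponents g p y).det)).map (extChartAt (𝓡 n) p).symm

/-- The Riemannian volume measure `dV`. The measures `√det(g_ij) dx¹ ⋯ dxⁿ` of two charts agree on
the overlap of their domains, so they glue to one measure on `M`; this is the least measure that
dominates all of them. -/
def volumeMeasure (g : Metric n M) : Measure M :=
  ⨆ p : M, chartVolume g p

/-- If a measure on a compact manifold is `√det(g_ij) dx¹ ⋯ dxⁿ` in each chart, then it is
`volumeMeasure g`. -/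
theorem volumeMeasure_eq [CompactSpace M] [BorelSpace M] (g : Metric n M) (μ : Measure M)
    (hμ : ∀ p : M, μ.restrict (chartAt (EuclideanSpace ℝ (Fin n)) p).source = chartVolume g p) :
    volumeMeasure g = μ := by
  classical
  apply le_antisymm
  · exact iSup_le fun p => (hμ p) ▸ Measure.restrict_le_self
  · obtain ⟨t, ht⟩ := isCompact_univ.elim_finite_subcover
      (fun p : M => (chartAt (EuclideanSpace ℝ (Fin n)) p).source)
      (fun p => (chartAt _ p).open_source)
      (fun x _ => mem_iUnion.2 ⟨x, mem_chart_source _ x⟩)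
    have key : ∀ t : Finset M, μ.restrict (⋃ i ∈ t, (chartAt (EuclideanSpace ℝ (Fin n)) i).source) ≤ volumeMeasure g := by
      intro t
      induction t using Finset.induction_on with
      | empty => simp [Measure.zero_le]
      | insert a s ha ih =>
        rw [Finset.set_biUnion_insert]
        refine Measure.le_iff.2 fun A hA => ?_
        set U := (chartAt (EuclideanSpace ℝ (Fin n)) a).source
        have hU : MeasurableSet U := (chartAt (EuclideanSpace ℝ (Fin n)) a).open_source.measurableSet
        rw [Measure.restrict_apply hA, ← measure_inter_add_sdiff A hU,
          ← measure_inter_add_sdiff _ hU]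
        refine add_le_add ?_ ?_
        · have h1 : chartVolume g a ≤ volumeMeasure g := le_iSup (chartVolume g) a
          have h2 := h1 (A ∩ U)
          rw [← hμ a, Measure.restrict_apply (hA.inter hU)] at h2
          exact (measure_mono (by grind)).trans h2
        · have h2 := ih (A \ U)
          rw [Measure.restrict_apply (hA.diff hU)] at h2
          exact (measure_mono (by grind)).trans h2
    have := key t
    rwa [univ_subset_iff.1 ht, Measure.restrict_univ] at this

/-- The integrand `(R + |∇f|²) e^{-f}`. -/
def functionalIntegrand (g : Metric n M) (f : M → ℝ) (x : M) : ℝ :=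
  (scalarCurvature g x + gradSq g f x) * Real.exp (-f x)

/-- `𝓕(g, f) = ∫_M (R + |∇f|²) e^{-f} dV`. -/
def functional (g : Metric n M) (f : M → ℝ) : ℝ :=
  ∫ x, functionalIntegrand g f x ∂(volumeMeasure g)

/-- The integrand
`e^{-f} [-v_ij (R_ij + ∇_i ∇_j f) + (v / 2 - h) (2 Δf - |∇f|² + R)]`, where `v = gⁱʲ v_ij`. -/
def variationIntegrand (g : Metric n M) (f : M → ℝ) (v : TwoTensor n M) (h : M → ℝ) (x : M) : ℝ :=
  Real.exp (-f x) *
    (-pairing g v x (ricci g x + hess g f x)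
      + (trace g v x / 2 - h x) * (2 * laplacian g f x - gradSq g f x + scalarCurvature g x))

end Geometry

end Perelman

end

/-! Everything rests on three pointwise variations and one integration by parts. Differentiating the
lowered Christoffel formula shows that δΓᵏ_ij = ½ gᵏᵃ(∇_i v_ja + ∇_j v_ia − ∇_a v_ij) is a tensor.
Palatini's identity δR_jl = ∇_i δΓⁱ_jl − ∇_j δΓⁱ_il, traced with g, gives −Δv + ∇_i∇_j v_ij
(`trace_dRicci`), and δg⁻¹ = −g⁻¹vg⁻¹ contributes −R_ij v_ij (`hasDerivAt_scalarCoord`). In the same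
way δ|∇f|² = −v(∇f,∇f) + 2⟨∇f,∇h⟩, while Jacobi's formula gives δ(dV) = (v/2) dV.

Multiplied by e^{-f}, these add up to the asserted integrand plus a total divergence,
`divergenceTerm` (`hasDerivAt_functionalIntegrand`). That term carries the second derivatives from v
over to w = e^{-f} and the derivative from h over to e^{-f}. Since ∇²e^{-f} = e^{-f}(∇f⊗∇f − ∇²f),
the term v(∇f,∇f) cancels and −v_ij∇_i∇_j f appears in its place.

Curvature at x is read in the chart around x, so work in one fixed chart needs invariance under
transition maps. The Christoffel law follows from uniqueness of the Levi-Civita connection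
(`jac_mul_connection`); the laws for curvature and Hessian follow from it. The double divergence is
never transformed directly: δR and R_ij v_ij are chart independent, hence so is −Δv + ∇_i∇_j v_ij
(`scalarVariation_eq`).

A finite partition of unity then reduces both analytic steps, differentiation under the integral
sign and the vanishing of the integral of a divergence, to a compact subset of a coordinate domain
in ℝⁿ. -/

open scoped Matrix

noncomputable section

namespace Perelman

/-! ### Partial derivatives of functions on ℝⁿ. -/

section PartialDerivatives

variable {n : ℕ} {U : Set (EuclideanSpace ℝ (Fin n))} {y : EuclideanSpace ℝ (Fin n)}
  {u w : EuclideanSpace ℝ (Fin n) → ℝ}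

theorem pd_add (i : Fin n) (hu : DifferentiableAt ℝ u y) (hw : DifferentiableAt ℝ w y) :
    pd i (fun z => u z + w z) y = pd i u y + pd i w y := by
  simp [pd, fderiv_fun_add hu hw]

theorem pd_sub (i : Fin n) (hu : DifferentiableAt ℝ u y) (hw : DifferentiableAt ℝ w y) :
    pd i (fun z => u z - w z) y = pd i u y - pd i w y := by
  simp [pd, fderiv_fun_sub hu hw]

theorem pd_mul (i : Fin n) (hu : DifferentiableAt ℝ u y) (hw : DifferentiableAt ℝ w y) :
    pd i (fun z => u z * w z) y = pd i u y * w y + u y * pd i w y := by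
  simp [pd, fderiv_fun_mul hu hw]
  ring

theorem pd_const_mul (i : Fin n) (c : ℝ) (hu : DifferentiableAt ℝ u y) :
    pd i (fun z => c * u z) y = c * pd i u y := by
  rw [pd_mul i (differentiableAt_const c) hu]
  simp [pd]

theorem pd_const (i : Fin n) (c : ℝ) : pd i (fun _ => c) y = 0 := by
  simp [pd]

theorem pd_sum {ι : Type*} (s : Finset ι) (i : Fin n) {u : ι → EuclideanSpace ℝ (Fin n) → ℝ}
    (hu : ∀ a ∈ s, DifferentiableAt ℝ (u a) y) :
    pd i (fun z => ∑ a ∈ s, u a z) y = ∑ a ∈ s, pd i (u a) y := by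
  simp [pd, fderiv_fun_sum hu]

theorem pd_congr_of_eventuallyEq (i : Fin n) (h : u =ᶠ[𝓝 y] w) : pd i u y = pd i w y := by
  rw [pd, pd, h.fderiv_eq]

theorem pd_congr (i : Fin n) (hU : IsOpen U) (hy : y ∈ U) (h : ∀ z ∈ U, u z = w z) :
    pd i u y = pd i w y :=
  pd_congr_of_eventuallyEq i (by filter_upwards [hU.mem_nhds hy] with z hz using h z hz)

theorem _root_.ContDiffOn.pd (hU : IsOpen U) (hu : ContDiffOn ℝ ∞ u U) (i : Fin n) :
    ContDiffOn ℝ ∞ (pd i u) U :=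
  (hu.fderiv_of_isOpen hU (by simp)).clm_apply contDiffOn_const

theorem diffAt (hU : IsOpen U) (hy : y ∈ U) (hu : ContDiffOn ℝ ∞ u U) : DifferentiableAt ℝ u y :=
  (hu.contDiffAt (hU.mem_nhds hy)).differentiableAt (by simp)

theorem fderiv_pd (hU : IsOpen U) (hy : y ∈ U) (hu : ContDiffOn ℝ ∞ u U) (i j : Fin n) :
    pd i (pd j u) y
      = fderiv ℝ (fderiv ℝ u) y (EuclideanSpace.single i 1) (EuclideanSpace.single j 1) := by
  have h : DifferentiableAt ℝ (fderiv ℝ u) y :=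
    ((hu.fderiv_of_isOpen (m := ∞) hU (by simp)).contDiffAt (hU.mem_nhds hy)).differentiableAt
      (by simp)
  have h2 : HasFDerivAt (fun z => fderiv ℝ u z (EuclideanSpace.single j 1))
      ((fderiv ℝ (fderiv ℝ u) y).flip (EuclideanSpace.single j 1)) y := by
    simpa using h.hasFDerivAt.clm_apply (hasFDerivAt_const (EuclideanSpace.single j (1 : ℝ)) y)
  have h3 : pd j u = fun z => fderiv ℝ u z (EuclideanSpace.single j 1) := rfl
  rw [h3, pd, h2.fderiv]
  rfl

theorem pd_comm (hU : IsOpen U) (hy : y ∈ U) (hu : ContDiffOn ℝ ∞ u U) (i j : Fin n) :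
    pd i (pd j u) y = pd j (pd i u) y := by
  rw [fderiv_pd hU hy hu, fderiv_pd hU hy hu]
  exact ((hu.contDiffAt (hU.mem_nhds hy)).isSymmSndFDerivAt
    (by rw [minSmoothness_of_isRCLikeNormedField]; exact WithTop.coe_le_coe.2 le_top)) _ _

theorem hasDerivAt_line_pd (hu : DifferentiableAt ℝ u y) (i : Fin n) :
    HasDerivAt (fun t : ℝ => u (y + t • EuclideanSpace.single i (1 : ℝ))) (pd i u y) 0 :=
  hu.hasFDerivAt.hasLineDerivAt _

theorem fderiv_apply_eq_sum_pd (v : EuclideanSpace ℝ (Fin n)) :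
    fderiv ℝ u y v = ∑ i, v i * pd i u y := by
  have hv : v = ∑ i, v i • EuclideanSpace.single i (1 : ℝ) := by
    ext j
    simp [Finset.sum_apply, Pi.single_apply]
  conv_lhs => rw [hv]
  simp [pd]

end PartialDerivatives

/-! ### Matrix calculus: determinants, inverses, and the connection as matrices. -/

section MatrixCalculus

variable {n : ℕ}

/-- Jacobi's formula, with the adjugate so that no invertibility is needed. It serves the volume
density twice: along coordinate lines and along the variation. -/
theorem hasDerivAt_det {A : ℝ → Matrix (Fin n) (Fin n) ℝ} {A' : Matrix (Fin n) (Fin n) ℝ} {t : ℝ}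
    (hA : ∀ i j, HasDerivAt (fun s => A s i j) (A' i j) t) :
    HasDerivAt (fun s => (A s).det) ((A t).adjugate * A').trace t := by
  have h : HasDerivAt (fun s => (A s).det)
      (∑ σ : Equiv.Perm (Fin n), ((Equiv.Perm.sign σ : ℤ) : ℝ) *
        ∑ k, (∏ i ∈ Finset.univ.erase k, A t (σ i) i) * A' (σ k) k) t := by
    simp only [Matrix.det_apply']
    refine HasDerivAt.fun_sum fun σ _ => HasDerivAt.const_mul _ ?_
    simpa [smul_eq_mul] using HasDerivAt.fun_finsetProd (u := Finset.univ)
      (f := fun i s => A s (σ i) i) fun i _ => hA (σ i) i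
  convert h using 1
  -- By Cramer's rule the trace is the sum over k of the determinant with column k differentiated,
  -- which is the product rule applied to the Leibniz expansion.
  have h1 : ((A t).adjugate * A').trace = ∑ k, ((A t).updateCol k (fun j => A' j k)).det := by
    simp only [Matrix.trace, Matrix.diag, ← Matrix.cramer_apply]
    refine Finset.sum_congr rfl fun k _ => ?_
    rw [Matrix.cramer_eq_adjugate_mulVec]
    rfl
  rw [h1]
  simp only [Matrix.det_apply', Finset.mul_sum]
  rw [Finset.sum_comm]
  refine Finset.sum_congr rfl fun σ _ => Finset.sum_congr rfl fun k _ => ?_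
  congr 1
  rw [← Finset.mul_prod_erase _ _ (Finset.mem_univ k), mul_comm]
  congr 1
  · refine Finset.prod_congr rfl fun i hi => ?_
    rw [Matrix.updateCol_ne (Finset.ne_of_mem_erase hi)]
  · simp

/-- The entrywise partial derivative of a matrix-valued function. -/
def pdM (k : Fin n) (A : EuclideanSpace ℝ (Fin n) → Matrix (Fin n) (Fin n) ℝ)
    (y : EuclideanSpace ℝ (Fin n)) : Matrix (Fin n) (Fin n) ℝ :=
  Matrix.of fun i j => pd k (fun z => A z i j) y

/-- All entries of a matrix-valued function are smooth on `U`. -/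
def SmoothMatOn (A : EuclideanSpace ℝ (Fin n) → Matrix (Fin n) (Fin n) ℝ)
    (U : Set (EuclideanSpace ℝ (Fin n))) : Prop :=
  ∀ i j, ContDiffOn ℝ ∞ (fun z => A z i j) U

variable {U : Set (EuclideanSpace ℝ (Fin n))} {y : EuclideanSpace ℝ (Fin n)}
  {A B : EuclideanSpace ℝ (Fin n) → Matrix (Fin n) (Fin n) ℝ}

theorem SmoothMatOn.mul (hA : SmoothMatOn A U) (hB : SmoothMatOn B U) :
    SmoothMatOn (fun z => A z * B z) U := fun i j => by
  simp only [Matrix.mul_apply]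
  exact ContDiffOn.sum fun k _ => (hA i k).mul (hB k j)

theorem SmoothMatOn.transpose (hA : SmoothMatOn A U) : SmoothMatOn (fun z => (A z)ᵀ) U :=
  fun i j => hA j i

theorem SmoothMatOn.pdM (hU : IsOpen U) (hA : SmoothMatOn A U) (k : Fin n) :
    SmoothMatOn (pdM k A) U :=
  fun i j => (hA i j).pd hU k

theorem contDiffOn_det {F : Type*} [NormedAddCommGroup F] [NormedSpace ℝ F] {s : Set F}
    {A : F → Matrix (Fin n) (Fin n) ℝ} (hA : ∀ i j, ContDiffOn ℝ ∞ (fun z => A z i j) s) :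
    ContDiffOn ℝ ∞ (fun z => (A z).det) s := by
  simp only [Matrix.det_apply']
  exact ContDiffOn.sum fun σ _ => contDiffOn_const.mul (contDiffOn_prod fun i _ => hA _ _)

/-- Entries of the inverse are quotients of determinants. The domain is an arbitrary normed space so
that the lemma also covers joint smoothness in (t, y). -/
theorem contDiffOn_inv {F : Type*} [NormedAddCommGroup F] [NormedSpace ℝ F] {s : Set F}
    {A : F → Matrix (Fin n) (Fin n) ℝ} (hA : ∀ i j, ContDiffOn ℝ ∞ (fun z => A z i j) s)
    (hdet : ∀ z ∈ s, (A z).det ≠ 0) (i j : Fin n) :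
    ContDiffOn ℝ ∞ (fun z => (A z)⁻¹ i j) s := by
  have h : ∀ z, (A z)⁻¹ i j = ((A z).det)⁻¹ * ((A z).updateRow j (Pi.single i 1)).det := by
    intro z
    rw [Matrix.inv_def, Matrix.smul_apply, Matrix.adjugate_apply, Ring.inverse_eq_inv', smul_eq_mul]
  simp only [h]
  refine ((contDiffOn_det hA).inv hdet).mul (contDiffOn_det fun a b => ?_)
  by_cases hab : a = j
  · subst hab
    simpa using contDiffOn_const
  · simpa [Matrix.updateRow_ne hab] using hA a b

theorem pdM_mul (hU : IsOpen U) (hy : y ∈ U) (hA : SmoothMatOn A U) (hB : SmoothMatOn B U)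
    (k : Fin n) : pdM k (fun z => A z * B z) y = pdM k A y * B y + A y * pdM k B y := by
  ext i j
  have h : ∀ a b, DifferentiableAt ℝ (fun z => A z a b) y := fun a b => diffAt hU hy (hA a b)
  have h' : ∀ a b, DifferentiableAt ℝ (fun z => B z a b) y := fun a b => diffAt hU hy (hB a b)
  simp only [pdM, Matrix.mul_apply, Matrix.of_apply, Matrix.add_apply]
  rw [pd_sum _ _ fun a _ => (h i a).fun_mul (h' a j), ← Finset.sum_add_distrib]
  exact Finset.sum_congr rfl fun a _ => pd_mul k (h i a) (h' a j)

theorem pdM_add (hU : IsOpen U) (hy : y ∈ U) (hA : SmoothMatOn A U) (hB : SmoothMatOn B U)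
    (k : Fin n) : pdM k (fun z => A z + B z) y = pdM k A y + pdM k B y := by
  ext i j
  exact pd_add k (diffAt hU hy (hA i j)) (diffAt hU hy (hB i j))

theorem pdM_transpose (k : Fin n) : pdM k (fun z => (A z)ᵀ) y = (pdM k A y)ᵀ := rfl

theorem pdM_congr (hU : IsOpen U) (hy : y ∈ U) (h : ∀ z ∈ U, A z = B z) (k : Fin n) :
    pdM k A y = pdM k B y := by
  ext i j
  exact pd_congr k hU hy fun z hz => by rw [h z hz]

theorem pd_trace (hU : IsOpen U) (hy : y ∈ U) (hA : SmoothMatOn A U) (k : Fin n) :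
    pd k (fun z => (A z).trace) y = (pdM k A y).trace := by
  simp only [Matrix.trace, Matrix.diag]
  rw [pd_sum _ _ fun a _ => diffAt hU hy (hA a a)]
  rfl

/-- `G` is the component matrix of a smooth (pseudo-)Riemannian metric on the open set `U`, with
positive determinant. -/
structure IsMetricOn (G : EuclideanSpace ℝ (Fin n) → Matrix (Fin n) (Fin n) ℝ)
    (U : Set (EuclideanSpace ℝ (Fin n))) : Prop where
  isOpen : IsOpen U
  smooth : SmoothMatOn G U
  symm : ∀ y ∈ U, (G y)ᵀ = G y
  det_pos : ∀ y ∈ U, 0 < (G y).det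

/-- The connection matrix `(Γ_k)ᵐ_i = Γᵐ_ki`. -/
def connection (G : EuclideanSpace ℝ (Fin n) → Matrix (Fin n) (Fin n) ℝ) (k : Fin n)
    (y : EuclideanSpace ℝ (Fin n)) : Matrix (Fin n) (Fin n) ℝ :=
  Matrix.of fun m i => christoffel G m k i y

variable {G : EuclideanSpace ℝ (Fin n) → Matrix (Fin n) (Fin n) ℝ}

namespace IsMetricOn

theorem mul_inv (hG : IsMetricOn G U) (hy : y ∈ U) : G y * (G y)⁻¹ = 1 :=
  Matrix.mul_nonsing_inv _ (hG.det_pos y hy).ne'.isUnit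

theorem inv_mul (hG : IsMetricOn G U) (hy : y ∈ U) : (G y)⁻¹ * G y = 1 :=
  Matrix.nonsing_inv_mul _ (hG.det_pos y hy).ne'.isUnit

theorem inv_symm (hG : IsMetricOn G U) (hy : y ∈ U) : ((G y)⁻¹)ᵀ = (G y)⁻¹ := by
  rw [Matrix.transpose_nonsing_inv, hG.symm y hy]

theorem smooth_inv (hG : IsMetricOn G U) : SmoothMatOn (fun z => (G z)⁻¹) U :=
  contDiffOn_inv hG.smooth fun z hz => (hG.det_pos z hz).ne'

theorem smooth_christoffel (hG : IsMetricOn G U) (k i j : Fin n) :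
    ContDiffOn ℝ ∞ (christoffel G k i j) U := by
  refine contDiffOn_const.mul (ContDiffOn.sum fun l _ => (hG.smooth_inv k l).mul ?_)
  exact (((hG.smooth j l).pd hG.isOpen i).add ((hG.smooth i l).pd hG.isOpen j)).sub
    ((hG.smooth i j).pd hG.isOpen l)

theorem smooth_connection (hG : IsMetricOn G U) (k : Fin n) : SmoothMatOn (connection G k) U :=
  fun _ _ => hG.smooth_christoffel _ _ _

theorem apply_symm (hG : IsMetricOn G U) (hy : y ∈ U) (i j : Fin n) : G y i j = G y j i :=
  congrFun (congrFun (hG.symm y hy).symm i) j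

theorem inv_apply_symm (hG : IsMetricOn G U) (hy : y ∈ U) (i j : Fin n) :
    (G y)⁻¹ i j = (G y)⁻¹ j i :=
  congrFun (congrFun (hG.inv_symm hy).symm i) j

theorem pd_symm (hG : IsMetricOn G U) (hy : y ∈ U) (k i j : Fin n) :
    pd k (fun z => G z i j) y = pd k (fun z => G z j i) y :=
  pd_congr k hG.isOpen hy fun _ hz => hG.apply_symm hz i j

/-- With the upper index lowered, the symbols are linear in ∂G and free of G⁻¹. In this form they
are easy to compare and to differentiate. -/
theorem lower_christoffel (hG : IsMetricOn G U) (hy : y ∈ U) (a i j : Fin n) :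
    ∑ k, G y a k * christoffel G k i j y = (1 / 2) *
      (pd i (fun z => G z j a) y + pd j (fun z => G z i a) y - pd a (fun z => G z i j) y) := by
  have h : G y *ᵥ ((G y)⁻¹ *ᵥ fun l => (1 / 2) * (pd i (fun z => G z j l) y
      + pd j (fun z => G z i l) y - pd l (fun z => G z i j) y)) = fun l => (1 / 2) *
        (pd i (fun z => G z j l) y + pd j (fun z => G z i l) y - pd l (fun z => G z i j) y) := by
    rw [Matrix.mulVec_mulVec, hG.mul_inv hy, Matrix.one_mulVec]
  rw [← congrFun h a]
  refine Finset.sum_congr rfl fun k _ => ?_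
  congr 1
  rw [christoffel, Finset.mul_sum]
  exact Finset.sum_congr rfl fun l _ => by ring

theorem christoffel_symm (hG : IsMetricOn G U) (hy : y ∈ U) (k i j : Fin n) :
    christoffel G k i j y = christoffel G k j i y := by
  simp only [christoffel]
  congr 1
  refine Finset.sum_congr rfl fun l _ => ?_
  rw [hG.pd_symm hy l i j]
  ring

/-- Metric compatibility ∇g = 0 in matrix form: in ∂_i g_kj and its permutations all but one pair of
terms cancel. -/
theorem pdM_eq (hG : IsMetricOn G U) (hy : y ∈ U) (k : Fin n) :
    pdM k G y = (connection G k y)ᵀ * G y + G y * connection G k y := by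
  ext i j
  have h1 : ((connection G k y)ᵀ * G y) i j = ∑ m, G y j m * christoffel G m k i y := by
    rw [Matrix.mul_apply]
    refine Finset.sum_congr rfl fun m _ => ?_
    rw [hG.apply_symm hy j m, mul_comm]
    rfl
  have h2 : (G y * connection G k y) i j = ∑ m, G y i m * christoffel G m k j y := rfl
  rw [Matrix.add_apply, h1, h2, hG.lower_christoffel hy, hG.lower_christoffel hy,
    hG.pd_symm hy k j i, hG.pd_symm hy i k j, hG.pd_symm hy j k i]
  simp only [pdM, Matrix.of_apply]
  ring

/-- The Koszul argument: a torsion-free, metric-compatible connection is determined by ∂G. `hsymm`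
is the absence of torsion and `hC` the compatibility. This is what later gives the transformation
law of Γ. -/
theorem connection_unique (hG : IsMetricOn G U) (hy : y ∈ U)
    {C : Fin n → Matrix (Fin n) (Fin n) ℝ} (hsymm : ∀ k m i, C k m i = C i m k)
    (hC : ∀ k, pdM k G y = (C k)ᵀ * G y + G y * C k) (k : Fin n) : C k = connection G k y := by
  suffices h : G y * C k = G y * connection G k y by
    have := congrArg (fun X => (G y)⁻¹ * X) h
    simpa [← Matrix.mul_assoc, hG.inv_mul hy] using this
  -- The lowered symbols are again symmetric in their two lower connection indices, so the cyclic
  -- combination of ∂G isolates one of them.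
  have hS : ∀ k a i, (G y * C k) a i = (G y * C i) a k := fun k a i => by
    simp only [Matrix.mul_apply]
    exact Finset.sum_congr rfl fun m _ => by rw [hsymm]
  have hd : ∀ k i j, pd k (fun z => G z i j) y = (G y * C k) j i + (G y * C k) i j := by
    intro k i j
    have h := congrFun (congrFun (hC k) i) j
    have h1 : (C k)ᵀ * G y = (G y * C k)ᵀ := by rw [Matrix.transpose_mul, hG.symm y hy]
    rw [h1] at h
    exact h
  ext a j
  have h2 : (G y * connection G k y) a j = ∑ m, G y a m * christoffel G m k j y := rfl
  rw [h2, hG.lower_christoffel hy, hd, hd, hd, hS k j a, hS j k a, hS j a k]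
  ring

theorem pdM_inv (hG : IsMetricOn G U) (hy : y ∈ U) (k : Fin n) :
    pdM k (fun z => (G z)⁻¹) y
      = -((G y)⁻¹ * (connection G k y)ᵀ + connection G k y * (G y)⁻¹) := by
  have h := pdM_mul hG.isOpen hy hG.smooth hG.smooth_inv k
  have h0 : pdM k (fun z => G z * (G z)⁻¹) y = 0 := by
    rw [pdM_congr hG.isOpen hy (B := fun _ => 1) (fun z hz => hG.mul_inv hz)]
    ext i j
    exact pd_const _ _
  rw [h0, hG.pdM_eq hy] at h
  have h1 := congrArg (fun X => (G y)⁻¹ * X) h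
  simp only [Matrix.mul_zero, Matrix.mul_add, Matrix.add_mul, ← Matrix.mul_assoc,
    hG.inv_mul hy, Matrix.one_mul] at h1
  rw [Matrix.mul_assoc _ (G y), hG.mul_inv hy, Matrix.mul_one] at h1
  rw [eq_neg_iff_add_eq_zero, add_comm]
  exact h1.symm

/-- The volume density `√det(g_ij)`. -/
theorem pd_sqrt_det (hG : IsMetricOn G U) (hy : y ∈ U) (k : Fin n) :
    pd k (fun z => √(G z).det) y = √(G y).det * (connection G k y).trace := by
  have hd := hG.det_pos y hy
  have h1 : DifferentiableAt ℝ (fun z => (G z).det) y :=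
    diffAt hG.isOpen hy (contDiffOn_det hG.smooth)
  -- Restriction to the coordinate line turns the partial derivative into a one-variable derivative,
  -- where Jacobi's formula applies. By `pdM_eq`, tr(G⁻¹∂_kG) = 2 tr Γ_k, and the 2 cancels that of
  -- the square root.
  have h2 := hasDerivAt_line_pd (h1.sqrt hd.ne') k
  have h3 := hasDerivAt_det (A := fun t : ℝ => G (y + t • EuclideanSpace.single k (1 : ℝ)))
    (A' := pdM k G y) (t := 0) fun i j => hasDerivAt_line_pd (diffAt hG.isOpen hy (hG.smooth i j)) k
  have h4 := h3.sqrt (by simpa using hd.ne')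
  rw [h2.unique h4]
  have hadj : (G y).adjugate = (G y).det • (G y)⁻¹ := by
    rw [Matrix.inv_def, Ring.inverse_eq_inv', smul_smul, mul_inv_cancel₀ hd.ne', one_smul]
  simp only [zero_smul, add_zero]
  rw [hadj, hG.pdM_eq hy, Matrix.smul_mul, Matrix.trace_smul, Matrix.mul_add, Matrix.trace_add,
    ← Matrix.mul_assoc, ← Matrix.mul_assoc, hG.inv_mul hy, Matrix.one_mul, Matrix.mul_assoc,
    Matrix.trace_mul_comm, Matrix.mul_assoc, hG.mul_inv hy, Matrix.mul_one, Matrix.trace_transpose,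
    smul_eq_mul, div_eq_iff (by positivity)]
  linear_combination (-2 * (connection G k y).trace) * Real.mul_self_sqrt hd.le

end IsMetricOn

end MatrixCalculus

/-! ### Covariant derivatives, divergences and the adjoint of the linearized scalar curvature, in
coordinates. -/

section Divergence

variable {n : ℕ} {U : Set (EuclideanSpace ℝ (Fin n))} {y : EuclideanSpace ℝ (Fin n)}
  {G V B : EuclideanSpace ℝ (Fin n) → Matrix (Fin n) (Fin n) ℝ}
  {u : EuclideanSpace ℝ (Fin n) → ℝ} {α β : Fin n → EuclideanSpace ℝ (Fin n) → ℝ}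

/-- The covariant derivative `∇_i α_j` of a covector field. -/
def covDerivOne (G : EuclideanSpace ℝ (Fin n) → Matrix (Fin n) (Fin n) ℝ)
    (α : Fin n → EuclideanSpace ℝ (Fin n) → ℝ) (i j : Fin n) (y : EuclideanSpace ℝ (Fin n)) : ℝ :=
  pd i (α j) y - ∑ m, christoffel G m i j y * α m y

/-- The divergence `gⁱʲ ∇_i α_j` of a covector field. -/
def codiff (G : EuclideanSpace ℝ (Fin n) → Matrix (Fin n) (Fin n) ℝ)
    (α : Fin n → EuclideanSpace ℝ (Fin n) → ℝ) (y : EuclideanSpace ℝ (Fin n)) : ℝ :=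
  ∑ i, ∑ j, (G y)⁻¹ i j * covDerivOne G α i j y

/-- The `i`-th component `√det(g) gⁱʲ α_j` of the vector density of a covector field. -/
def vectorDensity (G : EuclideanSpace ℝ (Fin n) → Matrix (Fin n) (Fin n) ℝ)
    (α : Fin n → EuclideanSpace ℝ (Fin n) → ℝ) (i : Fin n) (y : EuclideanSpace ℝ (Fin n)) : ℝ :=
  √(G y).det * ∑ j, (G y)⁻¹ i j * α j y

/-- The divergence `gʲˡ ∇_l V_ij` of a covariant 2-tensor field. -/
def divTwo (G V : EuclideanSpace ℝ (Fin n) → Matrix (Fin n) (Fin n) ℝ) (i : Fin n)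
    (y : EuclideanSpace ℝ (Fin n)) : ℝ :=
  traceCoord (G y) (Matrix.of fun j l => covDerivCoord G V l i j y)

theorem traceCoord_eq_trace {G₀ A : Matrix (Fin n) (Fin n) ℝ} (hG : (G₀⁻¹)ᵀ = G₀⁻¹) :
    traceCoord G₀ A = (G₀⁻¹ * A).trace := by
  simp only [traceCoord, Matrix.trace, Matrix.diag, Matrix.mul_apply]
  rw [Finset.sum_comm]
  refine Finset.sum_congr rfl fun i _ => Finset.sum_congr rfl fun j _ => ?_
  rw [← congrFun (congrFun hG j) i, Matrix.transpose_apply]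

theorem covDerivCoord_eq (k i j : Fin n) :
    covDerivCoord G V k i j y
      = (pdM k V y - ((connection G k y)ᵀ * V y + V y * connection G k y)) i j := by
  simp only [covDerivCoord, Matrix.sub_apply, Matrix.add_apply, Matrix.mul_apply, pdM,
    Matrix.of_apply, Matrix.transpose_apply, connection, Finset.sum_add_distrib]
  simp only [mul_comm]

theorem sum_comm₂ {ι : Type*} [Fintype ι] (F : ι → ι → ι → ι → ℝ) :
    ∑ i, ∑ j, ∑ k, ∑ l, F i j k l = ∑ k, ∑ l, ∑ i, ∑ j, F i j k l :=
  calc _ = ∑ i, ∑ k, ∑ j, ∑ l, F i j k l := Finset.sum_congr rfl fun _ _ => Finset.sum_comm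
    _ = ∑ k, ∑ i, ∑ j, ∑ l, F i j k l := Finset.sum_comm
    _ = ∑ k, ∑ i, ∑ l, ∑ j, F i j k l :=
      Finset.sum_congr rfl fun _ _ => Finset.sum_congr rfl fun _ _ => Finset.sum_comm
    _ = _ := Finset.sum_congr rfl fun _ _ => Finset.sum_comm

namespace IsMetricOn

theorem smooth_covDerivCoord (hG : IsMetricOn G U) (hV : SmoothMatOn V U) (k i j : Fin n) :
    ContDiffOn ℝ ∞ (covDerivCoord G V k i j) U := by
  refine ((hV i j).pd hG.isOpen k).sub (ContDiffOn.sum fun m _ => ?_)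
  exact ((hG.smooth_christoffel m k i).mul (hV m j)).add
    ((hG.smooth_christoffel m k j).mul (hV i m))

theorem smooth_traceCoord (hG : IsMetricOn G U) (hV : SmoothMatOn V U) :
    ContDiffOn ℝ ∞ (fun z => traceCoord (G z) (V z)) U :=
  ContDiffOn.sum fun i _ => ContDiffOn.sum fun j _ => (hG.smooth_inv i j).mul (hV i j)

theorem smooth_divTwo (hG : IsMetricOn G U) (hV : SmoothMatOn V U) (i : Fin n) :
    ContDiffOn ℝ ∞ (divTwo G V i) U :=
  hG.smooth_traceCoord fun _ _ => hG.smooth_covDerivCoord hV _ _ _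

theorem smooth_sqrt_det (hG : IsMetricOn G U) : ContDiffOn ℝ ∞ (fun z => √(G z).det) U :=
  (contDiffOn_det hG.smooth).sqrt fun z hz => (hG.det_pos z hz).ne'

theorem smooth_vectorDensity (hG : IsMetricOn G U) (hα : ∀ j, ContDiffOn ℝ ∞ (α j) U) (i : Fin n) :
    ContDiffOn ℝ ∞ (vectorDensity G α i) U :=
  hG.smooth_sqrt_det.mul (ContDiffOn.sum fun j _ => (hG.smooth_inv i j).mul (hα j))

/-- Taking traces commutes with covariant differentiation. -/
theorem pd_traceCoord (hG : IsMetricOn G U) (hy : y ∈ U) (hB : SmoothMatOn B U) (k : Fin n) :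
    pd k (fun z => traceCoord (G z) (B z)) y
      = traceCoord (G y) (Matrix.of fun i j => covDerivCoord G B k i j y) := by
  have h1 : pd k (fun z => traceCoord (G z) (B z)) y = pd k (fun z => ((G z)⁻¹ * B z).trace) y :=
    pd_congr k hG.isOpen hy fun z hz => traceCoord_eq_trace (hG.inv_symm hz)
  have h2 : (Matrix.of fun i j => covDerivCoord G B k i j y)
      = pdM k B y - ((connection G k y)ᵀ * B y + B y * connection G k y) := by
    ext i j
    exact covDerivCoord_eq k i j
  -- Inserting ∂_k G⁻¹ = −(G⁻¹Γ_kᵀ + Γ_kG⁻¹) already produces both connection terms of the covariant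
  -- derivative; cyclicity of the trace puts them in place.
  rw [h1, traceCoord_eq_trace (hG.inv_symm hy), h2, pd_trace hG.isOpen hy (hG.smooth_inv.mul hB),
    pdM_mul hG.isOpen hy hG.smooth_inv hB, hG.pdM_inv hy]
  simp only [Matrix.trace_add, Matrix.mul_sub, Matrix.trace_sub, Matrix.mul_add, Matrix.neg_mul,
    Matrix.trace_neg, Matrix.add_mul]
  rw [Matrix.mul_assoc (connection G k y), Matrix.trace_mul_comm (connection G k y),
    ← Matrix.mul_assoc, ← Matrix.mul_assoc]
  ring

theorem pd_inv (hG : IsMetricOn G U) (hy : y ∈ U) (k i j : Fin n) :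
    pd k (fun z => (G z)⁻¹ i j) y = -(∑ m, (G y)⁻¹ i m * christoffel G j k m y
      + ∑ m, christoffel G i k m y * (G y)⁻¹ m j) :=
  congrFun (congrFun (hG.pdM_inv hy k) i) j

/-- The identity ∂_i(√g Xⁱ) = √g ∇_iXⁱ: it turns covariant divergences into flat ones, whose
integrals can be computed in ℝⁿ. -/
theorem sum_pd_vectorDensity (hG : IsMetricOn G U) (hy : y ∈ U)
    (hα : ∀ j, ContDiffOn ℝ ∞ (α j) U) :
    ∑ i, pd i (vectorDensity G α i) y = √(G y).det * codiff G α y := by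
  have hP : ∀ i j, DifferentiableAt ℝ (fun z => (G z)⁻¹ i j) y := fun i j =>
    diffAt hG.isOpen hy (hG.smooth_inv i j)
  have hα' : ∀ j, DifferentiableAt ℝ (α j) y := fun j => diffAt hG.isOpen hy (hα j)
  have h1 : ∀ i, pd i (vectorDensity G α i) y = √(G y).det * (∑ j, (connection G i y).trace
      * ((G y)⁻¹ i j * α j y) + ∑ j, (G y)⁻¹ i j * pd i (α j) y
      - ∑ j, (∑ m, (G y)⁻¹ i m * christoffel G j i m y) * α j y
      - ∑ j, (∑ m, christoffel G i i m y * (G y)⁻¹ m j) * α j y) := by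
    intro i
    unfold vectorDensity
    rw [pd_mul i (diffAt hG.isOpen hy hG.smooth_sqrt_det)
      (DifferentiableAt.fun_sum fun j _ => (hP i j).fun_mul (hα' j)), hG.pd_sqrt_det hy,
      pd_sum _ _ fun j _ => (hP i j).fun_mul (hα' j)]
    simp only [pd_mul i (hP i _) (hα' _), hG.pd_inv hy, ← Finset.mul_sum]
    rw [mul_assoc, ← mul_add]
    congr 1
    rw [add_sub_assoc, add_sub_assoc, ← Finset.sum_sub_distrib, ← Finset.sum_sub_distrib]
    congr 1
    refine Finset.sum_congr rfl fun j _ => ?_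
    ring
  simp only [h1]
  rw [← Finset.mul_sum]
  congr 1
  simp only [Finset.sum_sub_distrib, Finset.sum_add_distrib, codiff, covDerivOne, mul_sub]
  -- The trace of Γ coming from ∂√g cancels against one half of ∂G⁻¹, because Γ is symmetric. The
  -- other half, treated in `h3`, supplies the correction in ∇_i α_j.
  have h2 : ∑ i, ∑ j, (∑ m, christoffel G i i m y * (G y)⁻¹ m j) * α j y
      = ∑ i, ∑ j, (connection G i y).trace * ((G y)⁻¹ i j * α j y) := by
    calc ∑ i, ∑ j, (∑ m, christoffel G i i m y * (G y)⁻¹ m j) * α j y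
        = ∑ i, ∑ m, christoffel G i i m y * ∑ j, (G y)⁻¹ m j * α j y := by
          refine Finset.sum_congr rfl fun i _ => ?_
          simp only [Finset.sum_mul, Finset.mul_sum]
          rw [Finset.sum_comm]
          simp only [mul_assoc]
      _ = ∑ m, ∑ i, christoffel G i i m y * ∑ j, (G y)⁻¹ m j * α j y := Finset.sum_comm
      _ = _ := by
          refine Finset.sum_congr rfl fun m _ => ?_
          rw [← Finset.sum_mul, ← Finset.mul_sum]
          congr 1
          exact Finset.sum_congr rfl fun i _ => hG.christoffel_symm hy i i m
  have h3 : ∑ i, ∑ j, (∑ m, (G y)⁻¹ i m * christoffel G j i m y) * α j y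
      = ∑ i, ∑ j, (G y)⁻¹ i j * ∑ m, christoffel G m i j y * α m y := by
    refine Finset.sum_congr rfl fun i _ => ?_
    simp only [Finset.sum_mul, Finset.mul_sum]
    rw [Finset.sum_comm]
    simp only [mul_assoc]
  rw [h2, h3]
  ring

theorem laplacianCoord_eq : laplacianCoord G u y = codiff G (fun j => pd j u) y := rfl

/-- Contraction commutes with ∇_k by `pd_traceCoord` on the contracted slots; the free index i only
adds one more Christoffel term. Thus the double divergence can be taken one divergence at a time. -/
theorem covDerivOne_divTwo (hG : IsMetricOn G U) (hy : y ∈ U) (hV : SmoothMatOn V U)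
    (k i : Fin n) : covDerivOne G (divTwo G V) k i y
      = ∑ j, ∑ l, (G y)⁻¹ j l * covDeriv₂Coord G V k l i j y := by
  have h1 := hG.pd_traceCoord hy
    (B := fun z => Matrix.of fun j l => covDerivCoord G V l i j z)
    (fun j l => hG.smooth_covDerivCoord hV l i j) k
  have h2 : ∑ m, christoffel G m k i y * divTwo G V m y
      = ∑ j, ∑ l, (G y)⁻¹ j l * ∑ m, christoffel G m k i y * covDerivCoord G V l m j y := by
    simp only [divTwo, traceCoord, Finset.mul_sum, Matrix.of_apply]
    rw [Finset.sum_comm]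
    refine Finset.sum_congr rfl fun j _ => ?_
    rw [Finset.sum_comm]
    refine Finset.sum_congr rfl fun l _ => Finset.sum_congr rfl fun m _ => ?_
    ring
  have h3 : pd k (divTwo G V i) y = pd k (fun z => traceCoord (G z)
    (Matrix.of fun j l => covDerivCoord G V l i j z)) y := rfl
  rw [covDerivOne, h2, h3, h1]
  simp only [traceCoord, ← Finset.sum_sub_distrib, ← mul_sub]
  refine Finset.sum_congr rfl fun j _ => Finset.sum_congr rfl fun l _ => ?_
  congr 1
  have h4 : ∀ B, covDerivCoord G B k j l y = pd k (fun z => B z j l) y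
      - ∑ m, (christoffel G m k j y * B y m l + christoffel G m k l y * B y j m) := fun _ => rfl
  rw [Matrix.of_apply, h4, covDeriv₂Coord]
  simp only [Matrix.of_apply, Finset.sum_add_distrib]
  ring

theorem divDivCoord_eq (hG : IsMetricOn G U) (hy : y ∈ U) (hV : SmoothMatOn V U) :
    divDivCoord G V y = codiff G (divTwo G V) y := by
  simp only [codiff, hG.covDerivOne_divTwo hy hV, divDivCoord]
  calc _ = ∑ i, ∑ k, ∑ j, ∑ l, (G y)⁻¹ i k * (G y)⁻¹ j l * covDeriv₂Coord G V k l i j y :=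
        Finset.sum_congr rfl fun i _ => Finset.sum_comm
    _ = ∑ k, ∑ i, ∑ j, ∑ l, (G y)⁻¹ i k * (G y)⁻¹ j l * covDeriv₂Coord G V k l i j y :=
        Finset.sum_comm
    _ = _ := by
        refine Finset.sum_congr rfl fun k _ => Finset.sum_congr rfl fun i _ => ?_
        simp only [Finset.mul_sum, hG.inv_apply_symm hy i k, mul_assoc]

theorem codiff_sub (hG : IsMetricOn G U) (hy : y ∈ U) (hα : ∀ j, ContDiffOn ℝ ∞ (α j) U)
    (hβ : ∀ j, ContDiffOn ℝ ∞ (β j) U) :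
    codiff G (fun j z => α j z - β j z) y = codiff G α y - codiff G β y := by
  simp only [codiff, covDerivOne, ← Finset.sum_sub_distrib]
  refine Finset.sum_congr rfl fun i _ => Finset.sum_congr rfl fun j _ => ?_
  rw [pd_sub i (diffAt hG.isOpen hy (hα j)) (diffAt hG.isOpen hy (hβ j))]
  simp only [mul_sub, Finset.sum_sub_distrib]
  ring

/-- The inner product `gⁱʲ α_i β_j` of two covectors. -/
def _root_.Perelman.covectorInner (G₀ : Matrix (Fin n) (Fin n) ℝ) (α β : Fin n → ℝ) : ℝ :=
  ∑ i, ∑ j, G₀⁻¹ i j * (α i * β j)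

theorem codiff_mul (hG : IsMetricOn G U) (hy : y ∈ U) (hu : ContDiffOn ℝ ∞ u U)
    (hα : ∀ j, ContDiffOn ℝ ∞ (α j) U) :
    codiff G (fun j z => u z * α j z) y
      = u y * codiff G α y + covectorInner (G y) (fun i => pd i u y) (fun j => α j y) := by
  simp only [codiff, covDerivOne, covectorInner, Finset.mul_sum, ← Finset.sum_add_distrib]
  refine Finset.sum_congr rfl fun i _ => Finset.sum_congr rfl fun j _ => ?_
  rw [pd_mul i (diffAt hG.isOpen hy hu) (diffAt hG.isOpen hy (hα j))]
  have : ∑ m, christoffel G m i j y * (u y * α m y) = u y * ∑ m, christoffel G m i j y * α m y := by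
    rw [Finset.mul_sum]
    exact Finset.sum_congr rfl fun m _ => by ring
  rw [this]
  ring

theorem hessCoord_symm (hG : IsMetricOn G U) (hy : y ∈ U) (hu : ContDiffOn ℝ ∞ u U) (i j : Fin n) :
    hessCoord G u i j y = hessCoord G u j i y := by
  simp only [hessCoord]
  rw [pd_comm hG.isOpen hy hu i j]
  simp only [hG.christoffel_symm hy _ i j]

/-- The covector field `V_jl gʲᵏ ∂_k u`. -/
def _root_.Perelman.contractGrad (G V : EuclideanSpace ℝ (Fin n) → Matrix (Fin n) (Fin n) ℝ)
    (u : EuclideanSpace ℝ (Fin n) → ℝ) (l : Fin n) (y : EuclideanSpace ℝ (Fin n)) : ℝ :=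
  traceCoord (G y) (Matrix.of fun j k => V y j l * pd k u y)

theorem smooth_contractGrad (hG : IsMetricOn G U) (hV : SmoothMatOn V U)
    (hu : ContDiffOn ℝ ∞ u U) (l : Fin n) : ContDiffOn ℝ ∞ (contractGrad G V u l) U :=
  hG.smooth_traceCoord fun j k => (hV j l).mul (hu.pd hG.isOpen k)

theorem covDerivOne_contractGrad (hG : IsMetricOn G U) (hy : y ∈ U) (hV : SmoothMatOn V U)
    (hu : ContDiffOn ℝ ∞ u U) (i l : Fin n) :
    covDerivOne G (contractGrad G V u) i l y = ∑ j, ∑ k, (G y)⁻¹ j k *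
      (pd k u y * covDerivCoord G V i j l y + V y j l * hessCoord G u i k y) := by
  have h1 := hG.pd_traceCoord hy (B := fun z => Matrix.of fun j k => V z j l * pd k u z)
    (fun j k => (hV j l).mul (hu.pd hG.isOpen k)) i
  have h2 : ∑ m, christoffel G m i l y * contractGrad G V u m y
      = ∑ j, ∑ k, (G y)⁻¹ j k * ∑ m, christoffel G m i l y * (V y j m * pd k u y) := by
    simp only [contractGrad, traceCoord, Finset.mul_sum, Matrix.of_apply]
    rw [Finset.sum_comm]
    refine Finset.sum_congr rfl fun j _ => ?_
    rw [Finset.sum_comm]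
    refine Finset.sum_congr rfl fun k _ => Finset.sum_congr rfl fun m _ => ?_
    ring
  have h3 : pd i (contractGrad G V u l) y = pd i (fun z => traceCoord (G z)
    (Matrix.of fun j k => V z j l * pd k u z)) y := rfl
  rw [covDerivOne, h2, h3, h1]
  simp only [traceCoord, ← Finset.sum_sub_distrib, ← mul_sub]
  refine Finset.sum_congr rfl fun j _ => Finset.sum_congr rfl fun k _ => ?_
  congr 1
  simp only [covDerivCoord, Matrix.of_apply, hessCoord]
  rw [pd_mul i (diffAt hG.isOpen hy (hV j l)) (diffAt hG.isOpen hy (hu.pd hG.isOpen k))]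
  simp only [Finset.sum_add_distrib, mul_sub, mul_add, Finset.mul_sum]
  simp only [mul_comm, mul_left_comm, mul_assoc]
  ring

/-- Leibniz rule for div(V(∇u, ·)) = ⟨∇u, div V⟩ + ⟨V, ∇²u⟩; this is the step that moves a
derivative from V to u. -/
theorem codiff_contractGrad (hG : IsMetricOn G U) (hy : y ∈ U) (hV : SmoothMatOn V U)
    (hu : ContDiffOn ℝ ∞ u U) :
    codiff G (contractGrad G V u) y
      = covectorInner (G y) (fun i => pd i u y) (fun j => divTwo G V j y)
        + pairingCoord (G y) (V y) (Matrix.of fun i j => hessCoord G u i j y) := by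
  simp only [codiff, hG.covDerivOne_contractGrad hy hV hu]
  have h1 : covectorInner (G y) (fun i => pd i u y) (fun j => divTwo G V j y)
      = ∑ i, ∑ l, (G y)⁻¹ i l * ∑ j, ∑ k, (G y)⁻¹ j k *
        (pd k u y * covDerivCoord G V i j l y) := by
    simp only [covectorInner, divTwo, traceCoord, Matrix.of_apply, Finset.mul_sum]
    calc _ = ∑ j, ∑ k, ∑ l, ∑ i, (G y)⁻¹ k j * (pd k u y * ((G y)⁻¹ l i
            * covDerivCoord G V i j l y)) := Finset.sum_comm
      _ = ∑ l, ∑ i, ∑ j, ∑ k, (G y)⁻¹ k j * (pd k u y * ((G y)⁻¹ l i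
            * covDerivCoord G V i j l y)) := sum_comm₂ _
      _ = ∑ i, ∑ l, ∑ j, ∑ k, (G y)⁻¹ k j * (pd k u y * ((G y)⁻¹ l i
            * covDerivCoord G V i j l y)) := Finset.sum_comm
      _ = _ := by
        refine Finset.sum_congr rfl fun i _ => Finset.sum_congr rfl fun l _ =>
          Finset.sum_congr rfl fun j _ => Finset.sum_congr rfl fun k _ => ?_
        rw [hG.inv_apply_symm hy k j, hG.inv_apply_symm hy l i]
        ring
  have h2 : pairingCoord (G y) (V y) (Matrix.of fun i j => hessCoord G u i j y)
      = ∑ i, ∑ l, (G y)⁻¹ i l * ∑ j, ∑ k, (G y)⁻¹ j k * (V y j l * hessCoord G u i k y) := by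
    simp only [pairingCoord, Matrix.of_apply, Finset.mul_sum]
    let F : Fin n → Fin n → Fin n → Fin n → ℝ := fun i j k l =>
      (G y)⁻¹ i k * (G y)⁻¹ j l * (V y i j * hessCoord G u k l y)
    calc _ = ∑ i, ∑ j, ∑ l, ∑ k, F i j k l :=
          Finset.sum_congr rfl fun i _ => Finset.sum_congr rfl fun j _ => Finset.sum_comm
      _ = ∑ i, ∑ l, ∑ j, ∑ k, F i j k l := Finset.sum_congr rfl fun i _ => Finset.sum_comm
      _ = ∑ l, ∑ i, ∑ j, ∑ k, F i j k l := Finset.sum_comm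
      _ = ∑ l, ∑ j, ∑ i, ∑ k, F i j k l := Finset.sum_congr rfl fun l _ => Finset.sum_comm
      _ = _ := by
        refine Finset.sum_congr rfl fun l _ => Finset.sum_congr rfl fun j _ =>
          Finset.sum_congr rfl fun i _ => Finset.sum_congr rfl fun k _ => ?_
        simp only [F]
        rw [hG.inv_apply_symm hy j l, hG.hessCoord_symm hy hu k l]
        ring
  rw [h1, h2]
  simp only [← Finset.sum_add_distrib, ← mul_add]

/-- The formal adjoint of `V ↦ -Δ(tr V) + ∇ⁱ∇ʲ V_ij` is `u ↦ ∇_i ∇_j u - Δu g_ij`. -/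
theorem adjoint_identity (hG : IsMetricOn G U) (hy : y ∈ U) (hV : SmoothMatOn V U)
    (hu : ContDiffOn ℝ ∞ u U) :
    √(G y).det * (u y * (-laplacianCoord G (fun z => traceCoord (G z) (V z)) y
        + divDivCoord G V y))
      = ∑ i, pd i (vectorDensity G (fun j z =>
          u z * (divTwo G V j z - pd j (fun z => traceCoord (G z) (V z)) z)
          - (contractGrad G V u j z - traceCoord (G z) (V z) * pd j u z)) i) y
        + √(G y).det * (pairingCoord (G y) (V y) (Matrix.of fun i j => hessCoord G u i j y)
          - traceCoord (G y) (V y) * laplacianCoord G u y) := by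
  have htr := hG.smooth_traceCoord hV
  have hdtr := fun j => htr.pd hG.isOpen j
  have hdu := fun j => hu.pd hG.isOpen j
  have hdiv := fun j => hG.smooth_divTwo hV j
  have hcg := fun j => hG.smooth_contractGrad hV hu j
  -- Expanding the divergence of u(div V − d tr V) − (V(∇u) − tr V du), the first-order products
  -- ⟨du, div V⟩ and ⟨du, d tr V⟩ each occur twice with opposite signs.
  rw [hG.sum_pd_vectorDensity hy fun j => (hu.mul ((hdiv j).sub (hdtr j))).sub
      ((hcg j).sub (htr.mul (hdu j))),
    hG.codiff_sub hy (fun j => hu.mul ((hdiv j).sub (hdtr j)))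
      (fun j => (hcg j).sub (htr.mul (hdu j))),
    hG.codiff_sub hy hcg fun j => htr.mul (hdu j),
    hG.codiff_mul hy hu fun j => (hdiv j).sub (hdtr j), hG.codiff_sub hy hdiv hdtr,
    hG.codiff_mul hy htr hdu, hG.codiff_contractGrad hy hV hu, hG.divDivCoord_eq hy hV,
    laplacianCoord_eq, laplacianCoord_eq]
  have h1 : covectorInner (G y) (fun i => pd i u y)
      (fun j => divTwo G V j y - pd j (fun z => traceCoord (G z) (V z)) y)
      = covectorInner (G y) (fun i => pd i u y) (fun j => divTwo G V j y)
        - covectorInner (G y) (fun i => pd i (fun z => traceCoord (G z) (V z)) y)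
          (fun i => pd i u y) := by
    have h2 : covectorInner (G y) (fun i => pd i (fun z => traceCoord (G z) (V z)) y)
        (fun i => pd i u y) = covectorInner (G y) (fun i => pd i u y)
          (fun i => pd i (fun z => traceCoord (G z) (V z)) y) := by
      unfold covectorInner
      rw [Finset.sum_comm]
      refine Finset.sum_congr rfl fun i _ => Finset.sum_congr rfl fun j _ => ?_
      rw [hG.inv_apply_symm hy, mul_comm (pd _ u y)]
    rw [h2]
    simp only [covectorInner, ← Finset.sum_sub_distrib]
    exact Finset.sum_congr rfl fun i _ => Finset.sum_congr rfl fun j _ => by ring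
  rw [h1]
  ring

end IsMetricOn

end Divergence

/-! ### Smooth one-parameter families and the variation of Γ, Ricci, R and |∇u|². -/

section Families

variable {n : ℕ} {I : Set ℝ} {U : Set (EuclideanSpace ℝ (Fin n))} {t : ℝ}
  {y : EuclideanSpace ℝ (Fin n)} {Φ Ψ : ℝ → EuclideanSpace ℝ (Fin n) → ℝ}

/-- The family of functions `Φ t` is smooth in `(t, y)` jointly. -/
def SmoothFam (Φ : ℝ → EuclideanSpace ℝ (Fin n) → ℝ) (I : Set ℝ)
    (U : Set (EuclideanSpace ℝ (Fin n))) : Prop :=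
  ContDiffOn ℝ ∞ (fun q : ℝ × EuclideanSpace ℝ (Fin n) => Φ q.1 q.2) (I ×ˢ U)

/-- The derivative of a family of functions in the parameter. -/
def dt (Φ : ℝ → EuclideanSpace ℝ (Fin n) → ℝ) (t : ℝ) (y : EuclideanSpace ℝ (Fin n)) : ℝ :=
  fderiv ℝ (fun q : ℝ × EuclideanSpace ℝ (Fin n) => Φ q.1 q.2) (t, y) (1, 0)

namespace SmoothFam

theorem mul (h : SmoothFam Φ I U) (h' : SmoothFam Ψ I U) :
    SmoothFam (fun t y => Φ t y * Ψ t y) I U := ContDiffOn.mul h h'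

theorem add (h : SmoothFam Φ I U) (h' : SmoothFam Ψ I U) :
    SmoothFam (fun t y => Φ t y + Ψ t y) I U := ContDiffOn.add h h'

theorem sub (h : SmoothFam Φ I U) (h' : SmoothFam Ψ I U) :
    SmoothFam (fun t y => Φ t y - Ψ t y) I U := ContDiffOn.sub h h'

theorem const (c : ℝ) : SmoothFam (fun _ (_ : EuclideanSpace ℝ (Fin n)) => c) I U :=
  contDiffOn_const

theorem sum {ι : Type*} {s : Finset ι} {Φ : ι → ℝ → EuclideanSpace ℝ (Fin n) → ℝ}
    (h : ∀ a ∈ s, SmoothFam (Φ a) I U) : SmoothFam (fun t y => ∑ a ∈ s, Φ a t y) I U :=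
  ContDiffOn.sum h

theorem slice (h : SmoothFam Φ I U) (ht : t ∈ I) : ContDiffOn ℝ ∞ (Φ t) U :=
  ContDiffOn.comp (g := fun q : ℝ × EuclideanSpace ℝ (Fin n) => Φ q.1 q.2) h
    (contDiffOn_const.prodMk contDiffOn_id) fun _ hz => ⟨ht, hz⟩

theorem differentiableAt (hI : IsOpen I) (hU : IsOpen U) (h : SmoothFam Φ I U) (ht : t ∈ I)
    (hy : y ∈ U) :
    DifferentiableAt ℝ (fun q : ℝ × EuclideanSpace ℝ (Fin n) => Φ q.1 q.2) (t, y) :=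
  (ContDiffOn.contDiffAt h ((hI.prod hU).mem_nhds ⟨ht, hy⟩)).differentiableAt (by simp)

/-- A partial derivative of a slice is a directional derivative of the joint function; joint
smoothness therefore survives `pd`, and mixed derivatives can be compared. -/
theorem pd_eq (hI : IsOpen I) (hU : IsOpen U) (h : SmoothFam Φ I U) (ht : t ∈ I)
    (hy : y ∈ U) (i : Fin n) :
    pd i (Φ t) y = fderiv ℝ (fun q : ℝ × EuclideanSpace ℝ (Fin n) => Φ q.1 q.2) (t, y)
      (0, EuclideanSpace.single i 1) := by
  have h1 := (h.differentiableAt hI hU ht hy).hasFDerivAt.comp y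
    ((hasFDerivAt_const t y).prodMk (hasFDerivAt_id y))
  have h2 : fderiv ℝ (Φ t) y = _ := HasFDerivAt.fderiv h1
  rw [pd, h2]
  simp

theorem hasDerivAt (hI : IsOpen I) (hU : IsOpen U) (h : SmoothFam Φ I U) (ht : t ∈ I)
    (hy : y ∈ U) : HasDerivAt (fun s => Φ s y) (dt Φ t y) t := by
  have h1 := (h.differentiableAt hI hU ht hy).hasFDerivAt.comp_hasDerivAt t
    ((hasDerivAt_id t).prodMk (hasDerivAt_const t y))
  exact h1

theorem fderiv_apply (hI : IsOpen I) (hU : IsOpen U) (h : SmoothFam Φ I U)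
    (v : ℝ × EuclideanSpace ℝ (Fin n)) :
    SmoothFam (fun t y => fderiv ℝ (fun q : ℝ × EuclideanSpace ℝ (Fin n) => Φ q.1 q.2) (t, y) v)
      I U :=
  (ContDiffOn.fderiv_of_isOpen h (hI.prod hU) (by simp)).clm_apply contDiffOn_const

theorem dt (hI : IsOpen I) (hU : IsOpen U) (h : SmoothFam Φ I U) : SmoothFam (dt Φ) I U :=
  h.fderiv_apply hI hU _

theorem pd (hI : IsOpen I) (hU : IsOpen U) (h : SmoothFam Φ I U) (i : Fin n) :
    SmoothFam (fun t => pd i (Φ t)) I U :=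
  ContDiffOn.congr (h.fderiv_apply hI hU (0, EuclideanSpace.single i 1)) fun _ hq =>
    h.pd_eq hI hU hq.1 hq.2 i

/-- Derivatives in the parameter and in the coordinates commute. -/
theorem hasDerivAt_pd (hI : IsOpen I) (hU : IsOpen U) (h : SmoothFam Φ I U) (ht : t ∈ I)
    (hy : y ∈ U) (i : Fin n) :
    HasDerivAt (fun s => Perelman.pd i (Φ s) y) (Perelman.pd i (Perelman.dt Φ t) y) t := by
  set Φ' := fun q : ℝ × EuclideanSpace ℝ (Fin n) => Φ q.1 q.2 with hΦ'
  have hs : ContDiffAt ℝ ∞ Φ' (t, y) := ContDiffOn.contDiffAt h ((hI.prod hU).mem_nhds ⟨ht, hy⟩)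
  have hd : DifferentiableAt ℝ (fderiv ℝ Φ') (t, y) :=
    (hs.fderiv_right (m := ∞) (by simp)).differentiableAt (by simp)
  have hv : ∀ v w, fderiv ℝ (fun q => fderiv ℝ Φ' q v) (t, y) w
      = fderiv ℝ (fderiv ℝ Φ') (t, y) w v := by
    intro v w
    have h2 : HasFDerivAt (fun q => fderiv ℝ Φ' q v)
        ((fderiv ℝ (fderiv ℝ Φ') (t, y)).flip v) (t, y) := by
      simpa using hd.hasFDerivAt.clm_apply (hasFDerivAt_const v (t, y))
    rw [h2.fderiv]
    rfl
  have h1 : HasDerivAt (fun s => Perelman.pd i (Φ s) y)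
      (Perelman.dt (fun s => Perelman.pd i (Φ s)) t y) t := (h.pd hI hU i).hasDerivAt hI hU ht hy
  convert h1 using 1
  -- Both sides become second derivatives of the joint function in the directions (1, 0) and (0,
  -- e_i), so symmetry of the second derivative finishes the proof.
  rw [(h.dt hI hU).pd_eq hI hU ht hy]
  have h3 : Perelman.dt (fun s => Perelman.pd i (Φ s)) t y
      = fderiv ℝ (fun q => fderiv ℝ Φ' q (0, EuclideanSpace.single i 1)) (t, y) (1, 0) := by
    rw [Perelman.dt]
    congr 1
    refine Filter.EventuallyEq.fderiv_eq ?_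
    filter_upwards [(hI.prod hU).mem_nhds ⟨ht, hy⟩] with q hq
    exact h.pd_eq hI hU hq.1 hq.2 i
  have h4 : fderiv ℝ (fun q : ℝ × EuclideanSpace ℝ (Fin n) => Perelman.dt Φ q.1 q.2) (t, y)
      (0, EuclideanSpace.single i 1)
      = fderiv ℝ (fun q => fderiv ℝ Φ' q (1, 0)) (t, y) (0, EuclideanSpace.single i 1) := rfl
  rw [h3, h4, hv, hv]
  exact (hs.isSymmSndFDerivAt
    (by rw [minSmoothness_of_isRCLikeNormedField]; exact WithTop.coe_le_coe.2 le_top)) _ _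

end SmoothFam

/-- A family of metrics on `U` that depends smoothly on the parameter `t ∈ I`. -/
structure IsMetricFamily (G : ℝ → EuclideanSpace ℝ (Fin n) → Matrix (Fin n) (Fin n) ℝ)
    (I : Set ℝ) (U : Set (EuclideanSpace ℝ (Fin n))) : Prop where
  isOpen_param : IsOpen I
  isOpen : IsOpen U
  smooth : ∀ i j, SmoothFam (fun t y => G t y i j) I U
  isMetricOn : ∀ t ∈ I, IsMetricOn (G t) U

namespace IsMetricFamily

variable {G : ℝ → EuclideanSpace ℝ (Fin n) → Matrix (Fin n) (Fin n) ℝ}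

theorem smooth_inv (hG : IsMetricFamily G I U) (i j : Fin n) :
    SmoothFam (fun t y => (G t y)⁻¹ i j) I U :=
  contDiffOn_inv hG.smooth (fun q hq => ((hG.isMetricOn q.1 hq.1).det_pos q.2 hq.2).ne') i j

theorem smooth_sqrt_det (hG : IsMetricFamily G I U) : SmoothFam (fun t y => √(G t y).det) I U :=
  (contDiffOn_det hG.smooth).sqrt
    fun q hq => ((hG.isMetricOn q.1 hq.1).det_pos q.2 hq.2).ne'

theorem smooth_christoffel (hG : IsMetricFamily G I U) (k i j : Fin n) :
    SmoothFam (fun t => christoffel (G t) k i j) I U := by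
  have h := fun k i j => (hG.smooth i j).pd hG.isOpen_param hG.isOpen k
  exact (SmoothFam.const _).mul (SmoothFam.sum fun l _ =>
    (hG.smooth_inv k l).mul (((h i j l).add (h j i l)).sub (h l i j)))

theorem smooth_riemannCoord (hG : IsMetricFamily G I U) (i j l h : Fin n) :
    SmoothFam (fun t => riemannCoord (G t) i j l h) I U := by
  have hΓ := hG.smooth_christoffel
  have hd := fun k a b c => (hΓ a b c).pd hG.isOpen_param hG.isOpen k
  exact ((hd _ _ _ _).sub (hd _ _ _ _)).add (SmoothFam.sum fun m _ =>
    ((hΓ _ _ _).mul (hΓ _ _ _)).sub ((hΓ _ _ _).mul (hΓ _ _ _)))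

theorem smooth_ricciCoord (hG : IsMetricFamily G I U) (j l : Fin n) :
    SmoothFam (fun t => ricciCoord (G t) j l) I U :=
  SmoothFam.sum fun i _ => hG.smooth_riemannCoord i j l i

theorem smooth_scalarCoord (hG : IsMetricFamily G I U) :
    SmoothFam (fun t => scalarCoord (G t)) I U :=
  SmoothFam.sum fun j _ => SmoothFam.sum fun l _ =>
    (hG.smooth_inv j l).mul (hG.smooth_ricciCoord j l)

theorem smooth_gradSqCoord (hG : IsMetricFamily G I U) (hΦ : SmoothFam Φ I U) :
    SmoothFam (fun t => gradSqCoord (G t) (Φ t)) I U :=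
  SmoothFam.sum fun i _ => SmoothFam.sum fun j _ => (hG.smooth_inv i j).mul
    ((hΦ.pd hG.isOpen_param hG.isOpen i).mul (hΦ.pd hG.isOpen_param hG.isOpen j))

end IsMetricFamily

/-- A family of metrics on `U` with parameter derivative `V` at `t = 0`. -/
structure IsMetricVariation (G : ℝ → EuclideanSpace ℝ (Fin n) → Matrix (Fin n) (Fin n) ℝ)
    (V : EuclideanSpace ℝ (Fin n) → Matrix (Fin n) (Fin n) ℝ)
    (I : Set ℝ) (U : Set (EuclideanSpace ℝ (Fin n))) : Prop extends IsMetricFamily G I U where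
  zero_mem : (0 : ℝ) ∈ I
  hasDerivAt : ∀ y ∈ U, ∀ i j, HasDerivAt (fun t => G t y i j) (V y i j) 0

namespace IsMetricVariation

variable {G : ℝ → EuclideanSpace ℝ (Fin n) → Matrix (Fin n) (Fin n) ℝ}
  {V : EuclideanSpace ℝ (Fin n) → Matrix (Fin n) (Fin n) ℝ}

theorem metric_zero (hG : IsMetricVariation G V I U) : IsMetricOn (G 0) U :=
  hG.isMetricOn 0 hG.zero_mem

theorem dt_eq (hG : IsMetricVariation G V I U) (hy : y ∈ U) (i j : Fin n) :
    dt (fun t z => G t z i j) 0 y = V y i j :=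
  ((hG.smooth i j).hasDerivAt hG.isOpen_param hG.isOpen hG.zero_mem hy).unique
    (hG.hasDerivAt y hy i j)

/-- V is the `t`-derivative of a jointly smooth family, so its smoothness in the coordinates comes
with the family. -/
theorem smooth_variation (hG : IsMetricVariation G V I U) : SmoothMatOn V U := fun i j =>
  (((hG.smooth i j).dt hG.isOpen_param hG.isOpen).slice hG.zero_mem).congr
    fun _ hy => (hG.dt_eq hy i j).symm

theorem variation_symm (hG : IsMetricVariation G V I U) (hy : y ∈ U) (i j : Fin n) :
    V y i j = V y j i := by
  refine (hG.hasDerivAt y hy i j).unique ((hG.hasDerivAt y hy j i).congr_of_eventuallyEq ?_)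
  filter_upwards [hG.isOpen_param.mem_nhds hG.zero_mem] with t ht
  exact (hG.isMetricOn t ht).apply_symm hy i j

theorem hasDerivAt_pd (hG : IsMetricVariation G V I U) (hy : y ∈ U) (k i j : Fin n) :
    HasDerivAt (fun t => pd k (fun z => G t z i j) y) (pd k (fun z => V z i j) y) 0 := by
  have h := (hG.smooth i j).hasDerivAt_pd hG.isOpen_param hG.isOpen hG.zero_mem hy k
  rwa [pd_congr k hG.isOpen hy fun z hz => hG.dt_eq hz i j] at h

theorem hasDerivAt_inv (hG : IsMetricVariation G V I U) (hy : y ∈ U) (i j : Fin n) :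
    HasDerivAt (fun t => (G t y)⁻¹ i j) (-((G 0 y)⁻¹ * V y * (G 0 y)⁻¹) i j) 0 := by
  set D : Matrix (Fin n) (Fin n) ℝ := Matrix.of fun i j => dt (fun t z => (G t z)⁻¹ i j) 0 y with hD
  have h1 : ∀ i j, HasDerivAt (fun t => (G t y)⁻¹ i j) (D i j) 0 := fun i j =>
    (hG.smooth_inv i j).hasDerivAt hG.isOpen_param hG.isOpen hG.zero_mem hy
  -- Differentiability of the inverse is known from joint smoothness, so differentiating G G⁻¹ = 1,
  -- valid for t near 0, forces the value of D.
  have h2 : V y * (G 0 y)⁻¹ + G 0 y * D = 0 := by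
    ext i j
    have h3 : HasDerivAt (fun t => ∑ k, G t y i k * (G t y)⁻¹ k j)
        (∑ k, (V y i k * (G 0 y)⁻¹ k j + G 0 y i k * D k j)) 0 :=
      HasDerivAt.fun_sum fun k _ => (hG.hasDerivAt y hy i k).fun_mul (h1 k j)
    have h4 : HasDerivAt (fun t => ∑ k, G t y i k * (G t y)⁻¹ k j) 0 0 := by
      refine (hasDerivAt_const 0 ((1 : Matrix (Fin n) (Fin n) ℝ) i j)).congr_of_eventuallyEq ?_
      filter_upwards [hG.isOpen_param.mem_nhds hG.zero_mem] with t ht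
      rw [← (hG.isMetricOn t ht).mul_inv hy, Matrix.mul_apply]
    have h5 := h3.unique h4
    rw [Finset.sum_add_distrib] at h5
    exact h5
  have h6 : D = -((G 0 y)⁻¹ * V y * (G 0 y)⁻¹) := by
    have h7 := congrArg (fun X => (G 0 y)⁻¹ * X) h2
    simp only [Matrix.mul_add, ← Matrix.mul_assoc, hG.metric_zero.inv_mul hy, Matrix.one_mul,
      Matrix.mul_zero] at h7
    exact eq_neg_of_add_eq_zero_right h7
  have h8 := h1 i j
  rw [h6] at h8
  exact h8

theorem hasDerivAt_sqrt_det (hG : IsMetricVariation G V I U) (hy : y ∈ U) :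
    HasDerivAt (fun t => √(G t y).det) (√(G 0 y).det * (traceCoord (G 0 y) (V y) / 2)) 0 := by
  have hd := hG.metric_zero.det_pos y hy
  have h := (hasDerivAt_det (A := fun t => G t y) (hG.hasDerivAt y hy)).sqrt hd.ne'
  convert h using 1
  have hadj : (G 0 y).adjugate = (G 0 y).det • (G 0 y)⁻¹ := by
    rw [Matrix.inv_def, Ring.inverse_eq_inv', smul_smul, mul_inv_cancel₀ hd.ne', one_smul]
  rw [traceCoord_eq_trace (hG.metric_zero.inv_symm hy), hadj, Matrix.smul_mul, Matrix.trace_smul,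
    smul_eq_mul, eq_div_iff (by positivity)]
  linear_combination ((G 0 y)⁻¹ * V y).trace * Real.mul_self_sqrt hd.le

/-- The derivative of the Christoffel symbols. -/
def _root_.Perelman.dChristoffel (G : ℝ → EuclideanSpace ℝ (Fin n) → Matrix (Fin n) (Fin n) ℝ)
    (k i j : Fin n) : EuclideanSpace ℝ (Fin n) → ℝ :=
  dt (fun t => christoffel (G t) k i j) 0

theorem hasDerivAt_christoffel (hG : IsMetricVariation G V I U) (hy : y ∈ U) (k i j : Fin n) :
    HasDerivAt (fun t => christoffel (G t) k i j y) (dChristoffel G k i j y) 0 :=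
  (hG.smooth_christoffel k i j).hasDerivAt hG.isOpen_param hG.isOpen hG.zero_mem hy

theorem smooth_dChristoffel (hG : IsMetricVariation G V I U) (k i j : Fin n) :
    ContDiffOn ℝ ∞ (dChristoffel G k i j) U :=
  ((hG.smooth_christoffel k i j).dt hG.isOpen_param hG.isOpen).slice hG.zero_mem

theorem covDerivCoord_symm (hG : IsMetricVariation G V I U) (hy : y ∈ U) (k i j : Fin n) :
    covDerivCoord (G 0) V k i j y = covDerivCoord (G 0) V k j i y := by
  simp only [covDerivCoord]
  rw [pd_congr k hG.isOpen hy fun z hz => hG.variation_symm hz i j]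
  congr 1
  refine Finset.sum_congr rfl fun m _ => ?_
  rw [hG.variation_symm hy m j, hG.variation_symm hy i m]
  ring

/-- Differentiating `lower_christoffel` gives partial derivatives of V minus V_ak Γᵏ_ij. That
leftover is exactly what turns the partial derivatives into covariant ones, which is why δΓ is a
tensor. -/
theorem lower_dChristoffel (hG : IsMetricVariation G V I U) (hy : y ∈ U) (a i j : Fin n) :
    ∑ k, G 0 y a k * dChristoffel G k i j y
      = (1 / 2) * (covDerivCoord (G 0) V i j a y + covDerivCoord (G 0) V j i a y
        - covDerivCoord (G 0) V a i j y) := by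
  have h1 : HasDerivAt (fun t => ∑ k, G t y a k * christoffel (G t) k i j y)
      (∑ k, (V y a k * christoffel (G 0) k i j y + G 0 y a k * dChristoffel G k i j y)) 0 :=
    HasDerivAt.fun_sum fun k _ =>
      (hG.hasDerivAt y hy a k).fun_mul (hG.hasDerivAt_christoffel hy k i j)
  have h2 : HasDerivAt (fun t => ∑ k, G t y a k * christoffel (G t) k i j y)
      ((1 / 2) * (pd i (fun z => V z j a) y + pd j (fun z => V z i a) y
        - pd a (fun z => V z i j) y)) 0 := by
    refine ((((hG.hasDerivAt_pd hy i j a).fun_add (hG.hasDerivAt_pd hy j i a)).fun_sub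
      (hG.hasDerivAt_pd hy a i j)).const_mul (1 / 2)).congr_of_eventuallyEq ?_
    filter_upwards [hG.isOpen_param.mem_nhds hG.zero_mem] with t ht
    exact (hG.isMetricOn t ht).lower_christoffel hy a i j
  have h3 := h1.unique h2
  rw [Finset.sum_add_distrib] at h3
  -- Of the six Christoffel corrections four cancel in pairs by symmetry of Γ and V; the other two
  -- are equal and account for the V·Γ term.
  simp only [covDerivCoord, Finset.sum_add_distrib]
  simp only [hG.metric_zero.christoffel_symm hy _ j i, hG.metric_zero.christoffel_symm hy _ a i,
    hG.metric_zero.christoffel_symm hy _ a j, hG.variation_symm hy i, hG.variation_symm hy j]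
  have h4 : ∑ k, V y a k * christoffel (G 0) k i j y
      = ∑ m, christoffel (G 0) m i j y * V y m a :=
    Finset.sum_congr rfl fun m _ => by rw [hG.variation_symm hy a m, mul_comm]
  rw [h4] at h3
  linear_combination h3

theorem dChristoffel_eq (hG : IsMetricVariation G V I U) (hy : y ∈ U) (k i j : Fin n) :
    dChristoffel G k i j y = ∑ a, (G 0 y)⁻¹ k a *
      ((1 / 2) * (covDerivCoord (G 0) V i j a y + covDerivCoord (G 0) V j i a y
        - covDerivCoord (G 0) V a i j y)) := by
  have h : (G 0 y)⁻¹ *ᵥ (G 0 y *ᵥ fun k => dChristoffel G k i j y)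
      = fun k => dChristoffel G k i j y := by
    rw [Matrix.mulVec_mulVec, hG.metric_zero.inv_mul hy, Matrix.one_mulVec]
  rw [← congrFun h k]
  simp only [← hG.lower_dChristoffel hy]
  rfl

/-- In the trace over the upper and first lower index, the terms ∇_i V_la and −∇_a V_il cancel,
which leaves half the gradient of tr V. -/
theorem sum_dChristoffel (hG : IsMetricVariation G V I U) (hy : y ∈ U) (l : Fin n) :
    ∑ i, dChristoffel G i i l y
      = (1 / 2) * pd l (fun z => traceCoord (G 0 z) (V z)) y := by
  rw [hG.metric_zero.pd_traceCoord hy hG.smooth_variation]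
  simp only [hG.dChristoffel_eq hy, traceCoord, Matrix.of_apply]
  have h1 : ∑ i, ∑ a, (G 0 y)⁻¹ i a * covDerivCoord (G 0) V i l a y
      = ∑ i, ∑ a, (G 0 y)⁻¹ i a * covDerivCoord (G 0) V a i l y := by
    rw [Finset.sum_comm]
    refine Finset.sum_congr rfl fun i _ => Finset.sum_congr rfl fun a _ => ?_
    rw [hG.metric_zero.inv_apply_symm hy, hG.covDerivCoord_symm hy a l i]
  have h2 : ∀ i a, (G 0 y)⁻¹ i a * ((1 / 2) * (covDerivCoord (G 0) V i l a y
      + covDerivCoord (G 0) V l i a y - covDerivCoord (G 0) V a i l y))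
      = (1 / 2) * ((G 0 y)⁻¹ i a * covDerivCoord (G 0) V i l a y)
        + (1 / 2) * ((G 0 y)⁻¹ i a * covDerivCoord (G 0) V l i a y)
        - (1 / 2) * ((G 0 y)⁻¹ i a * covDerivCoord (G 0) V a i l y) := fun i a => by ring
  simp only [h2, Finset.sum_sub_distrib, Finset.sum_add_distrib, ← Finset.mul_sum]
  rw [h1]
  ring

/-- Here two of the three terms each give div V and the third gives −½ d tr V. With
`sum_dChristoffel` these are the only two traces of δΓ that enter δR. -/
theorem trace_dChristoffel (hG : IsMetricVariation G V I U) (hy : y ∈ U) (i : Fin n) :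
    traceCoord (G 0 y) (Matrix.of fun j l => dChristoffel G i j l y) = ∑ a, (G 0 y)⁻¹ i a *
      (divTwo (G 0) V a y - (1 / 2) * pd a (fun z => traceCoord (G 0 z) (V z)) y) := by
  have h1 : ∀ a, divTwo (G 0) V a y - (1 / 2) * pd a (fun z => traceCoord (G 0 z) (V z)) y
      = ∑ j, ∑ l, (G 0 y)⁻¹ j l * ((1 / 2) * (covDerivCoord (G 0) V j l a y
        + covDerivCoord (G 0) V l j a y - covDerivCoord (G 0) V a j l y)) := by
    intro a
    rw [hG.metric_zero.pd_traceCoord hy hG.smooth_variation]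
    have h3 : ∑ j, ∑ l, (G 0 y)⁻¹ j l * covDerivCoord (G 0) V j l a y
        = divTwo (G 0) V a y := by
      simp only [divTwo, traceCoord, Matrix.of_apply]
      rw [Finset.sum_comm]
      refine Finset.sum_congr rfl fun i _ => Finset.sum_congr rfl fun l _ => ?_
      rw [hG.metric_zero.inv_apply_symm hy, hG.covDerivCoord_symm hy l i a]
    have h4 : ∑ j, ∑ l, (G 0 y)⁻¹ j l * covDerivCoord (G 0) V l j a y
        = divTwo (G 0) V a y := by
      simp only [divTwo, traceCoord, Matrix.of_apply]
      refine Finset.sum_congr rfl fun i _ => Finset.sum_congr rfl fun l _ => ?_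
      rw [hG.covDerivCoord_symm hy l i a]
    have h2 : ∀ j l, (G 0 y)⁻¹ j l * ((1 / 2) * (covDerivCoord (G 0) V j l a y
        + covDerivCoord (G 0) V l j a y - covDerivCoord (G 0) V a j l y))
        = (1 / 2) * ((G 0 y)⁻¹ j l * covDerivCoord (G 0) V j l a y)
          + (1 / 2) * ((G 0 y)⁻¹ j l * covDerivCoord (G 0) V l j a y)
          - (1 / 2) * ((G 0 y)⁻¹ j l * covDerivCoord (G 0) V a j l y) := fun i a => by ring
    simp only [h2, Finset.sum_sub_distrib, Finset.sum_add_distrib, ← Finset.mul_sum]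
    rw [h3, h4]
    simp only [traceCoord, Matrix.of_apply]
    ring
  simp only [h1]
  simp only [traceCoord, Matrix.of_apply, hG.dChristoffel_eq hy, Finset.mul_sum]
  calc _ = ∑ j, ∑ a, ∑ l, _ := Finset.sum_congr rfl fun _ _ => Finset.sum_comm
    _ = ∑ a, ∑ j, ∑ l, _ := Finset.sum_comm
    _ = _ := by
      refine Finset.sum_congr rfl fun a _ => Finset.sum_congr rfl fun j _ =>
        Finset.sum_congr rfl fun l _ => ?_
      ring

/-- The derivative of the Ricci tensor. -/
def _root_.Perelman.dRicci (G : ℝ → EuclideanSpace ℝ (Fin n) → Matrix (Fin n) (Fin n) ℝ)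
    (j l : Fin n) (y : EuclideanSpace ℝ (Fin n)) : ℝ :=
  ∑ i, (pd i (dChristoffel G i j l) y - pd j (dChristoffel G i i l) y
    + ∑ m, (dChristoffel G i i m y * christoffel (G 0) m j l y
      + christoffel (G 0) i i m y * dChristoffel G m j l y
      - (dChristoffel G i j m y * christoffel (G 0) m i l y
      + christoffel (G 0) i j m y * dChristoffel G m i l y)))

theorem hasDerivAt_ricciCoord (hG : IsMetricVariation G V I U) (hy : y ∈ U) (j l : Fin n) :
    HasDerivAt (fun t => ricciCoord (G t) j l y) (dRicci G j l y) 0 := by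
  have hΓ := hG.hasDerivAt_christoffel hy
  have hd : ∀ k a b c, HasDerivAt (fun t => pd k (christoffel (G t) a b c) y)
      (pd k (dChristoffel G a b c) y) 0 := fun k a b c =>
    (hG.smooth_christoffel a b c).hasDerivAt_pd hG.isOpen_param hG.isOpen hG.zero_mem hy k
  exact HasDerivAt.fun_sum fun i _ => ((hd _ _ _ _).fun_sub (hd _ _ _ _)).fun_add
    (HasDerivAt.fun_sum fun m _ => ((hΓ _ _ _).fun_mul (hΓ _ _ _)).fun_sub
      ((hΓ _ _ _).fun_mul (hΓ _ _ _)))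

theorem trace_dRicci (hG : IsMetricVariation G V I U) (hy : y ∈ U) :
    ∑ j, ∑ l, (G 0 y)⁻¹ j l * dRicci G j l y
      = -laplacianCoord (G 0) (fun z => traceCoord (G 0 z) (V z)) y + divDivCoord (G 0) V y := by
  have hG0 := hG.metric_zero
  have hV := hG.smooth_variation
  set τ : EuclideanSpace ℝ (Fin n) → ℝ := fun z => traceCoord (G 0 z) (V z) with hτ
  have hτs : ContDiffOn ℝ ∞ τ U := hG0.smooth_traceCoord hV
  have hdτ := fun j => hτs.pd hG.isOpen j
  have hdτ2 : ∀ j : Fin n, ContDiffOn ℝ ∞ (fun z => (1 / 2 : ℝ) * pd j τ z) U :=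
    fun j => contDiffOn_const.mul (hdτ j)
  have hdiv := fun j => hG0.smooth_divTwo hV j
  set k : Fin n → EuclideanSpace ℝ (Fin n) → ℝ :=
    fun a z => divTwo (G 0) V a z - (1 / 2) * pd a τ z with hk
  have hks : ∀ j, ContDiffOn ℝ ∞ (k j) U := fun j => (hdiv j).sub (hdτ2 j)
  have hC := hG.smooth_dChristoffel
  have hC' : ∀ a b c, DifferentiableAt ℝ (dChristoffel G a b c) y := fun a b c =>
    diffAt hG.isOpen hy (hC a b c)
  set κ : Fin n → EuclideanSpace ℝ (Fin n) → ℝ :=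
    fun i z => traceCoord (G 0 z) (Matrix.of fun j l => dChristoffel G i j l z) with hκ
  have hκs : ∀ i, ContDiffOn ℝ ∞ (κ i) U := fun i => hG0.smooth_traceCoord fun j l => hC i j l
  -- the two traces of the derivative of the connection
  have hpos : 0 < √(G 0 y).det := Real.sqrt_pos.2 (hG0.det_pos y hy)
  have e1 : ∑ i, (pd i (κ i) y + ∑ m, christoffel (G 0) i i m y * κ m y) = codiff (G 0) k y := by
    have h1 := hG0.sum_pd_vectorDensity hy hks
    -- By `trace_dChristoffel`, κ is `k` with its index raised, so √g κⁱ is the vector density of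
    -- `k` and its divergence is given by `sum_pd_vectorDensity`.
    have h2 : ∀ i, pd i (vectorDensity (G 0) k i) y
        = √(G 0 y).det * ((connection (G 0) i y).trace * κ i y + pd i (κ i) y) := by
      intro i
      rw [pd_congr i hG.isOpen hy (w := fun z => √(G 0 z).det * κ i z) (fun z hz => by
        rw [hκ, vectorDensity, ← hG.trace_dChristoffel hz]), pd_mul i
        (diffAt hG.isOpen hy hG0.smooth_sqrt_det) (diffAt hG.isOpen hy (hκs i)),
        hG0.pd_sqrt_det hy]
      ring
    simp only [h2] at h1
    rw [← Finset.mul_sum] at h1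
    rw [← mul_left_cancel₀ hpos.ne' h1]
    simp only [Finset.sum_add_distrib]
    rw [add_comm]
    congr 1
    rw [Finset.sum_comm]
    refine Finset.sum_congr rfl fun m _ => ?_
    rw [← Finset.sum_mul]
    congr 1
    exact Finset.sum_congr rfl fun i _ => hG0.christoffel_symm hy i i m
  -- The second Palatini term ∇_j δΓⁱ_il: the traced symbol is the covector ½ dτ.
  have e2 : ∀ j l, ∑ i, pd j (dChristoffel G i i l) y - ∑ m, (∑ i, dChristoffel G i i m y)
      * christoffel (G 0) m j l y = covDerivOne (G 0) (fun a z => (1 / 2) * pd a τ z) j l y := by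
    intro j l
    rw [covDerivOne, ← pd_sum _ _ fun i _ => hC' i i l]
    congr 1
    · exact pd_congr j hG.isOpen hy fun z hz => hG.sum_dChristoffel hz l
    · exact Finset.sum_congr rfl fun m _ => by rw [hG.sum_dChristoffel hy m, mul_comm]
  have e3 : ∀ i, pd i (κ i) y = ∑ j, ∑ l, (G 0 y)⁻¹ j l * (pd i (dChristoffel G i j l) y
      - ∑ m, (christoffel (G 0) m i j y * dChristoffel G i m l y
        + christoffel (G 0) m i l y * dChristoffel G i j m y)) := fun i =>
    hG0.pd_traceCoord hy (B := fun z => Matrix.of fun j l => dChristoffel G i j l z)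
      (fun j l => hC i j l) i
  -- Palatini's identity: the products Γ·δΓ in the linearized curvature are precisely the
  -- corrections in ∇_i δΓⁱ_jl − ∇_j δΓⁱ_il. Tracing the first term gives div div V − ½Δτ, and the
  -- second subtracts another ½Δτ.
  have e4 : ∀ j l, dRicci G j l y = ∑ i, (pd i (dChristoffel G i j l) y
      - ∑ m, (christoffel (G 0) m i j y * dChristoffel G i m l y
        + christoffel (G 0) m i l y * dChristoffel G i j m y)
      + ∑ m, christoffel (G 0) i i m y * dChristoffel G m j l y)
      - covDerivOne (G 0) (fun a z => (1 / 2) * pd a τ z) j l y := by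
    intro j l
    rw [← e2 j l, dRicci]
    have h1 : ∑ i, ∑ m, christoffel (G 0) i j m y * dChristoffel G m i l y
        = ∑ i, ∑ m, christoffel (G 0) m i j y * dChristoffel G i m l y := by
      rw [Finset.sum_comm]
      refine Finset.sum_congr rfl fun i _ => Finset.sum_congr rfl fun m _ => ?_
      rw [hG0.christoffel_symm hy]
    have h2 : ∑ m, (∑ i, dChristoffel G i i m y) * christoffel (G 0) m j l y
        = ∑ i, ∑ m, dChristoffel G i i m y * christoffel (G 0) m j l y := by
      rw [Finset.sum_comm]
      simp only [Finset.sum_mul]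
    have h3 : ∑ i, ∑ m, dChristoffel G i j m y * christoffel (G 0) m i l y
        = ∑ i, ∑ m, christoffel (G 0) m i l y * dChristoffel G i j m y := by
      simp only [mul_comm]
    rw [h2]
    simp only [Finset.sum_add_distrib, Finset.sum_sub_distrib]
    rw [h1, h3]
    ring
  have e5 : ∑ j, ∑ l, (G 0 y)⁻¹ j l * ∑ i, (pd i (dChristoffel G i j l) y
      - ∑ m, (christoffel (G 0) m i j y * dChristoffel G i m l y
        + christoffel (G 0) m i l y * dChristoffel G i j m y)
      + ∑ m, christoffel (G 0) i i m y * dChristoffel G m j l y) = codiff (G 0) k y := by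
    rw [← e1]
    have h1 : ∀ i, pd i (κ i) y + ∑ m, christoffel (G 0) i i m y * κ m y
        = ∑ j, ∑ l, (G 0 y)⁻¹ j l * (pd i (dChristoffel G i j l) y
          - ∑ m, (christoffel (G 0) m i j y * dChristoffel G i m l y
            + christoffel (G 0) m i l y * dChristoffel G i j m y)
          + ∑ m, christoffel (G 0) i i m y * dChristoffel G m j l y) := by
      intro i
      have h2 : ∑ m, christoffel (G 0) i i m y * κ m y = ∑ j, ∑ l, (G 0 y)⁻¹ j l *
          ∑ m, christoffel (G 0) i i m y * dChristoffel G m j l y := by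
        simp only [hκ, traceCoord, Matrix.of_apply, Finset.mul_sum]
        rw [Finset.sum_comm]
        refine Finset.sum_congr rfl fun j _ => ?_
        rw [Finset.sum_comm]
        refine Finset.sum_congr rfl fun l _ => Finset.sum_congr rfl fun m _ => ?_
        ring
      rw [e3, h2]
      simp only [← Finset.sum_add_distrib, ← mul_add]
    simp only [h1]
    simp only [Finset.mul_sum (s := Finset.univ) (f := fun i => pd i (dChristoffel G i _ _) y - _ + _)]
    symm
    rw [Finset.sum_comm]
    refine Finset.sum_congr rfl fun j _ => ?_
    rw [Finset.sum_comm]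
  simp only [e4, mul_sub, Finset.sum_sub_distrib]
  rw [e5]
  have e6 : ∑ j, ∑ l, (G 0 y)⁻¹ j l * covDerivOne (G 0) (fun a z => (1 / 2) * pd a τ z) j l y
      = codiff (G 0) (fun a z => (1 / 2) * pd a τ z) y := rfl
  have e7 : codiff (G 0) (fun a z => (1 / 2) * pd a τ z) y
      = (1 / 2) * codiff (G 0) (fun a z => pd a τ z) y := by
    rw [hG0.codiff_mul hy contDiffOn_const hdτ]
    simp [covectorInner, pd_const]
  rw [e6, hk, hG0.codiff_sub hy hdiv hdτ2, e7, hG0.divDivCoord_eq hy hV, IsMetricOn.laplacianCoord_eq]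
  ring

theorem sum_inv_mul_inv (hG : IsMetricVariation G V I U) (hy : y ∈ U)
    (B : Matrix (Fin n) (Fin n) ℝ) :
    ∑ j, ∑ l, ((G 0 y)⁻¹ * V y * (G 0 y)⁻¹) j l * B j l = pairingCoord (G 0 y) (V y) B := by
  simp only [pairingCoord, Matrix.mul_apply, Finset.sum_mul]
  let F : Fin n → Fin n → Fin n → Fin n → ℝ := fun a b j l =>
    (G 0 y)⁻¹ a j * (G 0 y)⁻¹ b l * (V y a b * B j l)
  calc _ = ∑ j, ∑ l, ∑ b, ∑ a, F a b j l := by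
        refine Finset.sum_congr rfl fun j _ => Finset.sum_congr rfl fun l _ =>
          Finset.sum_congr rfl fun b _ => Finset.sum_congr rfl fun a _ => ?_
        simp only [F]
        rw [hG.metric_zero.inv_apply_symm hy a j]
        ring
    _ = ∑ b, ∑ a, ∑ j, ∑ l, F a b j l := sum_comm₂ _
    _ = _ := Finset.sum_comm

/-- The variation formula for the scalar curvature. -/
theorem hasDerivAt_scalarCoord (hG : IsMetricVariation G V I U) (hy : y ∈ U) :
    HasDerivAt (fun t => scalarCoord (G t) y)
      (-laplacianCoord (G 0) (fun z => traceCoord (G 0 z) (V z)) y + divDivCoord (G 0) V y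
        - pairingCoord (G 0 y) (V y) (Matrix.of fun i j => ricciCoord (G 0) i j y)) 0 := by
  have h : HasDerivAt (fun t => scalarCoord (G t) y)
      (∑ j, ∑ l, (-((G 0 y)⁻¹ * V y * (G 0 y)⁻¹) j l * ricciCoord (G 0) j l y
        + (G 0 y)⁻¹ j l * dRicci G j l y)) 0 :=
    HasDerivAt.fun_sum fun j _ => HasDerivAt.fun_sum fun l _ =>
      (hG.hasDerivAt_inv hy j l).fun_mul (hG.hasDerivAt_ricciCoord hy j l)
  convert h using 1
  rw [← hG.trace_dRicci hy, ← hG.sum_inv_mul_inv hy]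
  simp only [Finset.sum_add_distrib, neg_mul, Finset.sum_neg_distrib, Matrix.of_apply]
  ring

theorem hasDerivAt_gradSqCoord (hG : IsMetricVariation G V I U) (hΦ : SmoothFam Φ I U)
    (hy : y ∈ U) :
    HasDerivAt (fun t => gradSqCoord (G t) (Φ t) y)
      (-pairingCoord (G 0 y) (V y) (Matrix.of fun i j => pd i (Φ 0) y * pd j (Φ 0) y)
        + 2 * covectorInner (G 0 y) (fun i => pd i (Φ 0) y) (fun j => pd j (dt Φ 0) y)) 0 := by
  have hd := hΦ.hasDerivAt_pd hG.isOpen_param hG.isOpen hG.zero_mem hy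
  have h : HasDerivAt (fun t => gradSqCoord (G t) (Φ t) y)
      (∑ i, ∑ j, (-((G 0 y)⁻¹ * V y * (G 0 y)⁻¹) i j * (pd i (Φ 0) y * pd j (Φ 0) y)
        + (G 0 y)⁻¹ i j * (pd i (dt Φ 0) y * pd j (Φ 0) y + pd i (Φ 0) y * pd j (dt Φ 0) y))) 0 :=
    HasDerivAt.fun_sum fun i _ => HasDerivAt.fun_sum fun j _ =>
      (hG.hasDerivAt_inv hy i j).fun_mul ((hd i).fun_mul (hd j))
  convert h using 1
  rw [← hG.sum_inv_mul_inv hy]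
  have h1 : ∑ i, ∑ j, (G 0 y)⁻¹ i j * (pd i (dt Φ 0) y * pd j (Φ 0) y)
      = ∑ i, ∑ j, (G 0 y)⁻¹ i j * (pd i (Φ 0) y * pd j (dt Φ 0) y) := by
    rw [Finset.sum_comm]
    refine Finset.sum_congr rfl fun i _ => Finset.sum_congr rfl fun j _ => ?_
    rw [hG.metric_zero.inv_apply_symm hy, mul_comm (pd _ _ _)]
  simp only [mul_add, Finset.sum_add_distrib, neg_mul, Finset.sum_neg_distrib, Matrix.of_apply,
    covectorInner]
  rw [h1]
  ring

end IsMetricVariation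

end Families

/-! ### Transformation laws under a change of coordinates. -/

section CoordinateChange

variable {n : ℕ}

/-- The Jacobian matrix `∂ψᵏ/∂xⁱ`. -/
def jac (ψ : EuclideanSpace ℝ (Fin n) → EuclideanSpace ℝ (Fin n)) (y : EuclideanSpace ℝ (Fin n)) :
    Matrix (Fin n) (Fin n) ℝ :=
  Matrix.of fun k i => pd i (fun z => ψ z k) y

theorem traceCoord_eq (G₀ A : Matrix (Fin n) (Fin n) ℝ) :
    traceCoord G₀ A = (G₀⁻¹ * Aᵀ).trace := by
  simp [traceCoord, Matrix.trace, Matrix.mul_apply]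

theorem pairingCoord_eq (G₀ A B : Matrix (Fin n) (Fin n) ℝ) :
    pairingCoord G₀ A B = ((G₀⁻¹)ᵀ * A * G₀⁻¹ * Bᵀ).trace := by
  simp only [pairingCoord, Matrix.trace, Matrix.mul_apply, Matrix.diag, Matrix.transpose_apply,
    Finset.sum_mul]
  let F : Fin n → Fin n → Fin n → Fin n → ℝ := fun i j k l =>
    G₀⁻¹ i k * G₀⁻¹ j l * (A i j * B k l)
  calc _ = ∑ k, ∑ l, ∑ i, ∑ j, F i j k l := sum_comm₂ F
    _ = ∑ k, ∑ l, ∑ j, ∑ i, F i j k l :=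
      Finset.sum_congr rfl fun _ _ => Finset.sum_congr rfl fun _ _ => Finset.sum_comm
    _ = _ := by
      refine Finset.sum_congr rfl fun k _ => Finset.sum_congr rfl fun l _ =>
        Finset.sum_congr rfl fun j _ => Finset.sum_congr rfl fun i _ => ?_
      simp only [F]
      ring

theorem inv_congruence (G₀ : Matrix (Fin n) (Fin n) ℝ) (J : Matrix (Fin n) (Fin n) ℝ) :
    (Jᵀ * G₀ * J)⁻¹ = J⁻¹ * G₀⁻¹ * (J⁻¹)ᵀ := by
  rw [Matrix.mul_inv_rev, Matrix.mul_inv_rev, Matrix.transpose_nonsing_inv, Matrix.mul_assoc]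

/-- Since (JᵀG₀J)⁻¹ = J⁻¹G₀⁻¹J⁻ᵀ, the Jacobians cancel inside the trace by cyclicity; the full
contraction behaves in the same way. -/
theorem traceCoord_congruence (G₀ A : Matrix (Fin n) (Fin n) ℝ) {J : Matrix (Fin n) (Fin n) ℝ}
    (hJ : IsUnit J.det) : traceCoord (Jᵀ * G₀ * J) (Jᵀ * A * J) = traceCoord G₀ A := by
  have h1 : J * J⁻¹ = 1 := Matrix.mul_nonsing_inv _ hJ
  have h2 : (J⁻¹)ᵀ * Jᵀ = 1 := by rw [← Matrix.transpose_mul, h1, Matrix.transpose_one]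
  rw [traceCoord_eq, traceCoord_eq, inv_congruence]
  simp only [Matrix.transpose_mul, Matrix.transpose_transpose]
  rw [Matrix.mul_assoc (J⁻¹ * G₀⁻¹), ← Matrix.mul_assoc (J⁻¹)ᵀ, h2, Matrix.one_mul,
    Matrix.mul_assoc J⁻¹, Matrix.trace_mul_comm, Matrix.mul_assoc, Matrix.mul_assoc, h1,
    Matrix.mul_one]

theorem pairingCoord_congruence (G₀ A B : Matrix (Fin n) (Fin n) ℝ)
    {J : Matrix (Fin n) (Fin n) ℝ} (hJ : IsUnit J.det) :
    pairingCoord (Jᵀ * G₀ * J) (Jᵀ * A * J) (Jᵀ * B * J) = pairingCoord G₀ A B := by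
  have h1 : J * J⁻¹ = 1 := Matrix.mul_nonsing_inv _ hJ
  have h2 : (J⁻¹)ᵀ * Jᵀ = 1 := by rw [← Matrix.transpose_mul, h1, Matrix.transpose_one]
  rw [pairingCoord_eq, pairingCoord_eq, inv_congruence]
  simp only [Matrix.transpose_mul, Matrix.transpose_transpose]
  have e : J⁻¹ * ((G₀⁻¹)ᵀ * (J⁻¹)ᵀ) * (Jᵀ * A * J) * (J⁻¹ * G₀⁻¹ * (J⁻¹)ᵀ) * (Jᵀ * (Bᵀ * J))
      = J⁻¹ * ((G₀⁻¹)ᵀ * ((J⁻¹)ᵀ * Jᵀ) * A * (J * J⁻¹) * G₀⁻¹ * ((J⁻¹)ᵀ * Jᵀ) * Bᵀ * J) := by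
    simp only [Matrix.mul_assoc]
  rw [e, Matrix.trace_mul_comm, h1, h2]
  simp only [Matrix.mul_one, Matrix.mul_assoc, h1]

theorem covectorInner_eq (G₀ : Matrix (Fin n) (Fin n) ℝ) (α β : Fin n → ℝ) :
    covectorInner G₀ α β = traceCoord G₀ (Matrix.vecMulVec α β) := rfl

theorem covectorInner_congruence (G₀ : Matrix (Fin n) (Fin n) ℝ) (α β : Fin n → ℝ)
    {J : Matrix (Fin n) (Fin n) ℝ} (hJ : IsUnit J.det) :
    covectorInner (Jᵀ * G₀ * J) (Jᵀ *ᵥ α) (Jᵀ *ᵥ β) = covectorInner G₀ α β := by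
  rw [covectorInner_eq, covectorInner_eq, ← traceCoord_congruence G₀ _ hJ, Matrix.mul_vecMulVec,
    Matrix.vecMulVec_mul, Matrix.mulVec_transpose (x := β)]

/-- The curvature endomorphism `R(∂_i, ∂_j)`. -/
def curvature (G : EuclideanSpace ℝ (Fin n) → Matrix (Fin n) (Fin n) ℝ) (i j : Fin n)
    (y : EuclideanSpace ℝ (Fin n)) : Matrix (Fin n) (Fin n) ℝ :=
  pdM i (connection G j) y - pdM j (connection G i) y
    + (connection G i y * connection G j y - connection G j y * connection G i y)

theorem riemannCoord_eq (G : EuclideanSpace ℝ (Fin n) → Matrix (Fin n) (Fin n) ℝ) (i j l h : Fin n)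
    (y : EuclideanSpace ℝ (Fin n)) : riemannCoord G i j l h y = curvature G i j y h l := by
  simp only [riemannCoord, curvature, Matrix.add_apply, Matrix.sub_apply, Matrix.mul_apply, pdM,
    connection, Matrix.of_apply, Finset.sum_sub_distrib]

/-- `G'` is the pull-back of the metric `G` on `U` by the map `ψ : W → U`. -/
structure IsPullback (G' G : EuclideanSpace ℝ (Fin n) → Matrix (Fin n) (Fin n) ℝ)
    (ψ : EuclideanSpace ℝ (Fin n) → EuclideanSpace ℝ (Fin n))
    (W U : Set (EuclideanSpace ℝ (Fin n))) : Prop where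
  metric' : IsMetricOn G' W
  metric : IsMetricOn G U
  smooth : ContDiffOn ℝ ∞ ψ W
  mapsTo : MapsTo ψ W U
  isUnit_jac : ∀ y ∈ W, IsUnit (jac ψ y).det
  eq : ∀ y ∈ W, G' y = (jac ψ y)ᵀ * G (ψ y) * jac ψ y

namespace IsPullback

variable {G' G B : EuclideanSpace ℝ (Fin n) → Matrix (Fin n) (Fin n) ℝ}
  {ψ : EuclideanSpace ℝ (Fin n) → EuclideanSpace ℝ (Fin n)}
  {W U : Set (EuclideanSpace ℝ (Fin n))} {y : EuclideanSpace ℝ (Fin n)}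
  {u : EuclideanSpace ℝ (Fin n) → ℝ}

theorem isOpen (h : IsPullback G' G ψ W U) : IsOpen W := h.metric'.isOpen

theorem smooth_apply (h : IsPullback G' G ψ W U) (k : Fin n) :
    ContDiffOn ℝ ∞ (fun z => ψ z k) W := by
  have := h.smooth
  rw [contDiffOn_euclidean] at this
  exact this k

theorem smooth_comp (h : IsPullback G' G ψ W U) (hu : ContDiffOn ℝ ∞ u U) :
    ContDiffOn ℝ ∞ (fun z => u (ψ z)) W := hu.comp h.smooth h.mapsTo

theorem smooth_jac (h : IsPullback G' G ψ W U) : SmoothMatOn (jac ψ) W :=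
  fun k i => (h.smooth_apply k).pd h.isOpen i

theorem pd_comp (h : IsPullback G' G ψ W U) (hy : y ∈ W) (hu : ContDiffOn ℝ ∞ u U) (i : Fin n) :
    pd i (fun z => u (ψ z)) y = ∑ q, jac ψ y q i * pd q u (ψ y) := by
  have hψ : DifferentiableAt ℝ ψ y :=
    (h.smooth.contDiffAt (h.isOpen.mem_nhds hy)).differentiableAt (by simp)
  have hu' := diffAt h.metric.isOpen (h.mapsTo hy) hu
  have h1 : fderiv ℝ (fun z => u (ψ z)) y = (fderiv ℝ u (ψ y)).comp (fderiv ℝ ψ y) :=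
    fderiv_comp y hu' hψ
  rw [pd, h1, ContinuousLinearMap.comp_apply, fderiv_apply_eq_sum_pd]
  refine Finset.sum_congr rfl fun q _ => ?_
  congr 1
  have h2 : HasFDerivAt (fun z => ψ z q) ((EuclideanSpace.proj q).comp (fderiv ℝ ψ y)) y :=
    (EuclideanSpace.proj (𝕜 := ℝ) q).hasFDerivAt.comp y hψ.hasFDerivAt
  rw [jac, Matrix.of_apply, pd, h2.fderiv]
  rfl

theorem pdM_comp (h : IsPullback G' G ψ W U) (hy : y ∈ W) (hB : SmoothMatOn B U) (i : Fin n) :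
    pdM i (fun z => B (ψ z)) y = ∑ q, jac ψ y q i • pdM q B (ψ y) := by
  ext a b
  rw [pdM, Matrix.of_apply, h.pd_comp hy (hB a b), Matrix.sum_apply]
  rfl

/-- The pull-back of the connection form. -/
def pullConn (G : EuclideanSpace ℝ (Fin n) → Matrix (Fin n) (Fin n) ℝ)
    (ψ : EuclideanSpace ℝ (Fin n) → EuclideanSpace ℝ (Fin n)) (i : Fin n)
    (y : EuclideanSpace ℝ (Fin n)) : Matrix (Fin n) (Fin n) ℝ :=
  ∑ q, jac ψ y q i • connection G q (ψ y)

theorem pd_jac_symm (h : IsPullback G' G ψ W U) (hy : y ∈ W) (k i q : Fin n) :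
    pd k (fun z => jac ψ z q i) y = pd i (fun z => jac ψ z q k) y :=
  pd_comm h.isOpen hy (h.smooth_apply q) k i

/-- The transformation law of the Christoffel symbols. -/
theorem jac_mul_connection (h : IsPullback G' G ψ W U) (hy : y ∈ W) (i : Fin n) :
    jac ψ y * connection G' i y = pdM i (jac ψ) y + pullConn G ψ i y * jac ψ y := by
  set J := jac ψ y with hJ
  have hJu := h.isUnit_jac y hy
  have h1 : J * J⁻¹ = 1 := Matrix.mul_nonsing_inv _ hJu
  -- J⁻¹D is the candidate connection in the new coordinates. It is torsion-free because ∂²ψ and Γ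
  -- are symmetric, and compatible with JᵀGJ by the product rule, so `connection_unique` identifies
  -- it.
  set D : Fin n → Matrix (Fin n) (Fin n) ℝ := fun i => pdM i (jac ψ) y + pullConn G ψ i y * J
    with hD
  have hDs : ∀ k m i, D k m i = D i m k := by
    intro k m i
    simp only [hD, Matrix.add_apply, pullConn, Matrix.sum_mul, Matrix.sum_apply, Matrix.smul_mul,
      Matrix.smul_apply, Matrix.mul_apply, smul_eq_mul, Finset.mul_sum]
    congr 1
    · exact h.pd_jac_symm hy k i m
    · rw [Finset.sum_comm]
      refine Finset.sum_congr rfl fun a _ => Finset.sum_congr rfl fun b _ => ?_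
      have : connection G b (ψ y) m a = connection G a (ψ y) m b :=
        h.metric.christoffel_symm (h.mapsTo hy) m b a
      rw [this]
      ring
  have hC := h.metric'.connection_unique hy (C := fun i => J⁻¹ * D i)
    (fun k m i => by
      simp only [Matrix.mul_apply]
      exact Finset.sum_congr rfl fun a _ => by rw [hDs k a i])
    (fun k => by
      have hGs : SmoothMatOn (fun z => G (ψ z)) W := fun a b => h.smooth_comp (h.metric.smooth a b)
      have e1 : pdM k G' y = pdM k (fun z => (jac ψ z)ᵀ * G (ψ z) * jac ψ z) y :=
        pdM_congr h.isOpen hy h.eq k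
      have e2 : pdM k (fun z => G (ψ z)) y
          = (pullConn G ψ k y)ᵀ * G (ψ y) + G (ψ y) * pullConn G ψ k y := by
        rw [h.pdM_comp hy h.metric.smooth]
        simp only [h.metric.pdM_eq (h.mapsTo hy), pullConn, Matrix.transpose_sum,
          Matrix.transpose_smul, Matrix.sum_mul, Matrix.mul_sum, Matrix.smul_mul, Matrix.mul_smul,
          smul_add, Finset.sum_add_distrib]
      have e3 : G' y * (J⁻¹ * D k) = Jᵀ * G (ψ y) * D k := by
        rw [h.eq y hy, ← hJ, ← Matrix.mul_assoc, Matrix.mul_assoc _ J, h1, Matrix.mul_one]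
      have e4 : (J⁻¹ * D k)ᵀ * G' y = (G' y * (J⁻¹ * D k))ᵀ := by
        rw [Matrix.transpose_mul (G' y), h.metric'.symm y hy]
      rw [e4, e3, e1, pdM_mul h.isOpen hy (h.smooth_jac.transpose.mul hGs) h.smooth_jac,
        pdM_mul h.isOpen hy h.smooth_jac.transpose hGs, e2, pdM_transpose, ← hJ]
      simp only [hD, Matrix.transpose_mul, Matrix.transpose_transpose, Matrix.transpose_add,
        h.metric.symm _ (h.mapsTo hy), Matrix.mul_add, Matrix.add_mul, Matrix.mul_assoc]
      abel) i
  rw [← hC, ← Matrix.mul_assoc, h1, Matrix.one_mul]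

theorem smooth_pullConn (h : IsPullback G' G ψ W U) (i : Fin n) :
    SmoothMatOn (pullConn G ψ i) W := fun a b => by
  have : (fun z => pullConn G ψ i z a b) = fun z => ∑ q, jac ψ z q i * connection G q (ψ z) a b := by
    ext z
    simp [pullConn, Matrix.sum_apply]
  rw [this]
  exact ContDiffOn.sum fun q _ => (h.smooth_jac q i).mul
    (h.smooth_comp (h.metric.smooth_connection q a b))

/-- The first sum carries ∂²ψ and is symmetric in k and i, so it disappears when the curvature
antisymmetrizes; only the second sum, the pulled-back derivative, remains. -/
theorem pdM_pullConn (h : IsPullback G' G ψ W U) (hy : y ∈ W) (k i : Fin n) :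
    pdM k (pullConn G ψ i) y = ∑ q, pd k (fun z => jac ψ z q i) y • connection G q (ψ y)
      + ∑ q, ∑ p, (jac ψ y p k * jac ψ y q i) • pdM p (connection G q) (ψ y) := by
  ext a b
  have e : ∀ z, pullConn G ψ i z a b = ∑ q, jac ψ z q i * connection G q (ψ z) a b := by
    intro z
    simp [pullConn, Matrix.sum_apply]
  have h1 : ∀ q, DifferentiableAt ℝ (fun z => jac ψ z q i) y := fun q =>
    diffAt h.isOpen hy (h.smooth_jac q i)
  have h2 : ∀ q, DifferentiableAt ℝ (fun z => connection G q (ψ z) a b) y := fun q =>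
    diffAt h.isOpen hy (h.smooth_comp (h.metric.smooth_connection q a b))
  simp only [pdM, Matrix.of_apply, e]
  rw [pd_sum _ _ fun q _ => (h1 q).fun_mul (h2 q)]
  simp only [Matrix.add_apply, Matrix.sum_apply, Matrix.smul_apply, smul_eq_mul, Matrix.of_apply]
  rw [← Finset.sum_add_distrib]
  refine Finset.sum_congr rfl fun q _ => ?_
  rw [pd_mul k (h1 q) (h2 q), h.pd_comp hy (h.metric.smooth_connection q a b), Finset.mul_sum]
  congr 1
  exact Finset.sum_congr rfl fun p _ => by ring

/-- The curvature of the pulled back connection form is the pull-back of the curvature. -/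
theorem curvature_pullConn (h : IsPullback G' G ψ W U) (hy : y ∈ W) (i j : Fin n) :
    pdM i (pullConn G ψ j) y - pdM j (pullConn G ψ i) y
      + (pullConn G ψ i y * pullConn G ψ j y - pullConn G ψ j y * pullConn G ψ i y)
      = ∑ p, ∑ q, (jac ψ y p i * jac ψ y q j) • curvature G p q (ψ y) := by
  rw [h.pdM_pullConn hy, h.pdM_pullConn hy]
  have e1 : ∑ q, pd i (fun z => jac ψ z q j) y • connection G q (ψ y)
      = ∑ q, pd j (fun z => jac ψ z q i) y • connection G q (ψ y) :=
    Finset.sum_congr rfl fun q _ => by rw [h.pd_jac_symm hy]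
  have e2 : ∀ i j, pullConn G ψ i y * pullConn G ψ j y
      = ∑ p, ∑ q, (jac ψ y p i * jac ψ y q j) • (connection G p (ψ y) * connection G q (ψ y)) := by
    intro i j
    simp only [pullConn, Matrix.sum_mul, Matrix.mul_sum, Matrix.smul_mul, Matrix.mul_smul,
      Finset.smul_sum, smul_smul]
    rw [Finset.sum_comm]
    simp only [mul_comm (jac ψ y _ j)]
  have e3 : ∑ p, ∑ q, (jac ψ y p j * jac ψ y q i) • (connection G p (ψ y) * connection G q (ψ y))
      = ∑ p, ∑ q, (jac ψ y p i * jac ψ y q j) • (connection G q (ψ y) * connection G p (ψ y)) := by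
    rw [Finset.sum_comm]
    simp only [mul_comm (jac ψ y _ j)]
  have e4 : ∑ q, ∑ p, (jac ψ y p j * jac ψ y q i) • pdM p (connection G q) (ψ y)
      = ∑ p, ∑ q, (jac ψ y p i * jac ψ y q j) • pdM q (connection G p) (ψ y) := by
    simp only [mul_comm (jac ψ y _ j)]
  have e5 : ∑ q, ∑ p, (jac ψ y p i * jac ψ y q j) • pdM p (connection G q) (ψ y)
      = ∑ p, ∑ q, (jac ψ y p i * jac ψ y q j) • pdM p (connection G q) (ψ y) := Finset.sum_comm
  rw [e1, e2, e2, e3, e4, e5]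
  simp only [curvature, smul_add, smul_sub, Finset.sum_add_distrib, Finset.sum_sub_distrib]
  abel

/-- J acts as a gauge transformation: J Γ' = ∂J + ωJ with ω the pulled-back connection.
Differentiating once more and antisymmetrizing removes ∂²J, which gives J·curv(Γ') = curv(ω)·J. -/
theorem jac_mul_curvature (h : IsPullback G' G ψ W U) (hy : y ∈ W) (i j : Fin n) :
    jac ψ y * curvature G' i j y
      = (∑ p, ∑ q, (jac ψ y p i * jac ψ y q j) • curvature G p q (ψ y)) * jac ψ y := by
  rw [← h.curvature_pullConn hy, curvature]
  have hd : ∀ k i, pdM k (fun z => jac ψ z * connection G' i z) y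
      = pdM k (fun z => pdM i (jac ψ) z + pullConn G ψ i z * jac ψ z) y := fun k i =>
    pdM_congr h.isOpen hy (fun z hz => h.jac_mul_connection hz i) k
  have hs := h.smooth_jac
  have hd' : ∀ k i, pdM k (jac ψ) y * connection G' i y + jac ψ y * pdM k (connection G' i) y
      = pdM k (pdM i (jac ψ)) y + (pdM k (pullConn G ψ i) y * jac ψ y
        + pullConn G ψ i y * pdM k (jac ψ) y) := by
    intro k i
    rw [← pdM_mul h.isOpen hy hs (h.metric'.smooth_connection i), hd,
      pdM_add h.isOpen hy (hs.pdM h.isOpen i) ((h.smooth_pullConn i).mul hs),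
      pdM_mul h.isOpen hy (h.smooth_pullConn i) hs]
  have hc : pdM i (pdM j (jac ψ)) y = pdM j (pdM i (jac ψ)) y := by
    ext a b
    exact pd_comm h.isOpen hy (hs a b) i j
  -- The transformation law solved for ∂J; after substitution only products of connection matrices
  -- are left to cancel.
  have hL : ∀ k, pdM k (jac ψ) y = jac ψ y * connection G' k y - pullConn G ψ k y * jac ψ y :=
    fun k => by rw [h.jac_mul_connection hy]; abel
  have h1 := hd' i j
  have h2 := hd' j i
  rw [hc] at h1
  have h3 : jac ψ y * pdM i (connection G' j) y - jac ψ y * pdM j (connection G' i) y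
      = pdM i (pullConn G ψ j) y * jac ψ y - pdM j (pullConn G ψ i) y * jac ψ y
        + (pullConn G ψ j y * pdM i (jac ψ) y - pullConn G ψ i y * pdM j (jac ψ) y)
        - (pdM i (jac ψ) y * connection G' j y - pdM j (jac ψ) y * connection G' i y) := by
    have h4 := congrArg₂ (fun a b => a - b) h1 h2
    rw [← sub_eq_zero] at h4 ⊢
    rw [← h4]
    abel
  rw [Matrix.mul_add, Matrix.mul_sub, h3, hL i, hL j]
  noncomm_ring

theorem ricciCoord_pullback (h : IsPullback G' G ψ W U) (hy : y ∈ W) :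
    (Matrix.of fun i j => ricciCoord G' i j y)
      = (jac ψ y)ᵀ * (Matrix.of fun i j => ricciCoord G i j (ψ y)) * jac ψ y := by
  set J := jac ψ y with hJ
  have hJu := h.isUnit_jac y hy
  have h1 : J * J⁻¹ = 1 := Matrix.mul_nonsing_inv _ hJu
  have h1' : J⁻¹ * J = 1 := Matrix.nonsing_inv_mul _ hJu
  ext j l
  have e1 : ∀ i, riemannCoord G' i j l i y = ∑ p, J p i * ∑ a, J⁻¹ i a *
      ((∑ q, J q j • curvature G p q (ψ y)) * J) a l := by
    intro i
    have h2 : curvature G' i j y = J⁻¹ * (jac ψ y * curvature G' i j y) := by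
      rw [← Matrix.mul_assoc, h1', Matrix.one_mul]
    rw [riemannCoord_eq, h2, h.jac_mul_curvature hy, ← hJ]
    have h3 : (∑ p, ∑ q, (J p i * J q j) • curvature G p q (ψ y)) * J
        = ∑ p, J p i • ((∑ q, J q j • curvature G p q (ψ y)) * J) := by
      rw [Matrix.sum_mul]
      refine Finset.sum_congr rfl fun p _ => ?_
      rw [← Matrix.smul_mul, Finset.smul_sum]
      simp only [smul_smul]
    rw [h3, Matrix.mul_sum, Matrix.sum_apply]
    refine Finset.sum_congr rfl fun p _ => ?_
    rw [Matrix.mul_smul, Matrix.smul_apply, smul_eq_mul, Matrix.mul_apply]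
  rw [Matrix.of_apply, ricciCoord]
  simp only [e1]
  rw [Finset.sum_comm]
  -- The Ricci contraction pairs the upper index, transformed by J⁻¹, with the first lower index,
  -- transformed by J; the two cancel.
  have e2 : ∀ p, ∑ i, J p i * ∑ a, J⁻¹ i a * ((∑ q, J q j • curvature G p q (ψ y)) * J) a l
      = ((∑ q, J q j • curvature G p q (ψ y)) * J) p l := by
    intro p
    have : (J * (J⁻¹ * ((∑ q, J q j • curvature G p q (ψ y)) * J))) p l
        = ((∑ q, J q j • curvature G p q (ψ y)) * J) p l := by
      rw [← Matrix.mul_assoc, h1, Matrix.one_mul]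
    rw [← this]
    rfl
  simp only [e2]
  simp only [Matrix.sum_apply, Matrix.smul_apply,
    Matrix.mul_apply, smul_eq_mul, Matrix.transpose_apply, Matrix.of_apply, ricciCoord,
    riemannCoord_eq, Finset.mul_sum, Finset.sum_mul]
  calc _ = ∑ k, ∑ p, ∑ q, J q j * curvature G p q (ψ y) p k * J k l := Finset.sum_comm
    _ = ∑ k, ∑ q, ∑ p, J q j * curvature G p q (ψ y) p k * J k l :=
        Finset.sum_congr rfl fun _ _ => Finset.sum_comm
    _ = _ := rfl

theorem pd_comp_eq (h : IsPullback G' G ψ W U) (hy : y ∈ W) (hu : ContDiffOn ℝ ∞ u U) :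
    (fun i => pd i (fun z => u (ψ z)) y) = (jac ψ y)ᵀ *ᵥ fun q => pd q u (ψ y) := by
  ext i
  exact h.pd_comp hy hu i

/-- The chain rule for ∂_i∂_j(u∘ψ) contributes ∂²ψ·∂u, and the inhomogeneous part of the Christoffel
law removes exactly this. -/
theorem hessCoord_pullback (h : IsPullback G' G ψ W U) (hy : y ∈ W) (hu : ContDiffOn ℝ ∞ u U) :
    (Matrix.of fun i j => hessCoord G' (fun z => u (ψ z)) i j y)
      = (jac ψ y)ᵀ * (Matrix.of fun i j => hessCoord G u i j (ψ y)) * jac ψ y := by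
  ext i j
  have hdu := fun q => hu.pd h.metric.isOpen q
  have h1 : pd i (pd j fun z => u (ψ z)) y = ∑ q, (pd i (fun z => jac ψ z q j) y * pd q u (ψ y)
      + jac ψ y q j * ∑ p, jac ψ y p i * pd p (pd q u) (ψ y)) := by
    rw [pd_congr i h.isOpen hy fun z hz => h.pd_comp hz hu j]
    have ha : ∀ q, DifferentiableAt ℝ (fun z => jac ψ z q j) y := fun q =>
      diffAt h.isOpen hy (h.smooth_jac q j)
    have hb : ∀ q, DifferentiableAt ℝ (fun z => pd q u (ψ z)) y := fun q =>
      diffAt h.isOpen hy (h.smooth_comp (hdu q))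
    rw [pd_sum _ _ fun q _ => (ha q).fun_mul (hb q)]
    refine Finset.sum_congr rfl fun q _ => ?_
    rw [pd_mul i (ha q) (hb q), h.pd_comp hy (hdu q)]
  have h2 : ∑ k, christoffel G' k i j y * pd k (fun z => u (ψ z)) y
      = ∑ q, (pd i (fun z => jac ψ z q j) y
        + ∑ p, ∑ r, jac ψ y p i * (christoffel G q p r (ψ y) * jac ψ y r j)) * pd q u (ψ y) := by
    have h3 : ∀ q, ∑ k, jac ψ y q k * christoffel G' k i j y = pd i (fun z => jac ψ z q j) y
        + ∑ p, ∑ r, jac ψ y p i * (christoffel G q p r (ψ y) * jac ψ y r j) := by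
      intro q
      have := congrFun (congrFun (h.jac_mul_connection hy i) q) j
      simp only [pullConn, Matrix.sum_mul, Matrix.sum_apply, Matrix.smul_mul, Matrix.smul_apply,
        Matrix.mul_apply, Matrix.add_apply, smul_eq_mul, Finset.mul_sum] at this
      exact this
    simp only [← h3, h.pd_comp hy hu, Finset.mul_sum, Finset.sum_mul]
    rw [Finset.sum_comm]
    exact Finset.sum_congr rfl fun q _ => Finset.sum_congr rfl fun k _ => by ring
  rw [Matrix.of_apply, hessCoord, h1, h2, ← Finset.sum_sub_distrib]
  simp only [Matrix.mul_apply, Matrix.transpose_apply, Matrix.of_apply, hessCoord, Finset.sum_mul,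
    mul_sub, sub_mul, Finset.mul_sum, Finset.sum_sub_distrib, add_mul, Finset.sum_add_distrib]
  have h4 : ∑ q, ∑ p, jac ψ y q j * (jac ψ y p i * pd p (pd q u) (ψ y))
      = ∑ r, ∑ p, jac ψ y p i * pd p (pd r u) (ψ y) * jac ψ y r j :=
    Finset.sum_congr rfl fun q _ => Finset.sum_congr rfl fun k _ => by ring
  have h5 : ∑ q, ∑ p, ∑ r, jac ψ y p i * (christoffel G q p r (ψ y) * jac ψ y r j) * pd q u (ψ y)
      = ∑ r, ∑ p, ∑ q, jac ψ y p i * (christoffel G q p r (ψ y) * pd q u (ψ y)) * jac ψ y r j := by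
    calc _ = ∑ q, ∑ r, ∑ p, _ := Finset.sum_congr rfl fun _ _ => Finset.sum_comm
      _ = ∑ r, ∑ q, ∑ p, _ := Finset.sum_comm
      _ = ∑ r, ∑ p, ∑ q, _ := Finset.sum_congr rfl fun _ _ => Finset.sum_comm
      _ = _ := by
        refine Finset.sum_congr rfl fun r _ => Finset.sum_congr rfl fun p _ =>
          Finset.sum_congr rfl fun q _ => ?_
        ring
  rw [h4, h5]
  ring

theorem scalarCoord_pullback (h : IsPullback G' G ψ W U) (hy : y ∈ W) :
    scalarCoord G' y = scalarCoord G (ψ y) := by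
  have e : ∀ (G : EuclideanSpace ℝ (Fin n) → Matrix (Fin n) (Fin n) ℝ) y, scalarCoord G y = traceCoord (G y) (Matrix.of fun i j => ricciCoord G i j y) :=
    fun _ _ => rfl
  rw [e, e, h.ricciCoord_pullback hy, h.eq y hy, traceCoord_congruence _ _ (h.isUnit_jac y hy)]

theorem laplacianCoord_pullback (h : IsPullback G' G ψ W U) (hy : y ∈ W)
    (hu : ContDiffOn ℝ ∞ u U) :
    laplacianCoord G' (fun z => u (ψ z)) y = laplacianCoord G u (ψ y) := by
  have e : ∀ (G : EuclideanSpace ℝ (Fin n) → Matrix (Fin n) (Fin n) ℝ) u y, laplacianCoord G u y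
      = traceCoord (G y) (Matrix.of fun i j => hessCoord G u i j y) := fun _ _ _ => rfl
  rw [e, e, h.hessCoord_pullback hy hu, h.eq y hy, traceCoord_congruence _ _ (h.isUnit_jac y hy)]

theorem covectorInner_pullback (h : IsPullback G' G ψ W U) (hy : y ∈ W)
    {w : EuclideanSpace ℝ (Fin n) → ℝ} (hu : ContDiffOn ℝ ∞ u U) (hw : ContDiffOn ℝ ∞ w U) :
    covectorInner (G' y) (fun i => pd i (fun z => u (ψ z)) y) (fun i => pd i (fun z => w (ψ z)) y)
      = covectorInner (G (ψ y)) (fun i => pd i u (ψ y)) (fun i => pd i w (ψ y)) := by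
  rw [h.pd_comp_eq hy hu, h.pd_comp_eq hy hw, h.eq y hy,
    covectorInner_congruence _ _ _ (h.isUnit_jac y hy)]

end IsPullback

end CoordinateChange

/-! ### Charts on the manifold: frames, components and chart independence. -/

section Charts

variable {n : ℕ} {M : Type*} [TopologicalSpace M] [ChartedSpace (EuclideanSpace ℝ (Fin n)) M]

/-- The domain of the chart around `p` in coordinates. -/
abbrev coordDomain (n : ℕ) {M : Type*} [TopologicalSpace M]
    [ChartedSpace (EuclideanSpace ℝ (Fin n)) M] (p : M) : Set (EuclideanSpace ℝ (Fin n)) :=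
  (extChartAt (𝓡 n) p).target

/-- The differential of the inverse chart around `p`. -/
def frame (p : M) (y : EuclideanSpace ℝ (Fin n)) :
    EuclideanSpace ℝ (Fin n) →L[ℝ] EuclideanSpace ℝ (Fin n) :=
  mfderiv 𝓘(ℝ, EuclideanSpace ℝ (Fin n)) (𝓡 n) (extChartAt (𝓡 n) p).symm y

theorem isOpen_coordDomain (p : M) : IsOpen (coordDomain n p) := isOpen_extChartAt_target p

theorem map_coordDomain {p : M} {y : EuclideanSpace ℝ (Fin n)} (hy : y ∈ coordDomain n p) :
    (extChartAt (𝓡 n) p).symm y ∈ (extChartAt (𝓡 n) p).source :=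
  (extChartAt (𝓡 n) p).map_target hy

/-- The change of coordinates from the chart around `p` to the chart around `q`. -/
def transition (p q : M) (y : EuclideanSpace ℝ (Fin n)) : EuclideanSpace ℝ (Fin n) :=
  extChartAt (𝓡 n) q ((extChartAt (𝓡 n) p).symm y)

/-- The overlap of the charts around `p` and `q`, in the coordinates around `p`. -/
def overlap (n : ℕ) {M : Type*} [TopologicalSpace M]
    [ChartedSpace (EuclideanSpace ℝ (Fin n)) M] (p q : M) : Set (EuclideanSpace ℝ (Fin n)) :=
  coordDomain n p ∩ (extChartAt (𝓡 n) p).symm ⁻¹' (extChartAt (𝓡 n) q).source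

theorem isOpen_overlap (p q : M) : IsOpen (overlap n p q) :=
  (continuousOn_extChartAt_symm p).isOpen_inter_preimage (isOpen_coordDomain p)
    (isOpen_extChartAt_source q)

theorem mapsTo_transition (p q : M) :
    MapsTo (transition p q) (overlap n p q) (coordDomain n q) :=
  fun _ hy => (extChartAt (𝓡 n) q).map_source hy.2

theorem symm_transition {p q : M} {y : EuclideanSpace ℝ (Fin n)} (hy : y ∈ overlap n p q) :
    (extChartAt (𝓡 n) q).symm (transition p q y) = (extChartAt (𝓡 n) p).symm y :=
  (extChartAt (𝓡 n) q).left_inv hy.2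

theorem inChart_eq_transition {p q : M} {y : EuclideanSpace ℝ (Fin n)} (hy : y ∈ overlap n p q)
    (u : M → ℝ) : inChart u p y = inChart u q (transition p q y) := by
  rw [inChart, inChart, symm_transition hy]

theorem components_apply (T : TwoTensor n M) (p : M) (y : EuclideanSpace ℝ (Fin n)) (i j : Fin n) :
    components T p y i j = (fun x => (T x : EuclideanSpace ℝ (Fin n) →L[ℝ]
        EuclideanSpace ℝ (Fin n) →L[ℝ] ℝ)) ((extChartAt (𝓡 n) p).symm y)
      (frame p y (EuclideanSpace.single i 1)) (frame p y (EuclideanSpace.single j 1)) := rfl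

theorem mem_overlap {p x : M} (hx : x ∈ (extChartAt (𝓡 n) p).source) (q : M)
    (hq : x ∈ (extChartAt (𝓡 n) q).source) : extChartAt (𝓡 n) p x ∈ overlap n p q :=
  ⟨(extChartAt (𝓡 n) p).map_source hx, by
    rw [mem_preimage, (extChartAt (𝓡 n) p).left_inv hx]
    exact hq⟩

theorem transition_extChartAt {p x : M} (hx : x ∈ (extChartAt (𝓡 n) p).source) (q : M) :
    transition p q (extChartAt (𝓡 n) p x) = extChartAt (𝓡 n) q x := by
  rw [transition, (extChartAt (𝓡 n) p).left_inv hx]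

variable [IsManifold (𝓡 n) ∞ M]

instance isManifold_one : IsManifold (𝓡 n) 1 M := IsManifold.of_le (n := ∞) (by simp)

/-- On the chart domain the differential of the inverse chart is the inverse of the tangent-bundle
trivialization; injectivity and smoothness of the coordinate frame are read off from this. -/
theorem frame_eq_symmL {p : M} {y : EuclideanSpace ℝ (Fin n)} (hy : y ∈ coordDomain n p) :
    (trivializationAt (EuclideanSpace ℝ (Fin n)) (TangentSpace (𝓡 n)) p).symmL ℝ
      ((extChartAt (𝓡 n) p).symm y) = frame p y := by
  have h := map_coordDomain hy
  rw [extChartAt_source] at h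
  rw [TangentBundle.symmL_trivializationAt h, (extChartAt (𝓡 n) p).right_inv hy]
  simp only [ModelWithCorners.range_eq_univ, mfderivWithin_univ]
  rfl

theorem frame_injective {p : M} {y : EuclideanSpace ℝ (Fin n)} (hy : y ∈ coordDomain n p) :
    Function.Injective (frame p y) := by
  have h := map_coordDomain hy
  rw [extChartAt_source] at h
  intro a b hab
  rw [← frame_eq_symmL hy] at hab
  have := congrArg ((trivializationAt (EuclideanSpace ℝ (Fin n))
    (TangentSpace (𝓡 n)) p).continuousLinearMapAt ℝ ((extChartAt (𝓡 n) p).symm y)) hab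
  have e := fun c => Trivialization.continuousLinearMapAt_symmL (R := ℝ)
    (trivializationAt (EuclideanSpace ℝ (Fin n)) (TangentSpace (𝓡 n) (M := M)) p) h c
  exact (e a).symm.trans (this.trans (e b))

/-- In the trivialization at `p` a coordinate vector field is the constant `v`. -/
theorem contMDiffOn_frame (p : M) (v : EuclideanSpace ℝ (Fin n)) :
    ContMDiffOn 𝓘(ℝ, EuclideanSpace ℝ (Fin n)) ((𝓡 n).prod 𝓘(ℝ, EuclideanSpace ℝ (Fin n))) ∞
      (fun y => TotalSpace.mk' (EuclideanSpace ℝ (Fin n)) (E := TangentSpace (𝓡 n) (M := M))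
        ((extChartAt (𝓡 n) p).symm y) (frame p y v)) (coordDomain n p) := by
  set e := trivializationAt (EuclideanSpace ℝ (Fin n)) (TangentSpace (𝓡 n) (M := M)) p with he
  have hbase : ∀ y ∈ coordDomain n p, (extChartAt (𝓡 n) p).symm y ∈ e.baseSet := by
    intro y hy
    have h := map_coordDomain hy
    rwa [extChartAt_source] at h
  rw [e.contMDiffOn_iff (fun y hy => (e.mem_source).2 (hbase y hy))]
  refine ⟨contMDiffOn_extChartAt_symm p, ContMDiffOn.congr (f := fun _ => v) contMDiffOn_const ?_⟩
  intro y hy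
  have h1 : e ⟨(extChartAt (𝓡 n) p).symm y, e.symmL ℝ ((extChartAt (𝓡 n) p).symm y) v⟩
      = ((extChartAt (𝓡 n) p).symm y, v) := by
    rw [Trivialization.symmL_apply _ (hbase y hy)]
    exact e.apply_mk_symm (hbase y hy) v
  rw [frame_eq_symmL hy] at h1
  exact congrArg Prod.snd h1

/-- The components of a smooth family of covariant 2-tensor fields are smooth. -/
theorem smoothFam_components {T : ℝ → TwoTensor n M} {I : Set ℝ}
    (hT : ContMDiffOn (𝓘(ℝ, ℝ).prod (𝓡 n))
      ((𝓡 n).prod 𝓘(ℝ, EuclideanSpace ℝ (Fin n) →L[ℝ] EuclideanSpace ℝ (Fin n) →L[ℝ] ℝ)) ∞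
      (fun q : ℝ × M =>
        TotalSpace.mk' (EuclideanSpace ℝ (Fin n) →L[ℝ] EuclideanSpace ℝ (Fin n) →L[ℝ] ℝ)
          (E := fun x : M => TangentSpace (𝓡 n) x →L[ℝ] TangentSpace (𝓡 n) x →L[ℝ] ℝ)
          q.2 (T q.1 q.2)) (I ×ˢ univ)) (p : M) (i j : Fin n) :
    SmoothFam (fun t y => components (T t) p y i j) I (coordDomain n p) := by
  have hmap : ContMDiffOn (𝓘(ℝ, ℝ).prod 𝓘(ℝ, EuclideanSpace ℝ (Fin n))) (𝓘(ℝ, ℝ).prod (𝓡 n)) ∞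
      (fun q : ℝ × EuclideanSpace ℝ (Fin n) => (q.1, (extChartAt (𝓡 n) p).symm q.2))
      (I ×ˢ coordDomain n p) :=
    contMDiffOn_fst.prodMk ((contMDiffOn_extChartAt_symm p).comp contMDiffOn_snd fun q hq => hq.2)
  have hT' := hT.comp hmap fun q hq => ⟨hq.1, mem_univ _⟩
  have hframe := fun v => (contMDiffOn_frame p v).comp
    (contMDiffOn_snd (I := 𝓘(ℝ, ℝ)) (s := I ×ˢ coordDomain n p)) fun q hq => hq.2
  -- Evaluating a smooth bilinear form on two smooth vector fields yields a section of the trivial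
  -- line bundle; its fibre part is the component function.
  have h : ContMDiffOn (𝓘(ℝ, ℝ).prod 𝓘(ℝ, EuclideanSpace ℝ (Fin n))) ((𝓡 n).prod 𝓘(ℝ)) ∞
      (fun q : ℝ × EuclideanSpace ℝ (Fin n) => TotalSpace.mk' ℝ (E := Bundle.Trivial M ℝ)
        ((extChartAt (𝓡 n) p).symm q.2) (T q.1 ((extChartAt (𝓡 n) p).symm q.2)
          (frame p q.2 (EuclideanSpace.single i 1)) (frame p q.2 (EuclideanSpace.single j 1))))
      (I ×ˢ coordDomain n p) := by
    apply ContMDiffOn.clm_bundle_apply₂ (F₁ := EuclideanSpace ℝ (Fin n))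
      (F₂ := EuclideanSpace ℝ (Fin n))
    · exact hT'
    · exact hframe _
    · exact hframe _
  have h2 : ContMDiffOn (𝓘(ℝ, ℝ).prod 𝓘(ℝ, EuclideanSpace ℝ (Fin n))) 𝓘(ℝ) ∞
      (fun q : ℝ × EuclideanSpace ℝ (Fin n) => components (T q.1) p q.2 i j)
      (I ×ˢ coordDomain n p) := by
    intro q hq
    have := h q hq
    simp only [contMDiffWithinAt_totalSpace] at this
    exact this.2
  refine contMDiffOn_iff_contDiffOn.1 ?_
  rw [modelWithCornersSelf_prod, ← chartedSpaceSelf_prod]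
  exact h2

theorem smoothFam_inChart {φ : ℝ → M → ℝ} {I : Set ℝ}
    (hφ : ContMDiffOn (𝓘(ℝ, ℝ).prod (𝓡 n)) 𝓘(ℝ, ℝ) ∞ (fun q : ℝ × M => φ q.1 q.2)
      (I ×ˢ univ)) (p : M) : SmoothFam (fun t => inChart (φ t) p) I (coordDomain n p) := by
  have hmap : ContMDiffOn (𝓘(ℝ, ℝ).prod 𝓘(ℝ, EuclideanSpace ℝ (Fin n))) (𝓘(ℝ, ℝ).prod (𝓡 n)) ∞
      (fun q : ℝ × EuclideanSpace ℝ (Fin n) => (q.1, (extChartAt (𝓡 n) p).symm q.2))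
      (I ×ˢ coordDomain n p) :=
    contMDiffOn_fst.prodMk ((contMDiffOn_extChartAt_symm p).comp contMDiffOn_snd fun q hq => hq.2)
  have h2 := hφ.comp hmap fun q hq => ⟨hq.1, mem_univ _⟩
  refine contMDiffOn_iff_contDiffOn.1 ?_
  rw [modelWithCornersSelf_prod, ← chartedSpaceSelf_prod]
  exact h2

theorem smooth_inChart {u : M → ℝ} (hu : ContMDiff (𝓡 n) 𝓘(ℝ, ℝ) ∞ u) (p : M) :
    ContDiffOn ℝ ∞ (inChart u p) (coordDomain n p) :=
  contMDiffOn_iff_contDiffOn.1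
    (hu.comp_contMDiffOn (contMDiffOn_extChartAt_symm (I := 𝓡 n) (n := ∞) p))

theorem smooth_metricComponents (g : Metric n M) (p : M) :
    SmoothMatOn (metricComponents g p) (coordDomain n p) := fun i j => by
  have h := smoothFam_components (T := fun _ => g.inner) (I := univ)
    ((g.contMDiff.comp contMDiff_snd).contMDiffOn) p i j
  exact h.slice (mem_univ (0 : ℝ))

theorem isMetricOn_metricComponents (g : Metric n M) (p : M) :
    IsMetricOn (metricComponents g p) (coordDomain n p) where
  isOpen := isOpen_coordDomain p
  smooth := smooth_metricComponents g p
  symm y _ := by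
    ext i j
    exact g.symm _ _ _
  det_pos y hy := by
    refine Matrix.PosDef.det_pos (Matrix.PosDef.of_dotProduct_mulVec_pos ?_ fun x hx => ?_)
    · ext i j
      simpa using! g.symm _ _ _
    -- The quadratic form of the component matrix at x is g evaluated on the frame image of x, which
    -- is nonzero because the frame is injective.
    · set v : EuclideanSpace ℝ (Fin n) := WithLp.toLp 2 x with hv
      have hv0 : v ≠ 0 := by
        intro h
        exact hx (by simpa [hv] using h)
      have hpos := g.pos ((extChartAt (𝓡 n) p).symm y) (frame p y v) fun h =>
        hv0 (frame_injective hy (h.trans (map_zero (frame p y)).symm))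
      refine lt_of_lt_of_eq hpos ?_
      have hsum : v = ∑ i, x i • EuclideanSpace.single i (1 : ℝ) := by
        ext j
        simp [hv, Finset.sum_apply, Pi.single_apply]
      let B : EuclideanSpace ℝ (Fin n) →L[ℝ] EuclideanSpace ℝ (Fin n) →L[ℝ] ℝ :=
        g.inner ((extChartAt (𝓡 n) p).symm y)
      have e1 : g.inner ((extChartAt (𝓡 n) p).symm y) (frame p y v) (frame p y v)
          = B (frame p y v) (frame p y v) := rfl
      have e2 : ∀ i j, metricComponents g p y i j
        = B (frame p y (EuclideanSpace.single i 1)) (frame p y (EuclideanSpace.single j 1)) :=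
        fun _ _ => rfl
      rw [e1, hsum]
      simp only [map_sum, map_smul, FunLike.coe_sum, FunLike.coe_smul, Finset.sum_apply,
        Pi.smul_apply, smul_eq_mul, dotProduct, Matrix.mulVec, e2, Finset.mul_sum, star_trivial]
      rw [Finset.sum_comm]
      refine Finset.sum_congr rfl fun i _ => Finset.sum_congr rfl fun j _ => ?_
      ring

theorem contDiffOn_transition (p q : M) : ContDiffOn ℝ ∞ (transition p q) (overlap n p q) :=
  contMDiffOn_iff_contDiffOn.1 ((contMDiffOn_extChartAt (I := 𝓡 n) (n := ∞) (x := q)).comp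
    ((contMDiffOn_extChartAt_symm (I := 𝓡 n) (n := ∞) p).mono inter_subset_left) fun y hy => by
      rw [← extChartAt_source (𝓡 n)]
      exact hy.2)

theorem frame_eq_comp {p q : M} {y : EuclideanSpace ℝ (Fin n)} (hy : y ∈ overlap n p q) :
    frame p y = (frame q (transition p q y)).comp (fderiv ℝ (transition p q) y) := by
  have hev : (extChartAt (𝓡 n) p).symm =ᶠ[𝓝 y] (extChartAt (𝓡 n) q).symm ∘ transition p q := by
    filter_upwards [(isOpen_overlap p q).mem_nhds hy] with z hz
    exact (symm_transition hz).symm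
  have hg : MDifferentiableAt (𝓡 n) (𝓡 n) (extChartAt (𝓡 n) q).symm (transition p q y) :=
    ((contMDiffOn_extChartAt_symm (I := 𝓡 n) (n := ∞) q).contMDiffAt
      ((isOpen_coordDomain q).mem_nhds (mapsTo_transition p q hy))).mdifferentiableAt (by simp)
  have hf : MDifferentiableAt (𝓡 n) (𝓡 n) (transition p q) y :=
    (((contDiffOn_transition p q).contDiffAt
      ((isOpen_overlap p q).mem_nhds hy)).differentiableAt (by simp)).mdifferentiableAt
  have h1 := mfderiv_comp y hg hf
  rw [mfderiv_eq_fderiv] at h1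
  rw [← hev.mfderiv_eq] at h1
  exact h1

theorem fderiv_transition_single {p q : M} {y : EuclideanSpace ℝ (Fin n)}
    (hy : y ∈ overlap n p q) (i : Fin n) :
    fderiv ℝ (transition p q) y (EuclideanSpace.single i 1)
      = ∑ k, jac (transition p q) y k i • EuclideanSpace.single k (1 : ℝ) := by
  have hf : DifferentiableAt ℝ (transition p q) y :=
    ((contDiffOn_transition p q).contDiffAt
      ((isOpen_overlap p q).mem_nhds hy)).differentiableAt (by simp)
  ext k
  have h2 : HasFDerivAt (fun z => transition p q z k)
      ((EuclideanSpace.proj k).comp (fderiv ℝ (transition p q) y)) y :=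
    (EuclideanSpace.proj (𝕜 := ℝ) k).hasFDerivAt.comp y hf.hasFDerivAt
  have h3 : jac (transition p q) y k i
      = fderiv ℝ (transition p q) y (EuclideanSpace.single i 1) k := by
    rw [jac, Matrix.of_apply, pd, h2.fderiv]
    rfl
  simp [← h3, Finset.sum_apply, Pi.single_apply]

/-- The transformation law of covariant 2-tensors. -/
theorem components_transition (T : TwoTensor n M) {p q : M} {y : EuclideanSpace ℝ (Fin n)}
    (hy : y ∈ overlap n p q) :
    components T p y = (jac (transition p q) y)ᵀ * components T q (transition p q y)
      * jac (transition p q) y := by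
  ext i j
  let B : EuclideanSpace ℝ (Fin n) →L[ℝ] EuclideanSpace ℝ (Fin n) →L[ℝ] ℝ :=
    T ((extChartAt (𝓡 n) q).symm (transition p q y))
  have e1 : components T p y i j
      = B (frame q (transition p q y) (fderiv ℝ (transition p q) y (EuclideanSpace.single i 1)))
        (frame q (transition p q y)
          (fderiv ℝ (transition p q) y (EuclideanSpace.single j 1))) := by
    rw [components_apply, frame_eq_comp hy, ← symm_transition hy]
    rfl
  have e2 : ∀ k l, components T q (transition p q y) k l
      = B (frame q (transition p q y) (EuclideanSpace.single k 1))
        (frame q (transition p q y) (EuclideanSpace.single l 1)) := fun _ _ => rfl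
  rw [e1, fderiv_transition_single hy, fderiv_transition_single hy]
  simp only [map_sum, map_smul, FunLike.coe_sum, FunLike.coe_smul, Finset.sum_apply,
    Pi.smul_apply, smul_eq_mul]
  simp only [Matrix.mul_apply, Matrix.transpose_apply, e2, Finset.sum_mul, Finset.mul_sum]
  refine Finset.sum_congr rfl fun k _ => Finset.sum_congr rfl fun l _ => ?_
  ring

theorem _root_.Perelman.IsMetricOn.mono {G : EuclideanSpace ℝ (Fin n) → Matrix (Fin n) (Fin n) ℝ}
    {U W : Set (EuclideanSpace ℝ (Fin n))} (hG : IsMetricOn G U) (hW : IsOpen W) (h : W ⊆ U) :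
    IsMetricOn G W where
  isOpen := hW
  smooth i j := (hG.smooth i j).mono h
  symm y hy := hG.symm y (h hy)
  det_pos y hy := hG.det_pos y (h hy)

theorem isPullback_transition (g : Metric n M) (p q : M) :
    IsPullback (metricComponents g p) (metricComponents g q) (transition p q) (overlap n p q)
      (coordDomain n q) where
  metric' := (isMetricOn_metricComponents g p).mono (isOpen_overlap p q) inter_subset_left
  metric := isMetricOn_metricComponents g q
  smooth := contDiffOn_transition p q
  mapsTo := mapsTo_transition p q
  -- From G' = JᵀGJ and det G' ≠ 0 the Jacobian is nonsingular, without appeal to the inverse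
  -- transition map.
  isUnit_jac y hy := by
    have h := ((isMetricOn_metricComponents g p).det_pos y hy.1).ne'
    rw [metricComponents, components_transition g.inner hy, Matrix.det_mul] at h
    exact (right_ne_zero_of_mul h).isUnit
  eq y hy := components_transition g.inner hy

section Transfer

variable (g : Metric n M) {p x : M}

/-- The definition uses a different chart at every point. This lemma and its companions below
express the quantities in one chart around `p`, so that they can be differentiated and integrated
there. -/
theorem scalarCurvature_eq (hx : x ∈ (extChartAt (𝓡 n) p).source) :
    scalarCurvature g x = scalarCoord (metricComponents g p) (extChartAt (𝓡 n) p x) := by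
  rw [(isPullback_transition g p x).scalarCoord_pullback (mem_overlap hx x (mem_extChartAt_source x)),
    transition_extChartAt hx]
  rfl

theorem trace_eq (T : TwoTensor n M) (hx : x ∈ (extChartAt (𝓡 n) p).source) :
    trace g T x = traceCoord (metricComponents g p (extChartAt (𝓡 n) p x))
      (components T p (extChartAt (𝓡 n) p x)) := by
  have hy := mem_overlap hx x (mem_extChartAt_source x)
  have h := isPullback_transition g p x
  rw [h.eq _ hy, components_transition T hy, traceCoord_congruence _ _ (h.isUnit_jac _ hy),
    transition_extChartAt hx]
  rfl

/-- The Ricci matrix itself depends on the chart; its contraction with a tensor field does not, so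
invariance is stated for the contraction. -/
theorem ricci_eq (hx : x ∈ (extChartAt (𝓡 n) p).source) (T : TwoTensor n M) :
    pairing g T x (ricci g x) = pairingCoord (metricComponents g p (extChartAt (𝓡 n) p x))
      (components T p (extChartAt (𝓡 n) p x))
      (Matrix.of fun i j => ricciCoord (metricComponents g p) i j (extChartAt (𝓡 n) p x)) := by
  have hy := mem_overlap hx x (mem_extChartAt_source x)
  have h := isPullback_transition g p x
  rw [h.ricciCoord_pullback hy, h.eq _ hy, components_transition T hy,
    pairingCoord_congruence _ _ _ (h.isUnit_jac _ hy), transition_extChartAt hx]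
  rfl

theorem hessCoord_congr {G : EuclideanSpace ℝ (Fin n) → Matrix (Fin n) (Fin n) ℝ}
    {U : Set (EuclideanSpace ℝ (Fin n))} (hU : IsOpen U) {u w : EuclideanSpace ℝ (Fin n) → ℝ}
    (h : ∀ z ∈ U, u z = w z) {y : EuclideanSpace ℝ (Fin n)} (hy : y ∈ U) (i j : Fin n) :
    hessCoord G u i j y = hessCoord G w i j y := by
  rw [hessCoord, hessCoord, pd_congr i hU hy fun z hz => pd_congr j hU hz h]
  simp only [pd_congr _ hU hy h]

theorem hess_eq {u : M → ℝ} (hu : ContMDiff (𝓡 n) 𝓘(ℝ, ℝ) ∞ u)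
    (hx : x ∈ (extChartAt (𝓡 n) p).source) (T : TwoTensor n M) :
    pairing g T x (hess g u x) = pairingCoord (metricComponents g p (extChartAt (𝓡 n) p x))
      (components T p (extChartAt (𝓡 n) p x)) (Matrix.of fun i j =>
        hessCoord (metricComponents g p) (inChart u p) i j (extChartAt (𝓡 n) p x)) := by
  have hy := mem_overlap hx x (mem_extChartAt_source x)
  have h := isPullback_transition g p x
  simp only [hessCoord_congr (isOpen_overlap p x) (fun z hz => inChart_eq_transition hz u) hy]
  rw [h.hessCoord_pullback hy (smooth_inChart hu x), h.eq _ hy, components_transition T hy,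
    pairingCoord_congruence _ _ _ (h.isUnit_jac _ hy), transition_extChartAt hx]
  rfl

theorem laplacian_eq {u : M → ℝ} (hu : ContMDiff (𝓡 n) 𝓘(ℝ, ℝ) ∞ u)
    (hx : x ∈ (extChartAt (𝓡 n) p).source) :
    laplacian g u x = laplacianCoord (metricComponents g p) (inChart u p)
      (extChartAt (𝓡 n) p x) := by
  have hy := mem_overlap hx x (mem_extChartAt_source x)
  have h := isPullback_transition g p x
  have h1 := h.laplacianCoord_pullback hy (smooth_inChart hu x)
  rw [transition_extChartAt hx] at h1
  rw [laplacian, ← h1]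
  unfold laplacianCoord
  simp only [hessCoord_congr (isOpen_overlap p x) (fun z hz => inChart_eq_transition hz u) hy]

/-- The inner product `⟨∇u, ∇w⟩`. -/
def gradInner (g : Metric n M) (u w : M → ℝ) (x : M) : ℝ :=
  covectorInner (metricComponents g x (extChartAt (𝓡 n) x x))
    (fun i => pd i (inChart u x) (extChartAt (𝓡 n) x x))
    (fun i => pd i (inChart w x) (extChartAt (𝓡 n) x x))

theorem gradInner_eq {u w : M → ℝ} (hu : ContMDiff (𝓡 n) 𝓘(ℝ, ℝ) ∞ u)
    (hw : ContMDiff (𝓡 n) 𝓘(ℝ, ℝ) ∞ w) (hx : x ∈ (extChartAt (𝓡 n) p).source) :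
    gradInner g u w x = covectorInner (metricComponents g p (extChartAt (𝓡 n) p x))
      (fun i => pd i (inChart u p) (extChartAt (𝓡 n) p x))
      (fun i => pd i (inChart w p) (extChartAt (𝓡 n) p x)) := by
  have hy := mem_overlap hx x (mem_extChartAt_source x)
  have h := isPullback_transition g p x
  have h1 := h.covectorInner_pullback hy (smooth_inChart hu x) (smooth_inChart hw x)
  rw [transition_extChartAt hx] at h1
  rw [gradInner, ← h1]
  simp only [pd_congr _ (isOpen_overlap p x) hy fun z hz => inChart_eq_transition hz _]

theorem gradSq_eq {u : M → ℝ} (hu : ContMDiff (𝓡 n) 𝓘(ℝ, ℝ) ∞ u)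
    (hx : x ∈ (extChartAt (𝓡 n) p).source) :
    gradSq g u x = gradSqCoord (metricComponents g p) (inChart u p) (extChartAt (𝓡 n) p x) :=
  gradInner_eq g hu hu hx

end Transfer

theorem IsVariation.isMetricVariation {g : Metric n M} {f : M → ℝ} {v : TwoTensor n M} {h : M → ℝ}
    {γ : ℝ → Metric n M} {φ : ℝ → M → ℝ} (H : IsVariation g f v h γ φ) :
    ∃ ε : ℝ, 0 < ε ∧ (∀ p : M, IsMetricVariation (fun t => metricComponents (γ t) p)
        (components v p) (Ioo (-ε) ε) (coordDomain n p)) ∧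
      (∀ p : M, SmoothFam (fun t => inChart (φ t) p) (Ioo (-ε) ε) (coordDomain n p)) ∧
      ∀ t ∈ Ioo (-ε) ε, ContMDiff (𝓡 n) 𝓘(ℝ, ℝ) ∞ (φ t) := by
  obtain ⟨ε, hε, h1, h2⟩ := H.smooth
  refine ⟨ε, hε, fun p => ?_, fun p => smoothFam_inChart h2 p, fun t ht =>
    h2.comp_contMDiff (contMDiff_const.prodMk contMDiff_id) fun x => ⟨ht, mem_univ x⟩⟩
  exact
    { isOpen_param := isOpen_Ioo
      isOpen := isOpen_coordDomain p
      smooth := fun i j => smoothFam_components (T := fun t => (γ t).inner) h1 p i j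
      isMetricOn := fun t _ => isMetricOn_metricComponents (γ t) p
      zero_mem := ⟨by linarith, hε⟩
      hasDerivAt := fun y _ i j => H.metric_deriv _ _ _ }

end Charts

/-! ### The Riemannian volume measure and its restriction to charts. -/

section Volume

variable {n : ℕ} {M : Type*} [TopologicalSpace M] [ChartedSpace (EuclideanSpace ℝ (Fin n)) M]

theorem injOn_transition (p q : M) : InjOn (transition p q) (overlap n p q) := by
  intro y hy z hz h
  have := congrArg (extChartAt (𝓡 n) q).symm h
  rw [symm_transition hy, symm_transition hz] at this
  exact (extChartAt (𝓡 n) p).symm.injOn hy.1 hz.1 this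

section Measurability

variable [MeasurableSpace M] [BorelSpace M]

theorem aemeasurable_symm (p : M) : AEMeasurable (extChartAt (𝓡 n) p).symm
    ((volume : Measure (EuclideanSpace ℝ (Fin n))).restrict (coordDomain n p)) :=
  (continuousOn_extChartAt_symm p).aemeasurable (isOpen_coordDomain p).measurableSet

theorem measurableSet_preimage_symm (p : M) {A : Set M} (hA : MeasurableSet A) :
    MeasurableSet (coordDomain n p ∩ (extChartAt (𝓡 n) p).symm ⁻¹' A) := by
  have h : Measurable ((coordDomain n p).domRestrict (extChartAt (𝓡 n) p).symm) :=
    (continuousOn_iff_continuous_domRestrict.1 (continuousOn_extChartAt_symm p)).measurable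
  have h2 := (isOpen_coordDomain p).measurableSet.subtype_image (h hA)
  convert h2 using 1
  ext y
  simp [and_comm]

end Measurability

variable [IsManifold (𝓡 n) ∞ M]

theorem det_fderiv_transition {p q : M} {y : EuclideanSpace ℝ (Fin n)} (hy : y ∈ overlap n p q) :
    (fderiv ℝ (transition p q) y).det = (jac (transition p q) y).det := by
  rw [ContinuousLinearMap.det, ← LinearMap.det_toMatrix (EuclideanSpace.basisFun (Fin n) ℝ).toBasis]
  congr 1
  ext k i
  rw [LinearMap.toMatrix_apply]
  simp [fderiv_transition_single hy, Finset.sum_apply]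

/-- The Riemannian density `√det(g_ij)` of the chart around `p`. -/
def density (g : Metric n M) (p : M) (y : EuclideanSpace ℝ (Fin n)) : ℝ :=
  √(metricComponents g p y).det

theorem density_transition (g : Metric n M) {p q : M} {y : EuclideanSpace ℝ (Fin n)}
    (hy : y ∈ overlap n p q) :
    density g p y = |(fderiv ℝ (transition p q) y).det| * density g q (transition p q y) := by
  rw [density, (isPullback_transition g p q).eq y hy, Matrix.det_mul, Matrix.det_mul,
    Matrix.det_transpose, det_fderiv_transition hy, density, ← Real.sqrt_sq_eq_abs,
    ← Real.sqrt_mul (sq_nonneg _)]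
  congr 1
  ring

theorem smooth_density (g : Metric n M) (p : M) :
    ContDiffOn ℝ ∞ (density g p) (coordDomain n p) :=
  (isMetricOn_metricComponents g p).smooth_sqrt_det

variable [MeasurableSpace M] [BorelSpace M]

theorem aemeasurable_symm_withDensity (g : Metric n M) (p : M) :
    AEMeasurable (extChartAt (𝓡 n) p).symm
      (((volume : Measure (EuclideanSpace ℝ (Fin n))).restrict (coordDomain n p)).withDensity
        fun y => ENNReal.ofReal (density g p y)) :=
  (aemeasurable_symm p).mono_ac (withDensity_absolutelyContinuous _ _)

theorem chartVolume_apply (g : Metric n M) (p : M) {A : Set M} (hA : MeasurableSet A) :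
    chartVolume g p A = ∫⁻ y in coordDomain n p ∩ (extChartAt (𝓡 n) p).symm ⁻¹' A,
      ENNReal.ofReal (density g p y) := by
  have h0 : chartVolume g p = Measure.map (extChartAt (𝓡 n) p).symm
    (((volume : Measure (EuclideanSpace ℝ (Fin n))).restrict (coordDomain n p)).withDensity
        fun y => ENNReal.ofReal (density g p y)) := rfl
  have h1 : ((volume : Measure (EuclideanSpace ℝ (Fin n))).restrict (coordDomain n p)).withDensity
        (fun y => ENNReal.ofReal (density g p y))
      = ((volume : Measure (EuclideanSpace ℝ (Fin n))).withDensity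
        fun y => ENNReal.ofReal (density g p y)).restrict (coordDomain n p) :=
    (restrict_withDensity (isOpen_coordDomain p).measurableSet _).symm
  rw [h0, Measure.map_apply_of_aemeasurable (aemeasurable_symm_withDensity g p) hA, h1,
    Measure.restrict_apply' (isOpen_coordDomain p).measurableSet, inter_comm,
    withDensity_apply _ (measurableSet_preimage_symm p hA)]

/-- Change of variables along the transition map: √det(JᵀGJ) = |det J| √det G supplies exactly the
Jacobian factor. -/
theorem chartVolume_eq_of_subset (g : Metric n M) (p q : M) {A : Set M} (hA : MeasurableSet A)
    (hp : A ⊆ (extChartAt (𝓡 n) p).source) (hq : A ⊆ (extChartAt (𝓡 n) q).source) :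
    chartVolume g p A = chartVolume g q A := by
  rw [chartVolume_apply g p hA, chartVolume_apply g q hA]
  set s := coordDomain n p ∩ (extChartAt (𝓡 n) p).symm ⁻¹' A with hs
  have hsub : s ⊆ overlap n p q := fun y hy => ⟨hy.1, hq hy.2⟩
  have himg : transition p q '' s = coordDomain n q ∩ (extChartAt (𝓡 n) q).symm ⁻¹' A := by
    ext z
    constructor
    · rintro ⟨y, hy, rfl⟩
      refine ⟨mapsTo_transition p q (hsub hy), ?_⟩
      rw [mem_preimage, symm_transition (hsub hy)]
      exact hy.2
    · intro hz
      refine ⟨extChartAt (𝓡 n) p ((extChartAt (𝓡 n) q).symm z), ⟨?_, ?_⟩, ?_⟩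
      · exact (extChartAt (𝓡 n) p).map_source (hp hz.2)
      · rw [mem_preimage, (extChartAt (𝓡 n) p).left_inv (hp hz.2)]
        exact hz.2
      · rw [transition, (extChartAt (𝓡 n) p).left_inv (hp hz.2), (extChartAt (𝓡 n) q).right_inv hz.1]
  have hsm : MeasurableSet s := measurableSet_preimage_symm p hA
  rw [← himg, lintegral_image_eq_lintegral_abs_det_fderiv_mul volume hsm
    (f' := fderiv ℝ (transition p q)) (fun y hy => ?_) ((injOn_transition p q).mono hsub)]
  · refine setLIntegral_congr_fun hsm fun y hy => ?_
    rw [density_transition g (hsub hy), ENNReal.ofReal_mul (abs_nonneg _)]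
  · exact (((contDiffOn_transition p q).contDiffAt ((isOpen_overlap p q).mem_nhds
      (hsub hy))).differentiableAt (by simp)).hasFDerivAt.hasFDerivWithinAt

theorem chartVolume_restrict_source (g : Metric n M) (p : M) :
    (chartVolume g p).restrict (extChartAt (𝓡 n) p).source = chartVolume g p := by
  have hU : MeasurableSet (extChartAt (𝓡 n) p).source := (isOpen_extChartAt_source p).measurableSet
  ext A hA
  rw [Measure.restrict_apply hA, chartVolume_apply g p hA, chartVolume_apply g p (hA.inter hU)]
  congr 2
  ext y
  constructor
  · exact fun hy => ⟨hy.1, hy.2.1⟩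
  · exact fun hy => ⟨hy.1, hy.2, (extChartAt (𝓡 n) p).map_target hy.1⟩

theorem chartVolume_restrict_comm (g : Metric n M) (p q : M) :
    (chartVolume g p).restrict (extChartAt (𝓡 n) q).source
      = (chartVolume g q).restrict (extChartAt (𝓡 n) p).source := by
  have hU : ∀ p : M, MeasurableSet (extChartAt (𝓡 n) p).source := fun p =>
    (isOpen_extChartAt_source p).measurableSet
  rw [← chartVolume_restrict_source g p, ← chartVolume_restrict_source g q,
    Measure.restrict_restrict (hU q), Measure.restrict_restrict (hU p),
    inter_comm (extChartAt (𝓡 n) p).source]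
  ext A hA
  rw [Measure.restrict_apply hA, Measure.restrict_apply hA]
  exact chartVolume_eq_of_subset g p q (hA.inter ((hU q).inter (hU p))) (fun x hx => hx.2.2)
    fun x hx => hx.2.1

/-- The Riemannian volume measure agrees with the volume measure of a chart on its domain. -/
theorem volumeMeasure_restrict (g : Metric n M) (p : M) :
    (volumeMeasure g).restrict (extChartAt (𝓡 n) p).source = chartVolume g p := by
  set U := (extChartAt (𝓡 n) p).source with hUdef
  have hU : MeasurableSet U := (isOpen_extChartAt_source p).measurableSet
  have hle : ∀ q, chartVolume g q ≤ volumeMeasure g := le_iSup (chartVolume g)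
  apply le_antisymm
  -- The right side dominates every chart volume: outside U trivially, and on U because chart
  -- volumes agree on overlaps. Hence it dominates the supremum, and restricting to U kills its
  -- first summand.
  · have h1 : volumeMeasure g ≤ (volumeMeasure g).restrict Uᶜ + chartVolume g p := by
      refine iSup_le fun q => ?_
      rw [← Measure.restrict_compl_add_restrict (μ := chartVolume g q) hU]
      refine add_le_add (Measure.restrict_mono le_rfl (hle q)) ?_
      rw [hUdef, chartVolume_restrict_comm]
      exact Measure.restrict_le_self
    have h2 := Measure.restrict_mono (le_refl U) h1
    rwa [Measure.restrict_add, Measure.restrict_restrict hU, inter_compl_self,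
      Measure.restrict_empty, zero_add, hUdef, chartVolume_restrict_source] at h2
  · rw [← chartVolume_restrict_source g p]
    exact Measure.restrict_mono le_rfl (hle p)

theorem integral_chartVolume (g : Metric n M) (p : M) {F : M → ℝ} (hF : Continuous F) :
    ∫ x, F x ∂(chartVolume g p) = ∫ y in coordDomain n p, inChart F p y * density g p y := by
  have h0 : chartVolume g p = Measure.map (extChartAt (𝓡 n) p).symm
    (((volume : Measure (EuclideanSpace ℝ (Fin n))).restrict (coordDomain n p)).withDensity
        fun y => ENNReal.ofReal (density g p y)) := rfl
  rw [h0, integral_map (aemeasurable_symm_withDensity g p) hF.aestronglyMeasurable,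
    integral_withDensity_eq_integral_toReal_smul₀]
  · refine integral_congr_ae (Eventually.of_forall fun y => ?_)
    simp only
    rw [ENNReal.toReal_ofReal (show 0 ≤ density g p y from Real.sqrt_nonneg _), smul_eq_mul, mul_comm]
    rfl
  · exact ((smooth_density g p).continuousOn.aemeasurable
      (isOpen_coordDomain p).measurableSet).ennreal_ofReal
  · exact Eventually.of_forall fun y => ENNReal.ofReal_lt_top

/-- The density is bounded on a closed coordinate ball. On compact `M` this makes every continuous
function integrable, which settles all integrability claims. -/
instance isLocallyFiniteMeasure_volumeMeasure (g : Metric n M) :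
    IsLocallyFiniteMeasure (volumeMeasure g) := by
  refine ⟨fun p => ?_⟩
  obtain ⟨r, hr, hball⟩ := Metric.nhds_basis_closedBall.mem_iff.1
    ((isOpen_coordDomain p).mem_nhds (mem_extChartAt_target (I := 𝓡 n) p))
  set A : Set M := (extChartAt (𝓡 n) p).source ∩
    extChartAt (𝓡 n) p ⁻¹' Metric.ball (extChartAt (𝓡 n) p p) r with hA
  have hAo : IsOpen A := (continuousOn_extChartAt p).isOpen_inter_preimage
    (isOpen_extChartAt_source p) Metric.isOpen_ball
  refine ⟨A, hAo.mem_nhds ⟨mem_extChartAt_source p, Metric.mem_ball_self hr⟩, ?_⟩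
  have h1 : volumeMeasure g A = chartVolume g p A := by
    rw [← volumeMeasure_restrict g p, Measure.restrict_apply hAo.measurableSet,
      inter_eq_left.2 inter_subset_left]
  rw [h1, chartVolume_apply g p hAo.measurableSet]
  refine lt_of_le_of_lt (lintegral_mono_set (t := Metric.closedBall (extChartAt (𝓡 n) p p) r)
    fun y hy => ?_) ?_
  · have := hy.2.2
    rw [mem_preimage, (extChartAt (𝓡 n) p).right_inv hy.1] at this
    exact Metric.ball_subset_closedBall this
  · have hint : IntegrableOn (density g p) (Metric.closedBall (extChartAt (𝓡 n) p p) r) :=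
      ((smooth_density g p).continuousOn.mono hball).integrableOn_compact
        (isCompact_closedBall _ _)
    exact hint.lintegral_lt_top

theorem integrable_of_continuous [CompactSpace M] (g : Metric n M) {F : M → ℝ}
    (hF : Continuous F) : Integrable F (volumeMeasure g) :=
  hF.integrable_of_hasCompactSupport (HasCompactSupport.of_compactSpace F)

/-- A function that vanishes off the domain of a chart is integrated in that chart. -/
theorem integral_volumeMeasure_of_support (g : Metric n M) (p : M) {F : M → ℝ} (hF : Continuous F)
    (hsupp : ∀ x ∉ (extChartAt (𝓡 n) p).source, F x = 0) :
    ∫ x, F x ∂(volumeMeasure g) = ∫ y in coordDomain n p, inChart F p y * density g p y := by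
  rw [← integral_chartVolume g p hF, ← volumeMeasure_restrict g p,
    setIntegral_eq_integral_of_forall_compl_eq_zero hsupp]

end Volume

/-! ### Differentiation under the integral and integration by parts in ℝⁿ. -/

section Analysis

variable {n : ℕ} {I : Set ℝ} {U K : Set (EuclideanSpace ℝ (Fin n))}
  {Φ : ℝ → EuclideanSpace ℝ (Fin n) → ℝ}

theorem SmoothFam.hasDerivAt_integral (hI : IsOpen I) (hU : IsOpen U) (h : SmoothFam Φ I U)
    (h0 : (0 : ℝ) ∈ I) (hK : IsCompact K) (hKU : K ⊆ U) :
    HasDerivAt (fun t => ∫ y in K, Φ t y) (∫ y in K, Perelman.dt Φ 0 y) 0 := by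
  obtain ⟨r, hr, hrI⟩ := Metric.nhds_basis_closedBall.mem_iff.1 (hI.mem_nhds h0)
  have hd := h.dt hI hU
  -- The parameter derivative is continuous on the compact product of a parameter interval with K,
  -- so a constant serves as the dominating function.
  obtain ⟨c, hc⟩ := ((isCompact_closedBall (0 : ℝ) r).prod hK).exists_bound_of_continuousOn
    (f := fun q : ℝ × EuclideanSpace ℝ (Fin n) => Perelman.dt Φ q.1 q.2)
    (ContDiffOn.continuousOn (ContDiffOn.mono hd (prod_mono hrI hKU)))
  have hm := hK.measurableSet
  refine (hasDerivAt_integral_of_dominated_loc_of_deriv_le (μ := volume.restrict K)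
    (F := Φ) (F' := Perelman.dt Φ) (bound := fun _ => c)
    (Metric.closedBall_mem_nhds (0 : ℝ) hr) ?_ ?_ ?_ ?_ ?_ ?_).2
  · filter_upwards [hI.mem_nhds h0] with t ht
    exact (((h.slice ht).continuousOn.mono hKU).aestronglyMeasurable hm)
  · exact ((h.slice h0).continuousOn.mono hKU).integrableOn_compact hK
  · exact (((hd.slice h0).continuousOn.mono hKU).aestronglyMeasurable hm)
  · filter_upwards [ae_restrict_mem hm] with y hy t ht
    exact hc (t, y) ⟨ht, hy⟩
  · exact integrableOn_const hK.measure_lt_top.ne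
  · filter_upwards [ae_restrict_mem hm] with y hy t ht
    exact h.hasDerivAt hI hU (hrI ht) (hKU hy)

/-- The integral of a partial derivative of a function with compact support in `U` vanishes. -/
theorem setIntegral_pd_eq_zero (hU : IsOpen U) (hK : IsCompact K) (hKU : K ⊆ U)
    {u : EuclideanSpace ℝ (Fin n) → ℝ} (hu : ContDiffOn ℝ ∞ u U) (h0 : ∀ y ∈ U, y ∉ K → u y = 0)
    (i : Fin n) : ∫ y in U, pd i u y = 0 := by
  -- Extension by zero is smooth on all of ℝⁿ: a point outside U has the complement of K as a
  -- neighbourhood, and there the extension vanishes.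
  set w := U.indicator u with hw
  have hwK : ∀ y ∉ K, w y = 0 := fun y hy => by
    by_cases hyU : y ∈ U
    · rw [hw, indicator_of_mem hyU, h0 y hyU hy]
    · rw [hw, indicator_of_notMem hyU]
  have hsupp : HasCompactSupport w := HasCompactSupport.intro hK hwK
  have hsm : ContDiff ℝ ∞ w := by
    rw [contDiff_iff_contDiffAt]
    intro y
    by_cases hyU : y ∈ U
    · refine (hu.contDiffAt (hU.mem_nhds hyU)).congr_of_eventuallyEq ?_
      filter_upwards [hU.mem_nhds hyU] with z hz
      rw [hw, indicator_of_mem hz]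
    · refine (contDiffAt_const (c := (0 : ℝ))).congr_of_eventuallyEq ?_
      filter_upwards [hK.isClosed.isOpen_compl.mem_nhds fun h => hyU (hKU h)] with z hz
      exact hwK z hz
  have hdc : Continuous fun y => fderiv ℝ w y (EuclideanSpace.single i 1) :=
    (hsm.continuous_fderiv (by simp)).clm_apply continuous_const
  have hds : HasCompactSupport fun y => fderiv ℝ w y (EuclideanSpace.single i 1) :=
    hsupp.fderiv_apply ℝ _
  -- Integration by parts against the constant function 1.
  have h1 := integral_mul_fderiv_eq_neg_fderiv_mul_of_integrable (μ := volume)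
    (f := fun _ : EuclideanSpace ℝ (Fin n) => (1 : ℝ)) (g := w)
    (v := EuclideanSpace.single i 1) (by simp)
    (by simpa using hdc.integrable_of_hasCompactSupport hds)
    (by simpa using hsm.continuous.integrable_of_hasCompactSupport hsupp)
    (fun x _ => differentiableAt_const _) (fun x _ => hsm.differentiable (by simp) x)
  simp only [one_mul, fderiv_fun_const, Pi.zero_apply, zero_apply, zero_mul, integral_zero,
    neg_zero] at h1
  rw [← h1, ← setIntegral_eq_integral_of_forall_compl_eq_zero (s := U)
    (f := fun y => fderiv ℝ w y (EuclideanSpace.single i 1))]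
  · refine setIntegral_congr_fun hU.measurableSet fun y hy => pd_congr i hU hy fun z hz => ?_
    rw [hw, indicator_of_mem hz]
  · intro y hy
    have hev : w =ᶠ[𝓝 y] fun _ => 0 := by
      filter_upwards [hK.isClosed.isOpen_compl.mem_nhds fun h => hy (hKU h)] with z hz
      exact hwK z hz
    rw [hev.fderiv_eq]
    simp

end Analysis

/-! ### The exponential weight and the divergence theorem with compact support in a chart. -/

section Divergence

variable {n : ℕ} {U : Set (EuclideanSpace ℝ (Fin n))} {y : EuclideanSpace ℝ (Fin n)}
  {G V : EuclideanSpace ℝ (Fin n) → Matrix (Fin n) (Fin n) ℝ}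
  {u w k : EuclideanSpace ℝ (Fin n) → ℝ} {α β : Fin n → EuclideanSpace ℝ (Fin n) → ℝ}

theorem pairingCoord_add (G₀ A B C : Matrix (Fin n) (Fin n) ℝ) :
    pairingCoord G₀ A (B + C) = pairingCoord G₀ A B + pairingCoord G₀ A C := by
  simp only [pairingCoord, Matrix.add_apply, mul_add, Finset.sum_add_distrib]

theorem pairingCoord_smul (c : ℝ) (G₀ A B : Matrix (Fin n) (Fin n) ℝ) :
    pairingCoord G₀ A (c • B) = c * pairingCoord G₀ A B := by
  simp only [pairingCoord, Matrix.smul_apply, smul_eq_mul, Finset.mul_sum]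
  refine Finset.sum_congr rfl fun i _ => Finset.sum_congr rfl fun j _ =>
    Finset.sum_congr rfl fun k _ => Finset.sum_congr rfl fun l _ => ?_
  ring

theorem traceCoord_add (G₀ A B : Matrix (Fin n) (Fin n) ℝ) :
    traceCoord G₀ (A + B) = traceCoord G₀ A + traceCoord G₀ B := by
  simp only [traceCoord, Matrix.add_apply, mul_add, Finset.sum_add_distrib]

theorem traceCoord_smul (c : ℝ) (G₀ A : Matrix (Fin n) (Fin n) ℝ) :
    traceCoord G₀ (c • A) = c * traceCoord G₀ A := by
  simp only [traceCoord, Matrix.smul_apply, smul_eq_mul, Finset.mul_sum]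
  refine Finset.sum_congr rfl fun i _ => Finset.sum_congr rfl fun j _ => ?_
  ring

/-- The Hessian as a matrix. -/
def hessMatrix (G : EuclideanSpace ℝ (Fin n) → Matrix (Fin n) (Fin n) ℝ)
    (u : EuclideanSpace ℝ (Fin n) → ℝ) (y : EuclideanSpace ℝ (Fin n)) : Matrix (Fin n) (Fin n) ℝ :=
  Matrix.of fun i j => hessCoord G u i j y

theorem hessMatrix_add (hU : IsOpen U) (hy : y ∈ U) (hu : ContDiffOn ℝ ∞ u U)
    (hw : ContDiffOn ℝ ∞ w U) :
    hessMatrix G (fun z => u z + w z) y = hessMatrix G u y + hessMatrix G w y := by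
  ext i j
  simp only [hessMatrix, Matrix.of_apply, Matrix.add_apply, hessCoord]
  rw [pd_congr i hU hy fun z hz => pd_add j (diffAt hU hz hu) (diffAt hU hz hw),
    pd_add i (diffAt hU hy (hu.pd hU j)) (diffAt hU hy (hw.pd hU j))]
  simp only [pd_add _ (diffAt hU hy hu) (diffAt hU hy hw), mul_add, Finset.sum_add_distrib]
  ring

theorem pd_eq_zero (hU : IsOpen U) (hy : y ∈ U) (h : ∀ z ∈ U, u z = 0) (i : Fin n) :
    pd i u y = 0 := by
  rw [pd_congr i hU hy h, pd_const]

theorem hessMatrix_eq_zero (hU : IsOpen U) (hy : y ∈ U) (h : ∀ z ∈ U, u z = 0) :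
    hessMatrix G u y = 0 := by
  ext i j
  simp [hessMatrix, hessCoord, pd_eq_zero hU hy h,
    pd_eq_zero hU hy fun z hz => pd_eq_zero hU hz h j]

theorem pd_exp_neg (hU : IsOpen U) (hy : y ∈ U) (hu : ContDiffOn ℝ ∞ u U) (i : Fin n) :
    pd i (fun z => Real.exp (-u z)) y = -Real.exp (-u y) * pd i u y := by
  have h := ((diffAt hU hy hu).hasFDerivAt.fun_neg).exp
  rw [pd, HasFDerivAt.fderiv h, pd]
  simp

/-- The du⊗du part will cancel the variation of the inverse metric in |∇f|²; the −∇²u part leaves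
the Hessian term of the first variation. -/
theorem hessMatrix_exp_neg (hU : IsOpen U) (hy : y ∈ U) (hu : ContDiffOn ℝ ∞ u U) :
    hessMatrix G (fun z => Real.exp (-u z)) y = Real.exp (-u y) •
      ((Matrix.of fun i j => pd i u y * pd j u y) + (-1 : ℝ) • hessMatrix G u y) := by
  have he : ContDiffOn ℝ ∞ (fun z => -Real.exp (-u z)) U := hu.neg.exp.neg
  ext i j
  simp only [hessMatrix, Matrix.of_apply, Matrix.add_apply, Matrix.smul_apply, smul_eq_mul,
    hessCoord]
  rw [pd_congr i hU hy fun z hz => pd_exp_neg hU hz hu j,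
    pd_mul i (diffAt hU hy he) (diffAt hU hy (hu.pd hU j))]
  have h1 : pd i (fun z => -Real.exp (-u z)) y = Real.exp (-u y) * pd i u y := by
    have h := (((diffAt hU hy hu).hasFDerivAt.fun_neg).exp).fun_neg
    rw [pd, HasFDerivAt.fderiv h, pd]
    simp
  rw [h1]
  simp only [pd_exp_neg hU hy hu]
  have h2 : ∑ k, christoffel G k i j y * (-Real.exp (-u y) * pd k u y)
      = -Real.exp (-u y) * ∑ k, christoffel G k i j y * pd k u y := by
    rw [Finset.mul_sum]
    exact Finset.sum_congr rfl fun k _ => by ring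
  rw [h2]
  ring

theorem covectorInner_add_left (G₀ : Matrix (Fin n) (Fin n) ℝ) (α β η : Fin n → ℝ) :
    covectorInner G₀ (fun i => α i + β i) η = covectorInner G₀ α η + covectorInner G₀ β η := by
  simp only [covectorInner, mul_add, add_mul, Finset.sum_add_distrib]

theorem covectorInner_smul_left (c : ℝ) (G₀ : Matrix (Fin n) (Fin n) ℝ) (α η : Fin n → ℝ) :
    covectorInner G₀ (fun i => c * α i) η = c * covectorInner G₀ α η := by
  simp only [covectorInner, Finset.mul_sum]
  refine Finset.sum_congr rfl fun i _ => Finset.sum_congr rfl fun j _ => ?_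
  ring

namespace IsMetricOn

theorem covectorInner_comm (hG : IsMetricOn G U) (hy : y ∈ U) (α β : Fin n → ℝ) :
    covectorInner (G y) α β = covectorInner (G y) β α := by
  rw [covectorInner, covectorInner, Finset.sum_comm]
  refine Finset.sum_congr rfl fun i _ => Finset.sum_congr rfl fun j _ => ?_
  rw [hG.inv_apply_symm hy j i, mul_comm (α j)]

theorem smooth_hessMatrix (hG : IsMetricOn G U) (hu : ContDiffOn ℝ ∞ u U) :
    SmoothMatOn (hessMatrix G u) U := fun i j =>
  ((hu.pd hG.isOpen j).pd hG.isOpen i).sub (ContDiffOn.sum fun k _ =>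
    (hG.smooth_christoffel k i j).mul (hu.pd hG.isOpen k))

theorem smooth_laplacianCoord (hG : IsMetricOn G U) (hu : ContDiffOn ℝ ∞ u U) :
    ContDiffOn ℝ ∞ (laplacianCoord G u) U := hG.smooth_traceCoord (hG.smooth_hessMatrix hu)

theorem smooth_pairingCoord (hG : IsMetricOn G U) {A B : EuclideanSpace ℝ (Fin n) →
    Matrix (Fin n) (Fin n) ℝ} (hA : SmoothMatOn A U) (hB : SmoothMatOn B U) :
    ContDiffOn ℝ ∞ (fun z => pairingCoord (G z) (A z) (B z)) U :=
  ContDiffOn.sum fun i _ => ContDiffOn.sum fun j _ => ContDiffOn.sum fun k _ =>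
    ContDiffOn.sum fun l _ => ((hG.smooth_inv i k).mul (hG.smooth_inv j l)).mul
      ((hA i j).mul (hB k l))

theorem smooth_covectorInner (hG : IsMetricOn G U) (hα : ∀ i, ContDiffOn ℝ ∞ (α i) U)
    (hβ : ∀ i, ContDiffOn ℝ ∞ (β i) U) :
    ContDiffOn ℝ ∞ (fun z => covectorInner (G z) (fun i => α i z) fun i => β i z) U :=
  ContDiffOn.sum fun i _ => ContDiffOn.sum fun j _ => (hG.smooth_inv i j).mul ((hα i).mul (hβ j))

theorem smooth_ricciCoord (hG : IsMetricOn G U) (i j : Fin n) :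
    ContDiffOn ℝ ∞ (ricciCoord G i j) U :=
  ContDiffOn.sum fun _ _ => (((hG.smooth_christoffel _ _ _).pd hG.isOpen _).sub
    ((hG.smooth_christoffel _ _ _).pd hG.isOpen _)).add (ContDiffOn.sum fun _ _ =>
      ((hG.smooth_christoffel _ _ _).mul (hG.smooth_christoffel _ _ _)).sub
        ((hG.smooth_christoffel _ _ _).mul (hG.smooth_christoffel _ _ _)))

end IsMetricOn

/-- The difference between the formal adjoints at `w` and `k` of the linearizations of
`R` and `|∇u|²`, whose integral vanishes, in coordinates. -/
def divergenceCoord (G V : EuclideanSpace ℝ (Fin n) → Matrix (Fin n) (Fin n) ℝ)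
    (w k u : EuclideanSpace ℝ (Fin n) → ℝ) (y : EuclideanSpace ℝ (Fin n)) : ℝ :=
  w y * (-laplacianCoord G (fun z => traceCoord (G z) (V z)) y + divDivCoord G V y)
    - pairingCoord (G y) (V y) (hessMatrix G w y) + traceCoord (G y) (V y) * laplacianCoord G w y
    - 2 * (k y * laplacianCoord G u y
      + covectorInner (G y) (fun i => pd i k y) (fun i => pd i u y))

/-- The covector field with divergence `divergenceCoord`. -/
def fluxCoord (G V : EuclideanSpace ℝ (Fin n) → Matrix (Fin n) (Fin n) ℝ)
    (w k u : EuclideanSpace ℝ (Fin n) → ℝ) (j : Fin n) (z : EuclideanSpace ℝ (Fin n)) : ℝ :=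
  w z * (divTwo G V j z - pd j (fun z => traceCoord (G z) (V z)) z)
    - (contractGrad G V w j z - traceCoord (G z) (V z) * pd j w z) - 2 * k z * pd j u z

namespace IsMetricOn

theorem smooth_adjointFlux (hG : IsMetricOn G U) (hV : SmoothMatOn V U)
    (hw : ContDiffOn ℝ ∞ w U) (j : Fin n) : ContDiffOn ℝ ∞ (fun z =>
      w z * (divTwo G V j z - pd j (fun z => traceCoord (G z) (V z)) z)
        - (contractGrad G V w j z - traceCoord (G z) (V z) * pd j w z)) U :=
  (hw.mul ((hG.smooth_divTwo hV j).sub ((hG.smooth_traceCoord hV).pd hG.isOpen j))).sub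
    ((hG.smooth_contractGrad hV hw j).sub ((hG.smooth_traceCoord hV).mul (hw.pd hG.isOpen j)))

theorem smooth_fluxCoord (hG : IsMetricOn G U) (hV : SmoothMatOn V U) (hw : ContDiffOn ℝ ∞ w U)
    (hk : ContDiffOn ℝ ∞ k U) (hu : ContDiffOn ℝ ∞ u U) (j : Fin n) :
    ContDiffOn ℝ ∞ (fluxCoord G V w k u j) U :=
  (hG.smooth_adjointFlux hV hw j).sub ((contDiffOn_const.mul hk).mul (hu.pd hG.isOpen j))

theorem smooth_divergenceCoord (hG : IsMetricOn G U) (hV : SmoothMatOn V U)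
    (hw : ContDiffOn ℝ ∞ w U) (hk : ContDiffOn ℝ ∞ k U) (hu : ContDiffOn ℝ ∞ u U) :
    ContDiffOn ℝ ∞ (divergenceCoord G V w k u) U := by
  have h1 : ContDiffOn ℝ ∞ (divDivCoord G V) U := by
    refine ContDiffOn.congr (f := codiff G (divTwo G V)) ?_ fun z hz => hG.divDivCoord_eq hz hV
    exact ContDiffOn.sum fun i _ => ContDiffOn.sum fun j _ => (hG.smooth_inv i j).mul
      (((hG.smooth_divTwo hV j).pd hG.isOpen i).sub (ContDiffOn.sum fun m _ =>
        (hG.smooth_christoffel m i j).mul (hG.smooth_divTwo hV m)))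
  exact (((hw.mul ((hG.smooth_laplacianCoord (hG.smooth_traceCoord hV)).neg.add h1)).sub
    (hG.smooth_pairingCoord hV (hG.smooth_hessMatrix hw))).add
    ((hG.smooth_traceCoord hV).mul (hG.smooth_laplacianCoord hw))).sub (contDiffOn_const.mul
      ((hk.mul (hG.smooth_laplacianCoord hu)).add
        (hG.smooth_covectorInner (fun i => hk.pd hG.isOpen i) fun i => hu.pd hG.isOpen i)))

/-- The flux is that of `adjoint_identity` minus 2k du, whose divergence is 2(kΔu + ⟨dk, du⟩). -/
theorem sum_pd_fluxCoord (hG : IsMetricOn G U) (hy : y ∈ U) (hV : SmoothMatOn V U)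
    (hw : ContDiffOn ℝ ∞ w U) (hk : ContDiffOn ℝ ∞ k U) (hu : ContDiffOn ℝ ∞ u U) :
    ∑ i, pd i (vectorDensity G (fluxCoord G V w k u) i) y
      = √(G y).det * divergenceCoord G V w k u y := by
  have hk2 : ContDiffOn ℝ ∞ (fun z => 2 * k z) U := contDiffOn_const.mul hk
  have h1 := hG.adjoint_identity hy hV hw
  rw [hG.sum_pd_vectorDensity hy fun j => hG.smooth_adjointFlux hV hw j] at h1
  have h2 := hG.codiff_sub hy (fun j => hG.smooth_adjointFlux hV hw j)
    (β := fun j z => 2 * k z * pd j u z) fun j => hk2.mul (hu.pd hG.isOpen j)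
  rw [hG.codiff_mul hy hk2 fun j => hu.pd hG.isOpen j] at h2
  simp only [pd_const_mul _ 2 (diffAt hG.isOpen hy hk)] at h2
  rw [covectorInner_smul_left] at h2
  rw [hG.sum_pd_vectorDensity hy fun j => hG.smooth_fluxCoord hV hw hk hu j, divergenceCoord,
    laplacianCoord_eq (u := u)]
  have h3 : codiff G (fluxCoord G V w k u) y = _ := h2
  rw [h3]
  simp only [hessMatrix]
  linear_combination -h1

end IsMetricOn

/-- The divergence theorem for covector fields with compact support in a coordinate domain. -/
theorem setIntegral_divergenceCoord (hG : IsMetricOn G U) (hV : SmoothMatOn V U)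
    (hw : ContDiffOn ℝ ∞ w U) (hk : ContDiffOn ℝ ∞ k U) (hu : ContDiffOn ℝ ∞ u U)
    {K : Set (EuclideanSpace ℝ (Fin n))} (hK : IsCompact K) (hKU : K ⊆ U)
    (hw0 : ∀ y ∈ U, y ∉ K → w y = 0) (hk0 : ∀ y ∈ U, y ∉ K → k y = 0) :
    ∫ y in U, divergenceCoord G V w k u y * √(G y).det = 0 := by
  have hX : ∀ i, ContDiffOn ℝ ∞ (vectorDensity G (fluxCoord G V w k u) i) U := fun i =>
    hG.smooth_vectorDensity (fun j => hG.smooth_fluxCoord hV hw hk hu j) i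
  have hopen : IsOpen (U \ K) := hG.isOpen.sdiff hK.isClosed
  have hflux : ∀ j, ∀ y ∈ U, y ∉ K → fluxCoord G V w k u j y = 0 := by
    intro j y hy hyK
    -- `w` vanishes on the open set U \ K, hence so do its derivatives there. No support condition
    -- on `u` is needed: it enters the flux only multiplied by `k`.
    have hp : ∀ i, pd i w y = 0 :=
      pd_eq_zero hopen ⟨hy, hyK⟩ fun z hz => hw0 z hz.1 hz.2
    simp [fluxCoord, contractGrad, traceCoord, hw0 y hy hyK, hk0 y hy hyK, hp]
  have hX0 : ∀ i, ∀ y ∈ U, y ∉ K → vectorDensity G (fluxCoord G V w k u) i y = 0 :=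
    fun i y hy hyK => by simp [vectorDensity, hflux _ y hy hyK]
  have hcongr : ∀ y ∈ U, divergenceCoord G V w k u y * √(G y).det
      = ∑ i, pd i (vectorDensity G (fluxCoord G V w k u) i) y := fun y hy => by
    rw [hG.sum_pd_fluxCoord hy hV hw hk hu, mul_comm]
  rw [setIntegral_congr_fun hG.isOpen.measurableSet hcongr, integral_finsetSum]
  · exact Finset.sum_eq_zero fun i _ =>
      setIntegral_pd_eq_zero hG.isOpen hK hKU (hX i) (hX0 i) i
  · intro i _
    have h1 : IntegrableOn (fun y => pd i (vectorDensity G (fluxCoord G V w k u) i) y) K :=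
      (((hX i).pd hG.isOpen i).continuousOn.mono hKU).integrableOn_compact hK
    refine h1.of_forall_sdiff_eq_zero hG.isOpen.measurableSet fun y hy => ?_
    exact pd_eq_zero hopen hy (fun z hz => hX0 i z hz.1 hz.2) i

end Divergence

/-! ### The variation of the integrand on the manifold and its divergence term. -/

section Variation

variable {n : ℕ} {M : Type*} [TopologicalSpace M] [ChartedSpace (EuclideanSpace ℝ (Fin n)) M]

theorem continuous_of_inChart {F : M → ℝ}
    (hF : ∀ p, ContinuousOn (inChart F p) (coordDomain n p)) : Continuous F := by
  refine continuous_iff_continuousAt.2 fun x => ?_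
  have h1 : ContinuousAt (inChart F x ∘ extChartAt (𝓡 n) x) x :=
    ContinuousAt.comp ((hF x).continuousAt ((isOpen_coordDomain x).mem_nhds
      (mem_extChartAt_target (I := 𝓡 n) x))) (continuousAt_extChartAt x)
  refine h1.congr ?_
  filter_upwards [(isOpen_extChartAt_source (I := 𝓡 n) x).mem_nhds (mem_extChartAt_source x)]
    with z hz
  rw [Function.comp_apply, inChart, (extChartAt (𝓡 n) x).left_inv hz]

theorem extChartAt_symm_apply {p : M} {y : EuclideanSpace ℝ (Fin n)} (hy : y ∈ coordDomain n p) :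
    extChartAt (𝓡 n) p ((extChartAt (𝓡 n) p).symm y) = y :=
  (extChartAt (𝓡 n) p).right_inv hy

variable [IsManifold (𝓡 n) ∞ M]

theorem exists_partition [CompactSpace M] [T2Space M] : ∃ (s : Finset M) (ρ : M → M → ℝ),
    (∀ p, ContMDiff (𝓡 n) 𝓘(ℝ, ℝ) ∞ (ρ p)) ∧
    (∀ p, tsupport (ρ p) ⊆ (extChartAt (𝓡 n) p).source) ∧ ∀ x, ∑ p ∈ s, ρ p x = 1 := by
  obtain ⟨ρ, hρ⟩ := SmoothPartitionOfUnity.exists_isSubordinate_chartAt_source (𝓡 n) M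
  -- The partition is indexed by the points of `M`; compactness leaves only finitely many functions
  -- that are not identically zero.
  have hfin := ρ.locallyFinite.finite_nonempty_of_compact
  refine ⟨hfin.toFinset, fun p => ρ p, fun p => (ρ p).contMDiff, fun p => ?_, fun x => ?_⟩
  · rw [extChartAt_source]
    exact hρ p
  · rw [← ρ.sum_eq_one (mem_univ x)]
    refine (finsum_eq_sum_of_support_subset _ fun p hp => ?_).symm
    simp only [hfin.coe_toFinset]
    exact ⟨x, hp⟩

/-- The quantity `-Δv + ∇_i ∇_j v_ij`. -/
def scalarVariation (g : Metric n M) (v : TwoTensor n M) (x : M) : ℝ :=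
  -laplacian g (trace g v) x + divDiv g v x

/-- The Laplacian differentiates the trace at points near x, each of which uses its own chart, so
`trace_eq` is needed even in the chart around x. -/
theorem scalarVariation_chart (g : Metric n M) (v : TwoTensor n M) (x : M) :
    scalarVariation g v x = -laplacianCoord (metricComponents g x)
        (fun z => traceCoord (metricComponents g x z) (components v x z)) (extChartAt (𝓡 n) x x)
      + divDivCoord (metricComponents g x) (components v x) (extChartAt (𝓡 n) x x) := by
  have h : ∀ z ∈ coordDomain n x, inChart (trace g v) x z
      = traceCoord (metricComponents g x z) (components v x z) := fun z hz => by
    rw [inChart, trace_eq g v (map_coordDomain hz), extChartAt_symm_apply hz]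
  rw [scalarVariation, laplacian, laplacianCoord, laplacianCoord]
  simp only [hessCoord_congr (isOpen_coordDomain x) h (mem_extChartAt_target (I := 𝓡 n) x)]
  rfl

/-- The difference between the formal adjoints at `w` and `k` of the linearizations of
`R` and `|∇u|²`, whose integral vanishes. -/
def divergenceTerm (g : Metric n M) (v : TwoTensor n M) (w k u : M → ℝ) (x : M) : ℝ :=
  w x * scalarVariation g v x - pairing g v x (hess g w x) + trace g v x * laplacian g w x
    - 2 * (k x * laplacian g u x + gradInner g k u x)

theorem divergenceTerm_chart (g : Metric n M) (v : TwoTensor n M) (w k u : M → ℝ) (x : M) :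
    divergenceTerm g v w k u x = divergenceCoord (metricComponents g x) (components v x)
      (inChart w x) (inChart k x) (inChart u x) (extChartAt (𝓡 n) x x) := by
  have h : ∀ u : M → ℝ, inChart u x (extChartAt (𝓡 n) x x) = u x := fun u => by
    rw [inChart, extChartAt_to_inv]
  rw [divergenceTerm, divergenceCoord, scalarVariation_chart, h, h]
  rfl

/-- Linearity jointly in (w, k), with `u` fixed, is what allows a partition of unity to be inserted.
-/
theorem divergenceTerm_add {w₁ w₂ k₁ k₂ : M → ℝ} (g : Metric n M) (v : TwoTensor n M) (u : M → ℝ)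
    (hw₁ : ContMDiff (𝓡 n) 𝓘(ℝ, ℝ) ∞ w₁) (hw₂ : ContMDiff (𝓡 n) 𝓘(ℝ, ℝ) ∞ w₂)
    (hk₁ : ContMDiff (𝓡 n) 𝓘(ℝ, ℝ) ∞ k₁) (hk₂ : ContMDiff (𝓡 n) 𝓘(ℝ, ℝ) ∞ k₂) (x : M) :
    divergenceTerm g v (fun z => w₁ z + w₂ z) (fun z => k₁ z + k₂ z) u x
      = divergenceTerm g v w₁ k₁ u x + divergenceTerm g v w₂ k₂ u x := by
  have hU := isOpen_coordDomain (n := n) x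
  have hy := mem_extChartAt_target (I := 𝓡 n) x
  have h0 : ∀ u w : M → ℝ, inChart (n := n) (fun z => u z + w z) x
    = fun y => inChart u x y + inChart w x y := fun _ _ => rfl
  have h1 := hessMatrix_add (G := metricComponents g x) hU hy (smooth_inChart hw₁ x)
    (smooth_inChart hw₂ x)
  have h2 := fun i => pd_add i (diffAt hU hy (smooth_inChart hk₁ x))
    (diffAt hU hy (smooth_inChart hk₂ x))
  have h3 : ∀ u, laplacianCoord (metricComponents g x) u (extChartAt (𝓡 n) x x) = traceCoord
    (metricComponents g x (extChartAt (𝓡 n) x x))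
    (hessMatrix (metricComponents g x) u (extChartAt (𝓡 n) x x)) := fun _ => rfl
  simp only [divergenceTerm_chart, divergenceCoord, h0]
  rw [h3 (fun y => inChart w₁ x y + inChart w₂ x y), h1, h3 (inChart w₁ x), h3 (inChart w₂ x)]
  simp only [h2, pairingCoord_add, traceCoord_add, covectorInner_add_left]
  ring

/-- Locality: only the germs of w and k matter, so cutting them off cuts off the whole expression.
-/
theorem divergenceTerm_eq_zero {w k : M → ℝ} (g : Metric n M) (v : TwoTensor n M) (u : M → ℝ)
    {W : Set M} (hW : IsOpen W) (hw : ∀ x ∈ W, w x = 0) (hk : ∀ x ∈ W, k x = 0) {x : M}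
    (hx : x ∈ W) : divergenceTerm g v w k u x = 0 := by
  have hU := (continuousOn_extChartAt_symm (I := 𝓡 n) x).isOpen_inter_preimage
    (isOpen_coordDomain x) hW
  have hy : extChartAt (𝓡 n) x x ∈ coordDomain n x ∩ (extChartAt (𝓡 n) x).symm ⁻¹' W := by
    refine ⟨mem_extChartAt_target (I := 𝓡 n) x, ?_⟩
    rw [mem_preimage, extChartAt_to_inv]
    exact hx
  have hw' : ∀ z ∈ coordDomain n x ∩ (extChartAt (𝓡 n) x).symm ⁻¹' W, inChart w x z = 0 :=
    fun z hz => hw _ hz.2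
  have hk' : ∀ z ∈ coordDomain n x ∩ (extChartAt (𝓡 n) x).symm ⁻¹' W, inChart k x z = 0 :=
    fun z hz => hk _ hz.2
  have h3 : laplacianCoord (metricComponents g x) (inChart w x) (extChartAt (𝓡 n) x x) = traceCoord
    (metricComponents g x (extChartAt (𝓡 n) x x))
    (hessMatrix (metricComponents g x) (inChart w x) (extChartAt (𝓡 n) x x)) := rfl
  rw [divergenceTerm_chart, divergenceCoord, h3, hessMatrix_eq_zero hU hy hw', hw' _ hy, hk' _ hy]
  simp only [pd_eq_zero hU hy hk']
  simp [pairingCoord, traceCoord, covectorInner]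

theorem divergenceTerm_sum (g : Metric n M) (v : TwoTensor n M) (u : M → ℝ) {ι : Type*}
    (s : Finset ι) {w k : ι → M → ℝ} (hw : ∀ a, ContMDiff (𝓡 n) 𝓘(ℝ, ℝ) ∞ (w a))
    (hk : ∀ a, ContMDiff (𝓡 n) 𝓘(ℝ, ℝ) ∞ (k a)) (x : M) :
    divergenceTerm g v (fun z => ∑ a ∈ s, w a z) (fun z => ∑ a ∈ s, k a z) u x
      = ∑ a ∈ s, divergenceTerm g v (w a) (k a) u x := by
  classical
  induction s using Finset.induction_on with
  | empty =>
    simpa using divergenceTerm_eq_zero g v u isOpen_univ (fun _ _ => rfl) (fun _ _ => rfl)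
      (mem_univ x)
  | insert a s ha ih =>
    simp only [Finset.sum_insert ha]
    rw [divergenceTerm_add g v u (hw a) (contMDiff_finsetSum fun a _ => hw a) (hk a)
      (contMDiff_finsetSum fun a _ => hk a), ih]

namespace IsVariation

variable {g : Metric n M} {f : M → ℝ} {v : TwoTensor n M} {h : M → ℝ} {γ : ℝ → Metric n M}
  {φ : ℝ → M → ℝ} {w k u : M → ℝ} {p x : M}

theorem smooth_components (H : IsVariation g f v h γ φ) (p : M) :
    SmoothMatOn (components v p) (coordDomain n p) := by
  obtain ⟨ε, hε, hG, -⟩ := H.isMetricVariation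
  exact (hG p).smooth_variation

theorem hasDerivAt_scalarCurvature_chart (H : IsVariation g f v h γ φ)
    (hx : x ∈ (extChartAt (𝓡 n) p).source) :
    HasDerivAt (fun t => scalarCurvature (γ t) x)
      (-laplacianCoord (metricComponents g p)
        (fun z => traceCoord (metricComponents g p z) (components v p z)) (extChartAt (𝓡 n) p x)
      + divDivCoord (metricComponents g p) (components v p) (extChartAt (𝓡 n) p x)
      - pairing g v x (ricci g x)) 0 := by
  obtain ⟨ε, hε, hG, -⟩ := H.isMetricVariation
  have h1 := (hG p).hasDerivAt_scalarCoord ((extChartAt (𝓡 n) p).map_source hx)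
  simp only [← scalarCurvature_eq _ hx, H.metric_zero] at h1
  rwa [ricci_eq g hx]

theorem hasDerivAt_scalarCurvature (H : IsVariation g f v h γ φ) (x : M) :
    HasDerivAt (fun t => scalarCurvature (γ t) x)
      (scalarVariation g v x - pairing g v x (ricci g x)) 0 := by
  rw [scalarVariation_chart]
  exact H.hasDerivAt_scalarCurvature_chart (mem_extChartAt_source x)

/-- The same function t ↦ R(γ t)(x) is differentiated in two charts. Uniqueness of the derivative
and invariance of R_ij v_ij give the claim, so the double divergence needs no transformation law of
its own. -/
theorem scalarVariation_eq (H : IsVariation g f v h γ φ) (hx : x ∈ (extChartAt (𝓡 n) p).source) :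
    scalarVariation g v x = -laplacianCoord (metricComponents g p)
        (fun z => traceCoord (metricComponents g p z) (components v p z)) (extChartAt (𝓡 n) p x)
      + divDivCoord (metricComponents g p) (components v p) (extChartAt (𝓡 n) p x) := by
  have h1 := (H.hasDerivAt_scalarCurvature x).unique (H.hasDerivAt_scalarCurvature_chart hx)
  linarith

theorem divergenceTerm_eq (H : IsVariation g f v h γ φ) (hw : ContMDiff (𝓡 n) 𝓘(ℝ, ℝ) ∞ w)
    (hk : ContMDiff (𝓡 n) 𝓘(ℝ, ℝ) ∞ k) (hu : ContMDiff (𝓡 n) 𝓘(ℝ, ℝ) ∞ u)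
    {y : EuclideanSpace ℝ (Fin n)} (hy : y ∈ coordDomain n p) :
    inChart (divergenceTerm g v w k u) p y = divergenceCoord (metricComponents g p)
      (components v p) (inChart w p) (inChart k p) (inChart u p) y := by
  have hx := map_coordDomain hy
  rw [inChart, divergenceTerm, H.scalarVariation_eq hx, hess_eq g hw hx, trace_eq g v hx,
    laplacian_eq g hw hx, laplacian_eq g hu hx, gradInner_eq g hk hu hx, extChartAt_symm_apply hy]
  rfl

theorem continuous_divergenceTerm (H : IsVariation g f v h γ φ)
    (hw : ContMDiff (𝓡 n) 𝓘(ℝ, ℝ) ∞ w) (hk : ContMDiff (𝓡 n) 𝓘(ℝ, ℝ) ∞ k)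
    (hu : ContMDiff (𝓡 n) 𝓘(ℝ, ℝ) ∞ u) : Continuous (divergenceTerm g v w k u) :=
  continuous_of_inChart fun p =>
    ((isMetricOn_metricComponents g p).smooth_divergenceCoord (H.smooth_components p)
      (smooth_inChart hw p) (smooth_inChart hk p) (smooth_inChart hu p)).continuousOn.congr
        fun _ hy => H.divergenceTerm_eq hw hk hu hy

theorem continuous_variationIntegrand (H : IsVariation g f v h γ φ)
    (hf : ContMDiff (𝓡 n) 𝓘(ℝ, ℝ) ∞ f) (hh : ContMDiff (𝓡 n) 𝓘(ℝ, ℝ) ∞ h) :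
    Continuous (variationIntegrand g f v h) := by
  refine continuous_of_inChart (n := n) fun p => ?_
  have hG := isMetricOn_metricComponents g p
  have hV := H.smooth_components p
  have hf' := smooth_inChart (n := n) hf p
  have hR : ContDiffOn ℝ ∞ (scalarCoord (metricComponents g p)) (coordDomain n p) :=
    hG.smooth_traceCoord (V := fun z => Matrix.of fun i j => ricciCoord (metricComponents g p) i j z)
      fun i j => hG.smooth_ricciCoord i j
  have hs := hf'.neg.exp.mul (((hG.smooth_pairingCoord hV
    (B := fun z => Matrix.of fun i j => ricciCoord (metricComponents g p) i j z)
    fun i j => hG.smooth_ricciCoord i j).add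
    (hG.smooth_pairingCoord hV (hG.smooth_hessMatrix hf'))).neg.add
    ((((hG.smooth_traceCoord hV).div_const 2).sub (smooth_inChart hh p)).mul
      (((contDiffOn_const (c := (2 : ℝ))).mul (hG.smooth_laplacianCoord hf')).sub
        (hG.smooth_covectorInner (fun i => hf'.pd hG.isOpen i) fun i => hf'.pd hG.isOpen i)
        |>.add hR)))
  refine hs.continuousOn.congr fun y hy => ?_
  have hx := map_coordDomain hy
  have hadd : ∀ x, pairing g v x (ricci g x + hess g f x)
    = pairing g v x (ricci g x) + pairing g v x (hess g f x) := fun x => pairingCoord_add _ _ _ _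
  rw [inChart, variationIntegrand, hadd, ricci_eq g hx, hess_eq g hf hx, trace_eq g v hx,
    laplacian_eq g hf hx, gradSq_eq g hf hx, scalarCurvature_eq g hx, extChartAt_symm_apply hy]
  rfl

/-- The derivative of the integrand of `𝓕`, up to the variation of the volume form. -/
theorem hasDerivAt_functionalIntegrand (H : IsVariation g f v h γ φ)
    (hf : ContMDiff (𝓡 n) 𝓘(ℝ, ℝ) ∞ f) (x : M) :
    HasDerivAt (fun t => functionalIntegrand (γ t) (φ t) x)
      (variationIntegrand g f v h x
        + divergenceTerm g v (fun z => Real.exp (-f z)) h (fun z => Real.exp (-f z)) x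
        - functionalIntegrand g f x * (trace g v x / 2)) 0 := by
  obtain ⟨ε, hε, hG, hΦ, -⟩ := H.isMetricVariation
  have hy := mem_extChartAt_target (I := 𝓡 n) x
  have hU := isOpen_coordDomain (n := n) x
  have hGx := isMetricOn_metricComponents g x
  have hf' := smooth_inChart (n := n) hf x
  have h1 := H.hasDerivAt_scalarCurvature x
  have h2 := (hG x).hasDerivAt_gradSqCoord (hΦ x) hy
  -- The pointwise derivative h agrees with the joint `t`-derivative on the whole coordinate domain,
  -- so its partial derivatives may be substituted.
  have hdt : ∀ z ∈ coordDomain n x, dt (fun t => inChart (φ t) x) 0 z = inChart h x z :=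
    fun z hz => ((hΦ x).hasDerivAt isOpen_Ioo hU (hG x).zero_mem hz).unique (H.function_deriv _)
  simp only [pd_congr _ hU hy hdt, H.metric_zero, H.function_zero] at h2
  have h3 := (H.function_deriv x).fun_neg.exp
  have h4 := (h1.fun_add h2).fun_mul h3
  refine h4.congr_deriv ?_
  set y := extChartAt (𝓡 n) x x with hydef
  have hfy : inChart f x y = f x := by rw [inChart, hydef, extChartAt_to_inv]
  have e1 := hessMatrix_exp_neg (G := metricComponents g x) hU hy hf'
  have e2 : hess g (fun z => Real.exp (-f z)) x = _ := e1
  have e3 : laplacian g (fun z => Real.exp (-f z)) x = traceCoord (metricComponents g x y)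
    (hessMatrix (metricComponents g x) (fun z => Real.exp (-inChart f x z)) y) := rfl
  have e4 : gradInner g h (fun z => Real.exp (-f z)) x
      = -Real.exp (-f x) * gradInner g f h x := by
    change covectorInner (metricComponents g x y) (fun i => pd i (inChart h x) y)
      (fun i => pd i (fun z => Real.exp (-inChart f x z)) y) = _
    rw [hGx.covectorInner_comm hy]
    simp only [pd_exp_neg hU hy hf']
    rw [covectorInner_smul_left, hfy]
    rfl
  have e5 : pairing g v x (ricci g x + hess g f x)
    = pairing g v x (ricci g x) + pairing g v x (hess g f x) := pairingCoord_add _ _ _ _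
  have e6 : traceCoord (metricComponents g x y) (Matrix.of fun i j =>
    pd i (inChart f x) y * pd j (inChart f x) y) = gradSq g f x := rfl
  have e7 : traceCoord (metricComponents g x y) (hessMatrix (metricComponents g x) (inChart f x) y)
    = laplacian g f x := rfl
  have e8 : ∀ A, pairing g v x A = pairingCoord (metricComponents g x y) (components v x y) A :=
    fun _ => rfl
  have e9 : hessMatrix (metricComponents g x) (inChart f x) y = hess g f x := rfl
  have e10 : gradSqCoord (metricComponents g x) (inChart f x) y = gradSq g f x := rfl
  have e11 : covectorInner (metricComponents g x y) (fun i => pd i (inChart f x) y)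
    (fun i => pd i (inChart h x) y) = gradInner g f h x := rfl
  -- With w = u = e^{-f} and k = h: the pairing with ∇²w cancels −v(∇f,∇f), the term −2⟨∇h, ∇u⟩ is
  -- 2e^{-f}⟨∇f, ∇h⟩, and −2hΔu turns R + |∇f|² into R + 2Δf − |∇f|² in the coefficient of −h. The
  -- subtracted trace term anticipates the variation of dV.
  rw [variationIntegrand, divergenceTerm, functionalIntegrand, e4, e3, e2, e1, traceCoord_smul,
    traceCoord_add, traceCoord_smul, e6, e7, e5, e8 (_ • _), pairingCoord_smul, pairingCoord_add,
    pairingCoord_smul, e9, ← e8 (hess g f x), e11, hfy, H.metric_zero, H.function_zero, e10]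
  ring

/-- The parametrized densities of `𝓕` in a chart. -/
theorem smoothFam_functionalIntegrand (H : IsVariation g f v h γ φ) :
    ∃ ε : ℝ, 0 < ε ∧ ∀ p : M,
      SmoothFam (fun t => inChart (functionalIntegrand (γ t) (φ t)) p) (Ioo (-ε) ε)
        (coordDomain n p) ∧
      SmoothFam (fun t => density (γ t) p) (Ioo (-ε) ε) (coordDomain n p) ∧
      ∀ y ∈ coordDomain n p, HasDerivAt (fun t => density (γ t) p y)
        (density g p y * (inChart (trace g v) p y / 2)) 0 := by
  obtain ⟨ε, hε, hG, hΦ, hφ⟩ := H.isMetricVariation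
  refine ⟨ε, hε, fun p => ⟨?_, (hG p).smooth_sqrt_det, fun y hy => ?_⟩⟩
  · refine ContDiffOn.congr (((hG p).smooth_scalarCoord.add
      ((hG p).smooth_gradSqCoord (hΦ p))).mul (Ψ := fun t y => Real.exp (-inChart (φ t) p y))
        (ContDiffOn.exp (ContDiffOn.neg (hΦ p)))) fun q hq => ?_
    have hx := map_coordDomain hq.2
    simp only [inChart]
    rw [functionalIntegrand, scalarCurvature_eq _ hx, gradSq_eq _ (hφ q.1 hq.1) hx,
      extChartAt_symm_apply hq.2]
  · have h1 := (hG p).hasDerivAt_sqrt_det hy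
    rw [H.metric_zero] at h1
    rw [inChart, trace_eq g v (map_coordDomain hy), extChartAt_symm_apply hy]
    exact h1

theorem eventually_continuous_functionalIntegrand (H : IsVariation g f v h γ φ) :
    ∀ᶠ t in 𝓝 (0 : ℝ), Continuous (functionalIntegrand (γ t) (φ t)) := by
  obtain ⟨ε, hε, hF⟩ := H.smoothFam_functionalIntegrand
  filter_upwards [Ioo_mem_nhds (neg_lt_zero.2 hε) hε] with t ht
  exact continuous_of_inChart fun p => ((hF p).1.slice ht).continuousOn

end IsVariation

end Variation

/-! ### Globalization by a partition of unity and the first variation. -/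

section FirstVariation

variable {n : ℕ} {M : Type*} [TopologicalSpace M] [ChartedSpace (EuclideanSpace ℝ (Fin n)) M]

/-- The coordinate image of a closed subset of a chart domain is compact. -/
theorem isCompact_image_extChartAt [CompactSpace M] {p : M} {S : Set M} (hS : IsClosed S)
    (hSp : S ⊆ (extChartAt (𝓡 n) p).source) : IsCompact (extChartAt (𝓡 n) p '' S) :=
  hS.isCompact.image_of_continuousOn ((continuousOn_extChartAt p).mono hSp)

theorem image_extChartAt_subset {p : M} {S : Set M}
    (hSp : S ⊆ (extChartAt (𝓡 n) p).source) : extChartAt (𝓡 n) p '' S ⊆ coordDomain n p := by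
  rintro _ ⟨x, hx, rfl⟩
  exact (extChartAt (𝓡 n) p).map_source (hSp hx)

theorem symm_notMem_of_notMem_image {p : M} {S : Set M} {y : EuclideanSpace ℝ (Fin n)}
    (hy : y ∈ coordDomain n p) (hyS : y ∉ extChartAt (𝓡 n) p '' S) :
    (extChartAt (𝓡 n) p).symm y ∉ S :=
  fun h => hyS ⟨_, h, extChartAt_symm_apply hy⟩

variable [IsManifold (𝓡 n) ∞ M] [CompactSpace M] [MeasurableSpace M] [BorelSpace M]

theorem integral_eq_sum_partition {s : Finset M} {ρ : M → M → ℝ}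
    (hρ : ∀ p, ContMDiff (𝓡 n) 𝓘(ℝ, ℝ) ∞ (ρ p)) (h1 : ∀ x, ∑ p ∈ s, ρ p x = 1)
    (g : Metric n M) {F : M → ℝ} (hF : Continuous F) :
    ∫ x, F x ∂(volumeMeasure g) = ∑ p ∈ s, ∫ x, ρ p x * F x ∂(volumeMeasure g) := by
  rw [← integral_finsetSum _ fun p _ =>
    integrable_of_continuous g ((hρ p).continuous.fun_mul hF)]
  simp only [← Finset.sum_mul, h1, one_mul]

namespace IsVariation

variable {g : Metric n M} {f : M → ℝ} {v : TwoTensor n M} {h : M → ℝ} {γ : ℝ → Metric n M}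
  {φ : ℝ → M → ℝ} {w k u : M → ℝ}

theorem integral_divergenceTerm_of_tsupport (H : IsVariation g f v h γ φ)
    (hw : ContMDiff (𝓡 n) 𝓘(ℝ, ℝ) ∞ w) (hk : ContMDiff (𝓡 n) 𝓘(ℝ, ℝ) ∞ k)
    (hu : ContMDiff (𝓡 n) 𝓘(ℝ, ℝ) ∞ u) {p : M} {S : Set M} (hS : IsClosed S)
    (hSp : S ⊆ (extChartAt (𝓡 n) p).source) (hw0 : ∀ x ∉ S, w x = 0) (hk0 : ∀ x ∉ S, k x = 0) :
    ∫ x, divergenceTerm g v w k u x ∂(volumeMeasure g) = 0 := by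
  rw [integral_volumeMeasure_of_support g p (H.continuous_divergenceTerm hw hk hu) fun x hx =>
      divergenceTerm_eq_zero g v u hS.isOpen_compl hw0 hk0 fun h => hx (hSp h),
    setIntegral_congr_fun (isOpen_coordDomain p).measurableSet fun y hy =>
      congrArg (· * density g p y) (H.divergenceTerm_eq hw hk hu hy)]
  exact setIntegral_divergenceCoord (isMetricOn_metricComponents g p) (H.smooth_components p)
    (smooth_inChart hw p) (smooth_inChart hk p) (smooth_inChart hu p)
    (isCompact_image_extChartAt hS hSp) (image_extChartAt_subset hSp)
    (fun y hy hyS => hw0 _ (symm_notMem_of_notMem_image hy hyS))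
    fun y hy hyS => hk0 _ (symm_notMem_of_notMem_image hy hyS)

/-- The divergence theorem. -/
theorem integral_divergenceTerm [T2Space M] (H : IsVariation g f v h γ φ)
    (hw : ContMDiff (𝓡 n) 𝓘(ℝ, ℝ) ∞ w) (hk : ContMDiff (𝓡 n) 𝓘(ℝ, ℝ) ∞ k)
    (hu : ContMDiff (𝓡 n) 𝓘(ℝ, ℝ) ∞ u) :
    ∫ x, divergenceTerm g v w k u x ∂(volumeMeasure g) = 0 := by
  obtain ⟨s, ρ, hρ, hsupp, h1⟩ := exists_partition (n := n) (M := M)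
  have hρw := fun p => (hρ p).mul hw
  have hρk := fun p => (hρ p).mul hk
  -- The cutoff goes inside, onto w and k. Each piece is then still a divergence, now with compact
  -- support in a chart; multiplying the divergence itself by ρ would destroy this.
  have hsum : ∀ x, divergenceTerm g v w k u x
      = ∑ p ∈ s, divergenceTerm g v (ρ p * w) (ρ p * k) u x := fun x => by
    rw [← divergenceTerm_sum g v u s hρw hρk x]
    simp only [Pi.mul_apply, ← Finset.sum_mul, h1, one_mul]
  simp only [hsum]
  rw [integral_finsetSum _ fun p _ =>
    integrable_of_continuous g (H.continuous_divergenceTerm (hρw p) (hρk p) hu)]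
  refine Finset.sum_eq_zero fun p _ => ?_
  have hz : ∀ x ∉ tsupport (ρ p), ρ p x = 0 := fun x hx => image_eq_zero_of_notMem_tsupport hx
  exact H.integral_divergenceTerm_of_tsupport (hρw p) (hρk p) hu (isClosed_tsupport _) (hsupp p)
    (fun x hx => by simp [hz x hx]) fun x hx => by simp [hz x hx]

/-- A fixed cutoff supported in one chart turns an integral against a moving measure into one over a
fixed compact set, with the density √det(g_ij) as a further smooth factor. -/
theorem hasDerivAt_integral_of_tsupport (H : IsVariation g f v h γ φ)
    (hf : ContMDiff (𝓡 n) 𝓘(ℝ, ℝ) ∞ f) (hh : ContMDiff (𝓡 n) 𝓘(ℝ, ℝ) ∞ h)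
    {p : M} {ρ : M → ℝ} (hρ : ContMDiff (𝓡 n) 𝓘(ℝ, ℝ) ∞ ρ)
    (hsupp : tsupport ρ ⊆ (extChartAt (𝓡 n) p).source) :
    HasDerivAt (fun t => ∫ x, ρ x * functionalIntegrand (γ t) (φ t) x ∂(volumeMeasure (γ t)))
      (∫ x, ρ x * (variationIntegrand g f v h x
        + divergenceTerm g v (fun z => Real.exp (-f z)) h (fun z => Real.exp (-f z)) x)
          ∂(volumeMeasure g)) 0 := by
  obtain ⟨ε, hε, hF⟩ := H.smoothFam_functionalIntegrand
  obtain ⟨hF1, hF2, hF3⟩ := hF p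
  have hU := isOpen_coordDomain (n := n) p
  have hI : Ioo (-ε) ε ∈ 𝓝 (0 : ℝ) := Ioo_mem_nhds (neg_lt_zero.2 hε) hε
  have he : ContMDiff (𝓡 n) 𝓘(ℝ, ℝ) ∞ fun z => Real.exp (-f z) :=
    Real.contDiff_exp.comp_contMDiff hf.neg
  set K := extChartAt (𝓡 n) p '' tsupport ρ with hKdef
  have hK : IsCompact K := isCompact_image_extChartAt (isClosed_tsupport ρ) hsupp
  have hKU : K ⊆ coordDomain n p := image_extChartAt_subset hsupp
  have hz : ∀ x ∉ tsupport ρ, ρ x = 0 := fun x hx => image_eq_zero_of_notMem_tsupport hx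
  -- Stated for an arbitrary metric because it is applied to all γ t near t = 0 with the same K.
  have hint : ∀ (g' : Metric n M) (F : M → ℝ), Continuous F →
      ∫ x, ρ x * F x ∂(volumeMeasure g')
        = ∫ y in K, inChart ρ p y * (inChart F p y * density g' p y) := by
    intro g' F hFc
    rw [integral_volumeMeasure_of_support g' p (hρ.continuous.fun_mul hFc) fun x hx => by
      rw [hz x fun h => hx (hsupp h), zero_mul]]
    rw [← setIntegral_eq_of_subset_of_forall_sdiff_eq_zero hU.measurableSet hKU]
    · refine integral_congr_ae (Eventually.of_forall fun y => ?_)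
      exact mul_assoc _ _ _
    · intro y hy
      rw [inChart, hz _ (symm_notMem_of_notMem_image hy.1 hy.2), zero_mul]
  have hρ' : SmoothFam (fun _ => inChart ρ p) (Ioo (-ε) ε) (coordDomain n p) :=
    (smooth_inChart hρ p).comp contDiffOn_snd fun q hq => hq.2
  have hfam := hρ'.mul (hF1.mul hF2)
  have hder := hfam.hasDerivAt_integral isOpen_Ioo hU (mem_of_mem_nhds hI) hK hKU
  rw [hint g _ ((H.continuous_variationIntegrand hf hh).fun_add
    (H.continuous_divergenceTerm he hh he))]
  refine (hder.congr_of_eventuallyEq ?_).congr_deriv ?_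
  · filter_upwards [H.eventually_continuous_functionalIntegrand] with t ht
    exact hint (γ t) _ ht
  · refine setIntegral_congr_fun hK.measurableSet fun y hy => ?_
    -- The derivative under the integral is evaluated by the product rule; the density contributes
    -- half the trace times the integrand, cancelling the correction in
    -- `hasDerivAt_functionalIntegrand`.
    have h1 := hfam.hasDerivAt isOpen_Ioo hU (mem_of_mem_nhds hI) (hKU hy)
    have h2 := ((H.hasDerivAt_functionalIntegrand hf ((extChartAt (𝓡 n) p).symm y)).fun_mul
      (hF3 y (hKU hy))).const_mul (inChart ρ p y)
    refine (h1.unique h2).trans ?_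
    simp only [inChart, H.metric_zero, H.function_zero]
    ring

/-- Summing the localized derivatives over the partition leaves the integral of `variationIntegrand`
plus that of `divergenceTerm`, and the latter is zero. -/
theorem hasDerivAt_functional [T2Space M] (H : IsVariation g f v h γ φ)
    (hf : ContMDiff (𝓡 n) 𝓘(ℝ, ℝ) ∞ f) (hh : ContMDiff (𝓡 n) 𝓘(ℝ, ℝ) ∞ h) :
    HasDerivAt (fun t => functional (γ t) (φ t))
      (∫ x, variationIntegrand g f v h x ∂(volumeMeasure g)) 0 := by
  obtain ⟨s, ρ, hρ, hsupp, h1⟩ := exists_partition (n := n) (M := M)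
  have he : ContMDiff (𝓡 n) 𝓘(ℝ, ℝ) ∞ fun z => Real.exp (-f z) :=
    Real.contDiff_exp.comp_contMDiff hf.neg
  have hv := H.continuous_variationIntegrand hf hh
  have hd := H.continuous_divergenceTerm he hh he
  have hsum := HasDerivAt.fun_sum (u := s) fun p _ =>
    H.hasDerivAt_integral_of_tsupport hf hh (hρ p) (hsupp p)
  rw [← integral_eq_sum_partition hρ h1 g (hv.fun_add hd), integral_add
    (integrable_of_continuous g hv) (integrable_of_continuous g hd),
    H.integral_divergenceTerm he hh he, add_zero] at hsum
  refine hsum.congr_of_eventuallyEq ?_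
  filter_upwards [H.eventually_continuous_functionalIntegrand] with t ht
  exact integral_eq_sum_partition hρ h1 (γ t) ht

end IsVariation

end FirstVariation

end Perelman

end

theorem theorem6p1 {n : ℕ} {M : Type*} [TopologicalSpace M]
    [ChartedSpace (EuclideanSpace ℝ (Fin n)) M] [IsManifold (𝓡 n) ∞ M]
    [CompactSpace M] [T2Space M] [MeasurableSpace M] [BorelSpace M]
    (g : Perelman.Metric n M) (f : M → ℝ) (hf : ContMDiff (𝓡 n) 𝓘(ℝ, ℝ) ∞ f)
    (v : Perelman.TwoTensor n M) (hv : Perelman.IsSmoothTensor v)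
    (hv_symm : ∀ (x : M) (X Y : TangentSpace (𝓡 n) x), v x X Y = v x Y X)
    (h : M → ℝ) (hh : ContMDiff (𝓡 n) 𝓘(ℝ, ℝ) ∞ h)
    (γ : ℝ → Perelman.Metric n M) (φ : ℝ → M → ℝ)
    (hγφ : Perelman.IsVariation g f v h γ φ) :
    (∀ x : M, HasDerivAt (fun t => Perelman.scalarCurvature (γ t) x)
      (-Perelman.laplacian g (Perelman.trace g v) x + Perelman.divDiv g v x
        - Perelman.pairing g v x (Perelman.ricci g x)) 0) ∧
    (∀ᶠ t in 𝓝 (0 : ℝ), Integrable (Perelman.functionalIntegrand (γ t) (φ t))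
      (Perelman.volumeMeasure (γ t))) ∧
    Integrable (Perelman.variationIntegrand g f v h) (Perelman.volumeMeasure g) ∧
    HasDerivAt (fun t => Perelman.functional (γ t) (φ t))
      (∫ x, Perelman.variationIntegrand g f v h x ∂(Perelman.volumeMeasure g)) 0 :=
  ⟨hγφ.hasDerivAt_scalarCurvature,
    hγφ.eventually_continuous_functionalIntegrand.mono fun t ht =>
      Perelman.integrable_of_continuous (γ t) ht,
    Perelman.integrable_of_continuous g (hγφ.continuous_variationIntegrand hf hh),
    hγφ.hasDerivAt_functional hf hh⟩
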